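/- Let $f(q)=\sum_{r\ge 1}|a_r|^2q^r$ on $[-1,1]$ with real $a_r$ and $\sum_{r\ge1}|a_r|^2=1$. Assume that $f$ is convex on $[-1,1]$ and that $f$ is twice continuously differentiable up to the boundary of $[-1,1]$. For $\sigma,\sigma'\in\{\pm1\}^N$ let $q_{\sigma,\sigma'}=\frac1N\sum_{i=1}^N\sigma_i\sigma_i'$. For each $N\ge1$ let $(K_N(\sigma))_{\sigma\in\{\pm1\}^N}$ be a centered Gaussian process with covariance $\mathbb E(K_N(\sigma)K_N(\sigma'))=\frac N2 f(q_{\sigma,\sigma'})$; the processes for different $N$ are defined on one probability space, with arbitrary joint distribution. For $\beta,h\in\mathbb R$ let $H_N(\sigma,h)=-K_N(\sigma)-h\sum_i\sigma_i$, $Z_N=\sum_\sigma e^{-\beta H_N(\sigma,h)}$ and $P_N(\beta,h)=\frac1N\mathbb E\ln Z_N$. A random overlap structure (ROSt) $\mu$ is a probability space carrying a random nonincreasing sequence $(\xi_n)_{n\in\mathbb N}$ and a random real matrix $(q_{n,n'})_{n,n'\in\mathbb N}$ such that almost surely $\xi_n\ge0$, $0<\sum_n\xi_n<\infty$, $q$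 is symmetric positive semidefinite, and $q_{n,n}=1$ for all $n$. Put $\phi(q)=qf'(q)-f(q)$ (with one-sided derivatives at $\pm1$). For $M\ge1$, given the configuration $(\xi,q)$ of a ROSt, let $(\kappa_\alpha)_{\alpha\in\mathbb N}$ and $(V_{\alpha,\sigma})_{\alpha\in\mathbb N,\,\sigma\in\{\pm1\}^M}$ be independent centered Gaussian families with $$\mathbb E(\kappa_\alpha\kappa_{\alpha'})=\tfrac12\phi(q_{\alpha,\alpha'}),\qquad \mathbb E(V_{\alpha,\sigma}V_{\alpha',\sigma'})=\tfrac M2 f'(q_{\alpha,\alpha'})\,q_{\sigma,\sigma'},$$ and define $$G_M(\beta,h;\mu)=\frac1M\,\mathbb E\left(\ln\frac{\sum_{\alpha,\sigma}\xi_\alpha e^{\beta(V_{\alpha,\sigma}+h\sum_i\sigma_i)}}{\sum_\alpha\xi_\alpha e^{\beta\sqrt M\kappa_\alpha}}\right),$$ the expectation being over $\kappa$, $V$ and the ROSt. Then, for all $\beta,h\in\mathbb R$, each $\ln Z_N$ is integrable, the limit $P(\beta,h)=\lim_{N\to\infty}P_N(\beta,h)$ exists in $\mathbb R$ and does not depend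 on the realization of the processes $K_N$, and $\frac1N\ln Z_N\to P(\beta,h)$ almost surely. If moreover $\beta\ge0$, then for every $M\ge1$ and every ROSt $\mu$ the functional $G_M(\beta,h;\mu)$ is well defined (the Gaussian families exist for almost every configuration of the ROSt, and the logarithm is integrable), and: i) for every $M\ge1$, $\displaystyle P_M(\beta,h)\le\inf_{\mu:\,\mathrm{ROSt}}G_M(\beta,h;\mu)$; ii) $\displaystyle P(\beta,h)=\lim_{M\to\infty}\ \inf_{\mu:\,\mathrm{ROSt}}G_M(\beta,h;\mu)$. -/

import Mathlib

open MeasureTheory ProbabilityTheory Filter Topology Set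

universe u v

noncomputable section

/-! ### Spin configurations -/

/-- Configurations of `N` Ising spins; `ℤˣ = {1, -1}`. -/
abbrev SpinConfig (N : ℕ) : Type := Fin N → ℤˣ

/-- The value `±1` of a spin, as a real number. -/
def spinVal (s : ℤˣ) : ℝ := ((s : ℤ) : ℝ)

/-- The overlap `q_{σ,σ'} = N⁻¹ ∑ᵢ σᵢ σ'ᵢ`. -/
def overlap {N : ℕ} (σ σ' : SpinConfig N) : ℝ :=
  (1 / (N : ℝ)) * ∑ i, spinVal (σ i) * spinVal (σ' i)

/-- The magnetic field term `h · σ = h ∑ᵢ σᵢ`. -/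
def fieldTerm {N : ℕ} (h : ℝ) (σ : SpinConfig N) : ℝ := ∑ i, h * spinVal (σ i)

/-! ### The covariance function -/

/-- The power series `f(q) = ∑_{r ≥ 1} |a_r|² q^r`. -/
def covFun (a : ℕ → ℝ) (q : ℝ) : ℝ := ∑' r : ℕ, |a (r + 1)| ^ 2 * q ^ (r + 1)

/-- The derivative `f'` on `[-1, 1]` (one-sided at the endpoints). -/
def covDeriv (f : ℝ → ℝ) (q : ℝ) : ℝ := derivWithin f (Icc (-1) 1) q

/-- `φ(q) = q f'(q) - f(q)`. -/
def covPhi (f : ℝ → ℝ) (q : ℝ) : ℝ := q * covDeriv f q - f q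

/-! ### Gaussian families -/

/-- `X` is a centered (jointly) Gaussian family under `P`, with covariance `C`. -/
structure IsCenteredGaussian {ι Ω : Type*} [MeasurableSpace Ω]
    (X : ι → Ω → ℝ) (P : Measure Ω) (C : ι → ι → ℝ) : Prop where
  gaussian : IsGaussianProcess X P
  mean_zero : ∀ i, ∫ ω, X i ω ∂P = 0
  covariance : ∀ i j, ∫ ω, X i ω * X j ω ∂P = C i j

/-- `P` is the law, on `ι → ℝ`, of a centered Gaussian family with covariance `C`. -/
def IsGaussianLaw {ι : Type*} (P : Measure (ι → ℝ)) (C : ι → ι → ℝ) : Prop :=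
  IsCenteredGaussian (fun (i : ι) (x : ι → ℝ) => x i) P C

open Classical in
/-- The law of the centered Gaussian family with covariance `C`
(and `0` if there is no such law, i.e. if `C` is not a positive semidefinite form). -/
def gaussianLaw {ι : Type*} (C : ι → ι → ℝ) : Measure (ι → ℝ) :=
  if hC : ∃ P : Measure (ι → ℝ), IsGaussianLaw P C then hC.choose else 0

theorem gaussianLaw_spec {ι : Type*} {C : ι → ι → ℝ}
    (hC : ∃ P : Measure (ι → ℝ), IsGaussianLaw P C) : IsGaussianLaw (gaussianLaw C) C := by
  unfold gaussianLaw
  rw [dif_pos hC]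
  exact hC.choose_spec

/-! ### The mean-field model -/

/-- `H_N(σ, h) = - K_N(σ) - h · σ`, for a given realization `k` of the interaction `K_N`. -/
def hamiltonian {N : ℕ} (h : ℝ) (k : SpinConfig N → ℝ) (σ : SpinConfig N) : ℝ :=
  - k σ - fieldTerm h σ

/-- The partition function `Z_N = ∑_σ exp (- β H_N(σ, h))`. -/
def partitionFn {N : ℕ} (β h : ℝ) (k : SpinConfig N → ℝ) : ℝ :=
  ∑ σ, Real.exp (-(β * hamiltonian h k σ))

/-- `𝒫_N(β, h; ω) = N⁻¹ ln Z_N(β, h; ω)`. -/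
def randomPressure {Ω : Type*} {N : ℕ} (β h : ℝ) (K : SpinConfig N → Ω → ℝ) (ω : Ω) : ℝ :=
  (1 / (N : ℝ)) * Real.log (partitionFn β h (fun σ => K σ ω))

/-- `Q_N(β, h) = 𝔼 ln Z_N`. -/
def quenched {Ω : Type*} [MeasurableSpace Ω] {N : ℕ} (P : Measure Ω) (β h : ℝ)
    (K : SpinConfig N → Ω → ℝ) : ℝ :=
  ∫ ω, Real.log (partitionFn β h (fun σ => K σ ω)) ∂P

/-- `P_N(β, h) = N⁻¹ Q_N(β, h)`. -/
def pressure {Ω : Type*} [MeasurableSpace Ω] {N : ℕ} (P : Measure Ω) (β h : ℝ)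
    (K : SpinConfig N → Ω → ℝ) : ℝ :=
  (1 / (N : ℝ)) * quenched P β h K

/-- `K_N` is a centered Gaussian process indexed by the spin configurations, with covariance
`𝔼 (K_N(σ) K_N(σ')) = (N / 2) f(q_{σ,σ'})`. -/
def IsInteraction {Ω : Type*} [MeasurableSpace Ω] (P : Measure Ω) (f : ℝ → ℝ) {N : ℕ}
    (K : SpinConfig N → Ω → ℝ) : Prop :=
  IsCenteredGaussian K P (fun σ σ' => (N : ℝ) / 2 * f (overlap σ σ'))

/-! ### Random overlap structures -/

/-- A random overlap structure: a probability space carrying a random ordered sequence of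
nonnegative weights `ξ`, with finite and nonzero sum, and a random positive semidefinite
overlap matrix `q` with unit diagonal. -/
structure ROSt where
  Ω : Type u
  mΩ : MeasurableSpace Ω
  μ : Measure Ω
  isProb : IsProbabilityMeasure μ
  ξ : ℕ → Ω → ℝ
  q : ℕ → ℕ → Ω → ℝ
  measurable_ξ : ∀ n, Measurable (ξ n)
  measurable_q : ∀ n n', Measurable (q n n')
  ordered : ∀ᵐ ω ∂μ, Antitone (fun n => ξ n ω)
  nonneg : ∀ᵐ ω ∂μ, ∀ n, 0 ≤ ξ n ω
  summable : ∀ᵐ ω ∂μ, Summable (fun n => ξ n ω)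
  sum_pos : ∀ᵐ ω ∂μ, 0 < ∑' n, ξ n ω
  posSemidef : ∀ᵐ ω ∂μ, (Matrix.of (fun n n' => q n n' ω)).PosSemidef
  diag_one : ∀ᵐ ω ∂μ, ∀ n, q n n ω = 1

attribute [instance] ROSt.mΩ ROSt.isProb

namespace ROSt

/-- The covariance `φ(q_{α,α'}) / 2` of `κ`, at a given configuration of the ROSt. -/
def kappaCov (S : ROSt) (f : ℝ → ℝ) (ω : S.Ω) : ℕ → ℕ → ℝ :=
  fun n n' => covPhi f (S.q n n' ω) / 2

/-- The covariance `(M / 2) f'(q_{α,α'}) q_{σ,σ'}` of `V`, at a given configuration of the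
ROSt. -/
def cavityCov (S : ROSt) (f : ℝ → ℝ) (M : ℕ) (ω : S.Ω) :
    ℕ × SpinConfig M → ℕ × SpinConfig M → ℝ :=
  fun x y => (M : ℝ) / 2 * covDeriv f (S.q x.1 y.1 ω) * overlap x.2 y.2

/-- The joint law of the independent Gaussian families `κ`, `V`, at a given configuration of the
ROSt. -/
def fieldLaw (S : ROSt) (f : ℝ → ℝ) (M : ℕ) (ω : S.Ω) :
    Measure ((ℕ → ℝ) × (ℕ × SpinConfig M → ℝ)) :=
  (gaussianLaw (S.kappaCov f ω)).prod (gaussianLaw (S.cavityCov f M ω))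

/-- `ln [ ∑_{α,σ} ξ_α exp (β (V_{α,σ} + h · σ)) / ∑_α ξ_α exp (β √M κ_α) ]`, as a function of the
configuration of the ROSt and of the pair of fields `(κ, V)`. -/
def logRatio (S : ROSt) (β h : ℝ) (M : ℕ) (ω : S.Ω)
    (x : (ℕ → ℝ) × (ℕ × SpinConfig M → ℝ)) : ℝ :=
  Real.log
    ((∑' n, ∑ σ : SpinConfig M, S.ξ n ω * Real.exp (β * (x.2 (n, σ) + fieldTerm h σ))) /
      (∑' n, S.ξ n ω * Real.exp (β * Real.sqrt (M : ℝ) * x.1 n)))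

/-- The functional `G_M(β, h; μ)`: the mean of `M⁻¹ logRatio` over `κ`, `V` and the ROSt. -/
def G (f : ℝ → ℝ) (β h : ℝ) (M : ℕ) (S : ROSt) : ℝ :=
  (1 / (M : ℝ)) * ∫ ω, (∫ x, S.logRatio β h M ω x ∂(S.fieldLaw f M ω)) ∂S.μ

/-- The expectation in the definition of `G` is meaningful: for almost every configuration of the
ROSt the two Gaussian families exist, and `logRatio` is integrable. -/
structure GWellDefined (f : ℝ → ℝ) (β h : ℝ) (M : ℕ) (S : ROSt) : Prop where
  kappa_law : ∀ᵐ ω ∂S.μ, IsGaussianLaw (gaussianLaw (S.kappaCov f ω)) (S.kappaCov f ω)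
  cavity_law : ∀ᵐ ω ∂S.μ, IsGaussianLaw (gaussianLaw (S.cavityCov f M ω)) (S.cavityCov f M ω)
  integrable_fields : ∀ᵐ ω ∂S.μ, Integrable (S.logRatio β h M ω) (S.fieldLaw f M ω)
  integrable_rost : Integrable (fun ω => ∫ x, |S.logRatio β h M ω x| ∂(S.fieldLaw f M ω)) S.μ
  integrable_mean : Integrable (fun ω => ∫ x, S.logRatio β h M ω x ∂(S.fieldLaw f M ω)) S.μ

end ROSt

end

/-!
The statement rests on two facts about the mean free energy `𝔼 ln ∑ᵢ wᵢ exp Xᵢ` of a centered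
Gaussian family `X` with weights `w`.

*Comparison.* Rotating one Gaussian family into an independent one and integrating by parts, the mean
free energy is seen to increase with the quantities `Cᵢᵢ - Cᵢⱼ`, where `C` is the covariance; if they
change by at most `c`, the mean free energy changes by at most `c / 2`
(`IsCenteredGaussian.integral_lse_le`). Exhausting the index set by finite subsets, the comparison
extends to countably many indices and summable weights
(`IsCenteredGaussian.integral_lse_le_of_summable`).

*Concentration.* The same rotation bounds the fourth centered moment of the free energy by a
multiple of the squared maximal variance (`lintegral_lse_sub_integral_pow_four_le`).

The variances `N / 2` of the interaction do not depend on the configuration, so that comparisons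
reduce to inequalities between covariances. Convexity of `f` makes `𝔼 ln Z_N` superadditive
(`meanLogPartition_superadditive`); by Fekete's lemma the pressure converges to its supremum, and
concentration, with a bound of order `N⁻²` on the fourth centered moment of `N⁻¹ ln Z_N`, gives
almost sure convergence (`ae_tendsto_randomPressure`). The upper bound is the tangent inequality
`f(x) + f'(x) (y - x) ≤ f(y)`, with `x` an overlap of the random overlap structure and `y` an overlap
of spin configurations: it compares the cavity field `V` with the sum of `K_M` and `√M κ`
(`ROSt.IsRegular.meanLogPartition_le_integral_logRatio`).

For the converse, split a system of `N + M` spins into a bath of `N` spins and `M` cavity spins. The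
bath configurations, weighted by the Boltzmann factors of the part of the interaction that does not
see the cavity spins, form an overlap structure. A Taylor expansion of `f` shows that its functional,
averaged over this part of the interaction, is at most
`M⁻¹ (𝔼 ln Z_{N+M} - 𝔼 ln Z_N)` up to an error of order `1 / N` (`exists_G_le_increment`). Since
`𝔼 ln Z_N ≤ N P`, this increment is at most `M (P + ε)` for arbitrarily large `N`, hence
`inf G_M ≤ P` for every `M`.

A Gaussian law with a given covariance is realized as the image of white noise under a Cholesky
factor of the covariance. This gives the existence of the fields, and also the measurability of
their law in the configuration of the overlap structure.
-/

noncomputable section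

/-! ### Positive semidefinite kernels -/

theorem posSemidef_of_iff {ι : Type*} {C : ι → ι → ℝ} :
    (Matrix.of C).PosSemidef ↔ (∀ i j, C i j = C j i) ∧
      ∀ (s : Finset ι) (x : ι → ℝ), 0 ≤ ∑ i ∈ s, ∑ j ∈ s, x i * C i j * x j := by
  classical
  constructor
  · intro hC
    refine ⟨fun i j => by simpa using hC.1.apply j i, fun s x => ?_⟩
    have h := hC.2 (Finsupp.onFinset s (fun i => if i ∈ s then x i else 0)
      (fun i hi => by by_contra h; simp [h] at hi))
    rw [Finsupp.onFinset_sum _ (by simp)] at h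
    refine h.trans_eq (Finset.sum_congr rfl fun i hi => ?_)
    rw [Finsupp.onFinset_sum _ (by simp)]
    exact Finset.sum_congr rfl fun j hj => by simp [hi, hj]
  · rintro ⟨hsymm, hnn⟩
    exact ⟨Matrix.IsHermitian.ext fun i j => by simpa using hsymm j i,
      fun x => by simpa [Finsupp.sum] using hnn x.support x⟩

theorem posSemidef_of_comp {ι κ : Type*} {C : ι → ι → ℝ} (hC : (Matrix.of C).PosSemidef)
    (e : κ → ι) : (Matrix.of fun i j => C (e i) (e j)).PosSemidef :=
  hC.submatrix e

theorem posSemidef_of_mul {ι : Type*} {C D : ι → ι → ℝ} (hC : (Matrix.of C).PosSemidef)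
    (hD : (Matrix.of D).PosSemidef) : (Matrix.of fun i j => C i j * D i j).PosSemidef :=
  hC.hadamard hD

theorem posSemidef_of_const_mul {ι : Type*} {C : ι → ι → ℝ} (hC : (Matrix.of C).PosSemidef)
    {c : ℝ} (hc : 0 ≤ c) : (Matrix.of fun i j => c * C i j).PosSemidef :=
  hC.smul hc

theorem posSemidef_of_add {ι : Type*} {C D : ι → ι → ℝ} (hC : (Matrix.of C).PosSemidef)
    (hD : (Matrix.of D).PosSemidef) : (Matrix.of fun i j => C i j + D i j).PosSemidef :=
  hC.add hD

theorem posSemidef_of_pow {ι : Type*} {C : ι → ι → ℝ} (hC : (Matrix.of C).PosSemidef) (r : ℕ) :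
    (Matrix.of fun i j => C i j ^ r).PosSemidef := by
  induction r with
  | zero =>
    refine posSemidef_of_iff.2 ⟨by simp, fun s x => ?_⟩
    simp only [pow_zero, mul_one, ← Finset.mul_sum, ← Finset.sum_mul]
    exact mul_self_nonneg _
  | succ r ih =>
    simp only [pow_succ]
    exact posSemidef_of_mul ih hC

theorem posSemidef_of_tendsto {ι κ : Type*} {l : Filter κ} [l.NeBot] {D : κ → ι → ι → ℝ}
    {C : ι → ι → ℝ} (hD : ∀ᶠ k in l, (Matrix.of (D k)).PosSemidef)
    (h : ∀ i j, Tendsto (fun k => D k i j) l (𝓝 (C i j))) : (Matrix.of C).PosSemidef := by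
  refine posSemidef_of_iff.2 ⟨fun i j => ?_, fun s x => ?_⟩
  · refine tendsto_nhds_unique_of_eventuallyEq (h i j) (h j i) ?_
    filter_upwards [hD] with k hk using (posSemidef_of_iff.1 hk).1 i j
  · refine ge_of_tendsto (tendsto_finsetSum s fun i _ => tendsto_finsetSum s fun j _ =>
      ((h i j).const_mul (x i)).mul_const (x j)) ?_
    filter_upwards [hD] with k hk using (posSemidef_of_iff.1 hk).2 s x

/-- A power series with nonnegative coefficients preserves positive semidefiniteness. -/
theorem posSemidef_of_powerSeries {ι : Type*} {C : ι → ι → ℝ} (hC : (Matrix.of C).PosSemidef)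
    {c : ℕ → ℝ} (hc : ∀ r, 0 ≤ c r) (e : ℕ → ℕ)
    (hs : ∀ i j, Summable fun r => c r * C i j ^ e r) :
    (Matrix.of fun i j => ∑' r, c r * C i j ^ e r).PosSemidef := by
  refine posSemidef_of_tendsto (l := atTop) (D := fun n i j => ∑ r ∈ Finset.range n,
    c r * C i j ^ e r) (Eventually.of_forall fun n => ?_) fun i j => (hs i j).hasSum.tendsto_sum_nat
  induction n with
  | zero => exact Matrix.PosSemidef.zero
  | succ n ih =>
    simp only [Finset.sum_range_succ]
    exact posSemidef_of_add ih (posSemidef_of_const_mul (posSemidef_of_pow hC _) (hc n))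

theorem quadratic_nonneg {ι : Type*} {C : ι → ι → ℝ} (hC : (Matrix.of C).PosSemidef)
    (s : Finset ι) (x : ι → ℝ) (k : ι) (t : ℝ) :
    0 ≤ ∑ i ∈ s, ∑ j ∈ s, x i * C i j * x j + 2 * t * ∑ i ∈ s, x i * C i k + t ^ 2 * C k k := by
  -- evaluate the form obtained by adjoining one more copy of the point `k`
  have h := (posSemidef_of_iff.1 (posSemidef_of_comp hC
    (fun o : Option ι => o.elim k id))).2 (Finset.insertNone s) (fun o => o.elim t x)
  simp only [Finset.sum_insertNone, Option.elim, id] at h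
  refine h.trans_eq ?_
  have h1 : ∑ j ∈ s, t * C k j * x j = t * ∑ i ∈ s, x i * C i k := by
    rw [Finset.mul_sum]
    exact Finset.sum_congr rfl fun j _ => by rw [(posSemidef_of_iff.1 hC).1 k j]; ring
  rw [Finset.sum_add_distrib, h1, ← Finset.sum_mul]
  ring

theorem abs_le_one_of_diag_eq_one {ι : Type*} {C : ι → ι → ℝ} (hC : (Matrix.of C).PosSemidef)
    (h1 : ∀ i, C i i = 1) (i j : ι) : C i j ∈ Icc (-1 : ℝ) 1 := by
  have hp := quadratic_nonneg hC {i} 1 j 1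
  have hm := quadratic_nonneg hC {i} 1 j (-1)
  simp only [Finset.sum_singleton, Pi.one_apply, h1] at hp hm
  constructor <;> linarith

theorem eq_zero_of_diag_eq_zero {ι : Type*} {C : ι → ι → ℝ} (hC : (Matrix.of C).PosSemidef)
    {k : ι} (hk : C k k = 0) (i : ι) : C i k = 0 := by
  by_contra hne
  have h := quadratic_nonneg hC {i} 1 k (-(C i i + 1) / (2 * C i k))
  simp only [Finset.sum_singleton, Pi.one_apply, hk] at h
  have e : 2 * (-(C i i + 1) / (2 * C i k)) * (1 * C i k) = -(C i i + 1) := by field_simp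
  rw [e] at h
  linarith

/-! ### Cholesky factorization -/

/-- The successive Schur complements of a kernel on `ℕ`, obtained by eliminating the indices
`0, 1, 2, …` one at a time; an index with zero pivot is left alone, since then `x / 0 = 0`. -/
def schurComplement (C : ℕ → ℕ → ℝ) : ℕ → ℕ → ℕ → ℝ
  | 0 => C
  | k + 1 => fun n m => schurComplement C k n m -
      schurComplement C k n k * schurComplement C k m k / schurComplement C k k k

/-- The Cholesky factor of a positive semidefinite kernel on `ℕ`. -/
def choleskyFactor (C : ℕ → ℕ → ℝ) (n k : ℕ) : ℝ :=
  schurComplement C k n k / Real.sqrt (schurComplement C k k k)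

theorem schurComplement_posSemidef {C : ℕ → ℕ → ℝ} (hC : (Matrix.of C).PosSemidef) (k : ℕ) :
    (Matrix.of (schurComplement C k)).PosSemidef := by
  induction k with
  | zero => exact hC
  | succ k ih =>
    set R := schurComplement C k with hR
    have hsymm := (posSemidef_of_iff.1 ih).1
    refine posSemidef_of_iff.2 ⟨fun i j => ?_, fun s x => ?_⟩
    · simp only [schurComplement, ← hR]
      rw [hsymm i j, mul_comm]
    · -- the Schur complement is the minimum over `t` of the form at `x + t e_k`
      have h := quadratic_nonneg ih s x k (-(∑ i ∈ s, x i * R i k) / R k k)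
      have e : ∑ i ∈ s, ∑ j ∈ s, x i * schurComplement C (k + 1) i j * x j =
          ∑ i ∈ s, ∑ j ∈ s, x i * R i j * x j - (∑ i ∈ s, x i * R i k) ^ 2 / R k k := by
        rw [sq, Finset.sum_mul_sum, Finset.sum_div, ← Finset.sum_sub_distrib]
        refine Finset.sum_congr rfl fun i _ => ?_
        rw [Finset.sum_div, ← Finset.sum_sub_distrib]
        refine Finset.sum_congr rfl fun j _ => ?_
        simp only [schurComplement, ← hR]
        ring
      rw [e]
      by_cases h0 : R k k = 0
      · simpa [h0] using (posSemidef_of_iff.1 ih).2 s x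
      · refine h.trans_eq ?_
        field_simp
        ring

theorem schurComplement_eq_zero {C : ℕ → ℕ → ℝ} (hC : (Matrix.of C).PosSemidef) {k n : ℕ}
    (hn : n < k) (m : ℕ) : schurComplement C k n m = 0 := by
  induction k generalizing m with
  | zero => omega
  | succ k ih =>
    have hP := schurComplement_posSemidef hC k
    have hsymm := (posSemidef_of_iff.1 hP).1
    simp only [schurComplement]
    rcases Nat.lt_succ_iff_lt_or_eq.1 hn with h | rfl
    · simp [ih h]
    · by_cases h0 : schurComplement C n n n = 0
      · rw [h0, hsymm n m, eq_zero_of_diag_eq_zero hP h0 m]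
        simp
      · rw [hsymm m n]
        field_simp
        ring

theorem sum_choleskyFactor_mul {C : ℕ → ℕ → ℝ} (hC : (Matrix.of C).PosSemidef) (K n m : ℕ) :
    ∑ k ∈ Finset.range K, choleskyFactor C n k * choleskyFactor C m k =
      C n m - schurComplement C K n m := by
  induction K with
  | zero => simp [schurComplement]
  | succ K ih =>
    have h0 : 0 ≤ schurComplement C K K K :=
      (schurComplement_posSemidef hC K).diag_nonneg (i := K)
    rw [Finset.sum_range_succ, ih]
    simp only [choleskyFactor, schurComplement]
    rw [div_mul_div_comm, Real.mul_self_sqrt h0]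
    ring

theorem choleskyFactor_eq_zero {C : ℕ → ℕ → ℝ} (hC : (Matrix.of C).PosSemidef) {n k : ℕ}
    (h : n < k) : choleskyFactor C n k = 0 := by
  rw [choleskyFactor, schurComplement_eq_zero hC h, zero_div]

theorem measurable_choleskyFactor {Ω : Type*} [MeasurableSpace Ω] {C : Ω → ℕ → ℕ → ℝ}
    (hC : ∀ n m, Measurable fun ω => C ω n m) (n k : ℕ) :
    Measurable fun ω => choleskyFactor (C ω) n k := by
  have h : ∀ k n m, Measurable fun ω => schurComplement (C ω) k n m := by
    intro k
    induction k with
    | zero => exact hC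
    | succ k ih =>
      intro n m
      simp only [schurComplement]
      exact (ih n m).sub (((ih n k).mul (ih m k)).div (ih k k))
  exact (h k n k).div (h k k k).sqrt

/-! ### Centered Gaussian families -/

namespace IsCenteredGaussian

variable {ι κ τ Ω Ω' : Type*} [MeasurableSpace Ω] [MeasurableSpace Ω'] {P : Measure Ω}
  {Q : Measure Ω'} {X : ι → Ω → ℝ} {Y : κ → Ω' → ℝ} {C : ι → ι → ℝ} {D : κ → κ → ℝ}

theorem isProbabilityMeasure (hX : IsCenteredGaussian X P C) : IsProbabilityMeasure P :=
  hX.gaussian.isProbabilityMeasure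

theorem aemeasurable (hX : IsCenteredGaussian X P C) (i : ι) : AEMeasurable (X i) P :=
  hX.gaussian.aemeasurable i

theorem aemeasurable_pi [Countable ι] (hX : IsCenteredGaussian X P C) :
    AEMeasurable (fun ω i => X i ω) P :=
  aemeasurable_pi_lambda _ hX.aemeasurable

theorem memLp (hX : IsCenteredGaussian X P C) (i : ι) {p : ENNReal} (hp : p ≠ ⊤) :
    MemLp (X i) p P :=
  (hX.gaussian.hasGaussianLaw_eval i).memLp hp

theorem integrable (hX : IsCenteredGaussian X P C) (i : ι) : Integrable (X i) P :=
  (hX.gaussian.hasGaussianLaw_eval i).integrable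

theorem integrable_mul (hX : IsCenteredGaussian X P C) (i j : ι) :
    Integrable (fun ω => X i ω * X j ω) P :=
  (hX.memLp i (p := 2) (by simp)).integrable_mul (hX.memLp j (p := 2) (by simp))

/-- Finite linear combinations of a centered Gaussian family. -/
theorem linear (hX : IsCenteredGaussian X P C) (s : τ → Finset ι) (A : τ → ι → ℝ) :
    IsCenteredGaussian (fun t ω => ∑ i ∈ s t, A t i * X i ω) P
      (fun t u => ∑ i ∈ s t, ∑ j ∈ s u, A t i * A u j * C i j) where
  gaussian := hX.gaussian.of_isGaussianProcess fun t => ⟨s t,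
    ∑ i : s t, A t i • ContinuousLinearMap.proj (R := ℝ) (φ := fun _ : s t => ℝ) i, fun ω => by
      rw [← Finset.sum_coe_sort (s t) fun i => A t i * X i ω]
      simp⟩
  mean_zero t := by
    rw [integral_finsetSum _ fun i _ => (hX.integrable i).const_mul _]
    simp [integral_const_mul, hX.mean_zero]
  covariance t u := by
    have h : ∀ ω, (∑ i ∈ s t, A t i * X i ω) * (∑ j ∈ s u, A u j * X j ω) =
        ∑ i ∈ s t, ∑ j ∈ s u, A t i * A u j * (X i ω * X j ω) := fun ω => by
      rw [Finset.sum_mul_sum]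
      exact Finset.sum_congr rfl fun i _ => Finset.sum_congr rfl fun j _ => by ring
    simp_rw [h]
    rw [integral_finsetSum _ fun i _ => integrable_finsetSum _ fun j _ =>
      (hX.integrable_mul i j).const_mul _]
    refine Finset.sum_congr rfl fun i _ => ?_
    rw [integral_finsetSum _ fun j _ => (hX.integrable_mul i j).const_mul _]
    exact Finset.sum_congr rfl fun j _ => by rw [integral_const_mul, hX.covariance]

theorem comp (hX : IsCenteredGaussian X P C) (p : τ → ι) :
    IsCenteredGaussian (fun t => X (p t)) P (fun t u => C (p t) (p u)) where
  gaussian := hX.gaussian.comp_right p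
  mean_zero _ := hX.mean_zero _
  covariance _ _ := hX.covariance _ _

theorem const_mul (hX : IsCenteredGaussian X P C) (c : ℝ) :
    IsCenteredGaussian (fun i ω => c * X i ω) P (fun i j => c ^ 2 * C i j) := by
  have h := hX.linear (fun i => {i}) (fun _ _ => c)
  simpa [sq] using h

/-- Linear combinations of two independent centered Gaussian families. -/
theorem prod (hX : IsCenteredGaussian X P C) (hY : IsCenteredGaussian Y Q D)
    (p : τ → ι) (q : τ → κ) (a b : τ → ℝ) :
    IsCenteredGaussian (fun t (ω : Ω × Ω') => a t * X (p t) ω.1 + b t * Y (q t) ω.2) (P.prod Q)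
      (fun t u => a t * a u * C (p t) (p u) + b t * b u * D (q t) (q u)) := by
  classical
  have := hX.isProbabilityMeasure
  have := hY.isProbabilityMeasure
  have hXi : ∀ i, Integrable (fun ω : Ω × Ω' => X i ω.1) (P.prod Q) := fun i =>
    (hX.integrable i).comp_fst Q
  have hYi : ∀ i, Integrable (fun ω : Ω × Ω' => Y i ω.2) (P.prod Q) := fun i =>
    (hY.integrable i).comp_snd P
  refine ⟨⟨fun I => ?_⟩, fun t => ?_, fun t u => ?_⟩
  · have h1 : HasGaussianLaw (fun ω : Ω × Ω' => (I.image p).restrict (X · ω.1)) (P.prod Q) := by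
      refine ⟨?_⟩
      have h := (hX.gaussian.hasGaussianLaw (I.image p))
      have e : (P.prod Q).map (fun ω : Ω × Ω' => (I.image p).restrict (X · ω.1)) =
          P.map (fun ω => (I.image p).restrict (X · ω)) := by
        conv_rhs => rw [← (measurePreserving_fst (μ := P) (ν := Q)).map_eq]
        rw [AEMeasurable.map_map_of_aemeasurable _ measurable_fst.aemeasurable]
        · rfl
        · rw [measurePreserving_fst.map_eq]
          exact h.aemeasurable
      rw [e]
      exact h.isGaussian_map
    have h2 : HasGaussianLaw (fun ω : Ω × Ω' => (I.image q).restrict (Y · ω.2)) (P.prod Q) := by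
      refine ⟨?_⟩
      have h := (hY.gaussian.hasGaussianLaw (I.image q))
      have e : (P.prod Q).map (fun ω : Ω × Ω' => (I.image q).restrict (Y · ω.2)) =
          Q.map (fun ω => (I.image q).restrict (Y · ω)) := by
        conv_rhs => rw [← (measurePreserving_snd (μ := P) (ν := Q)).map_eq]
        rw [AEMeasurable.map_map_of_aemeasurable _ measurable_snd.aemeasurable]
        · rfl
        · rw [measurePreserving_snd.map_eq]
          exact h.aemeasurable
      rw [e]
      exact h.isGaussian_map
    have h12 := IndepFun.hasGaussianLaw h1 h2
      (indepFun_prod₀ (hX.gaussian.hasGaussianLaw (I.image p)).aemeasurable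
        (hY.gaussian.hasGaussianLaw (I.image q)).aemeasurable)
    let L : ((I.image p → ℝ) × (I.image q → ℝ)) →L[ℝ] (I → ℝ) :=
      ContinuousLinearMap.pi fun t =>
        a t • (ContinuousLinearMap.proj (R := ℝ) (φ := fun _ : I.image p => ℝ)
          ⟨p t, Finset.mem_image_of_mem p t.2⟩).comp (ContinuousLinearMap.fst ℝ _ _) +
        b t • (ContinuousLinearMap.proj (R := ℝ) (φ := fun _ : I.image q => ℝ)
          ⟨q t, Finset.mem_image_of_mem q t.2⟩).comp (ContinuousLinearMap.snd ℝ _ _)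
    exact h12.map_fun L
  · rw [integral_add ((hXi _).const_mul _) ((hYi _).const_mul _), integral_const_mul,
      integral_const_mul, integral_fun_fst (fun x => X (p t) x), integral_fun_snd]
    simp [hX.mean_zero, hY.mean_zero]
  · have e : ∀ ω : Ω × Ω', (a t * X (p t) ω.1 + b t * Y (q t) ω.2) *
        (a u * X (p u) ω.1 + b u * Y (q u) ω.2) =
        (a t * a u * (X (p t) ω.1 * X (p u) ω.1) + b t * b u * (Y (q t) ω.2 * Y (q u) ω.2)) +
        (a t * b u * (X (p t) ω.1 * Y (q u) ω.2) + a u * b t * (X (p u) ω.1 * Y (q t) ω.2)) :=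
      fun ω => by ring
    have i1 : Integrable (fun ω : Ω × Ω' => X (p t) ω.1 * X (p u) ω.1) (P.prod Q) :=
      (hX.integrable_mul (p t) (p u)).comp_fst Q
    have i2 : Integrable (fun ω : Ω × Ω' => Y (q t) ω.2 * Y (q u) ω.2) (P.prod Q) :=
      (hY.integrable_mul (q t) (q u)).comp_snd P
    have i3 := (hX.integrable (p t)).mul_prod (hY.integrable (q u))
    have i4 := (hX.integrable (p u)).mul_prod (hY.integrable (q t))
    simp_rw [e]
    have i12 : Integrable (fun ω : Ω × Ω' => a t * a u * (X (p t) ω.1 * X (p u) ω.1) +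
        b t * b u * (Y (q t) ω.2 * Y (q u) ω.2)) (P.prod Q) :=
      (i1.const_mul _).add (i2.const_mul _)
    have i34 : Integrable (fun ω : Ω × Ω' => a t * b u * (X (p t) ω.1 * Y (q u) ω.2) +
        a u * b t * (X (p u) ω.1 * Y (q t) ω.2)) (P.prod Q) :=
      (i3.const_mul _).add (i4.const_mul _)
    rw [integral_add i12 i34, integral_add (i1.const_mul _) (i2.const_mul _),
      integral_add (i3.const_mul _) (i4.const_mul _)]
    simp_rw [integral_const_mul]
    rw [integral_prod_mul, integral_prod_mul, integral_fun_fst (fun x => X (p t) x * X (p u) x),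
      integral_fun_snd (fun x => Y (q t) x * Y (q u) x)]
    simp [hX.mean_zero, hX.covariance, hY.covariance]

theorem covariance_diag_nonneg (hX : IsCenteredGaussian X P C) (i : ι) : 0 ≤ C i i := by
  rw [← hX.covariance]
  exact integral_nonneg fun ω => mul_self_nonneg _

theorem map_eval (hX : IsCenteredGaussian X P C) (i : ι) :
    P.map (X i) = gaussianReal 0 (C i i).toNNReal := by
  have := hX.isProbabilityMeasure
  rw [(hX.gaussian.hasGaussianLaw_eval i).map_eq_gaussianReal, hX.mean_zero,
    variance_of_integral_eq_zero (hX.aemeasurable i) (hX.mean_zero i), ← hX.covariance]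
  simp [sq]

theorem cov_eq (hX : IsCenteredGaussian X P C) (i j : ι) : cov[X i, X j; P] = C i j := by
  have := hX.isProbabilityMeasure
  rw [covariance_eq_sub (hX.memLp i (by simp)) (hX.memLp j (by simp)), hX.mean_zero,
    hX.mean_zero, ← hX.covariance]
  simp

theorem charFunDual_restrict (hX : IsCenteredGaussian X P C) (I : Finset ι)
    [DecidableEq I] (L : StrongDual ℝ (I → ℝ)) :
    charFunDual (P.map fun ω => I.restrict (X · ω)) L =
      Complex.exp (-((∑ i : I, ∑ j : I, L (Pi.single i 1) * L (Pi.single j 1) * C i j : ℝ) : ℂ)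
        / 2) := by
  have := hX.isProbabilityMeasure
  have hlin := (hX.comp (fun i : I => (i : ι))).linear (fun _ : Unit => Finset.univ)
    (fun _ i => L (Pi.single i 1))
  have e : ∀ ω, L (I.restrict (X · ω)) = ∑ i : I, L (Pi.single i 1) * X i ω := fun ω => by
    conv_lhs => rw [← Finset.univ_sum_single (I.restrict (X · ω)), map_sum]
    refine Finset.sum_congr rfl fun i _ => ?_
    have : (Pi.single i (I.restrict (X · ω) i) : I → ℝ) = X i ω • Pi.single i 1 := by
      rw [← Pi.single_smul]; simp
    rw [this, map_smul, smul_eq_mul, mul_comm]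
  rw [(hX.gaussian.hasGaussianLaw I).charFunDual_map_eq_fun L]
  simp_rw [e]
  rw [variance_of_integral_eq_zero (hlin.aemeasurable ()) (hlin.mean_zero ())]
  have h2 := hlin.covariance () ()
  simp_rw [← sq] at h2
  rw [h2, hlin.mean_zero ()]
  simp [neg_div]

/-- The law of a centered Gaussian family is determined by its covariance. -/
theorem map_eq [Countable ι] {Y : ι → Ω' → ℝ} (hX : IsCenteredGaussian X P C)
    (hY : IsCenteredGaussian Y Q C) :
    P.map (fun ω i => X i ω) = Q.map (fun ω i => Y i ω) := by
  classical
  have := hX.isProbabilityMeasure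
  have := hY.isProbabilityMeasure
  refine IsProjectiveLimit.unique
    (P := fun I : Finset ι => Q.map fun ω => I.restrict (Y · ω)) (fun I => ?_)
    (isProjectiveLimit_map hY.aemeasurable_pi)
  rw [isProjectiveLimit_map hX.aemeasurable_pi I]
  have := (hX.gaussian.hasGaussianLaw I).isGaussian_map
  have := (hY.gaussian.hasGaussianLaw I).isGaussian_map
  exact Measure.ext_of_charFunDual (funext fun L => by
    rw [hX.charFunDual_restrict I L, hY.charFunDual_restrict I L])

theorem integral_comp_eq [Countable ι] {Y : ι → Ω' → ℝ} (hX : IsCenteredGaussian X P C)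
    (hY : IsCenteredGaussian Y Q C) {F : (ι → ℝ) → ℝ} (hF : Measurable F) :
    ∫ ω, F (fun i => X i ω) ∂P = ∫ ω, F (fun i => Y i ω) ∂Q := by
  rw [← integral_map hX.aemeasurable_pi hF.aestronglyMeasurable, hX.map_eq hY,
    integral_map hY.aemeasurable_pi hF.aestronglyMeasurable]

theorem isGaussianLaw_map [Countable ι] (hX : IsCenteredGaussian X P C) :
    IsGaussianLaw (P.map fun ω i => X i ω) C where
  gaussian := ⟨fun I => ⟨by
    rw [AEMeasurable.map_map_of_aemeasurable (by fun_prop) hX.aemeasurable_pi]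
    exact (hX.gaussian.hasGaussianLaw I).isGaussian_map⟩⟩
  mean_zero i := by
    rw [integral_map hX.aemeasurable_pi (measurable_pi_apply i).aestronglyMeasurable, hX.mean_zero]
  covariance i j := by
    rw [integral_map hX.aemeasurable_pi
      (f := fun x : ι → ℝ => x i * x j)
      ((measurable_pi_apply i).mul (measurable_pi_apply j)).aestronglyMeasurable, hX.covariance]

theorem integrable_exp (hX : IsCenteredGaussian X P C) (i : ι) (t : ℝ) :
    Integrable (fun ω => Real.exp (t * X i ω)) P := by
  have h : Integrable (fun x : ℝ => Real.exp (t * x)) (P.map (X i)) := by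
    rw [hX.map_eval]; exact integrable_exp_mul_gaussianReal t
  exact h.comp_aemeasurable (hX.aemeasurable i)

theorem integral_exp (hX : IsCenteredGaussian X P C) (i : ι) (t : ℝ) :
    ∫ ω, Real.exp (t * X i ω) ∂P = Real.exp (C i i * t ^ 2 / 2) := by
  have h := mgf_gaussianReal (hX.map_eval i) t
  rw [mgf, Real.coe_toNNReal _ (hX.covariance_diag_nonneg i), zero_mul, zero_add] at h
  exact h

theorem integral_pow_four (hX : IsCenteredGaussian X P C) (i : ι) :
    ∫ ω, X i ω ^ 4 ∂P = C i i ^ 2 * ∫ x, x ^ 4 ∂(gaussianReal 0 1) := by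
  have h0 := hX.covariance_diag_nonneg i
  have h := hX.map_eval i
  have h2 : gaussianReal 0 (C i i).toNNReal = (gaussianReal 0 1).map (Real.sqrt (C i i) * ·) := by
    rw [gaussianReal_map_const_mul]
    congr 1
    · simp
    · ext
      simp [Real.sq_sqrt h0, h0]
  rw [← integral_map (φ := X i) (f := fun x => x ^ 4) (hX.aemeasurable i) (by fun_prop), h, h2,
    integral_map (by fun_prop) (by fun_prop)]
  simp_rw [mul_pow]
  rw [integral_const_mul]
  congr 1
  rw [show (4 : ℕ) = 2 * 2 from rfl, pow_mul, Real.sq_sqrt h0]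

end IsCenteredGaussian

/-! ### Existence of Gaussian families -/

/-- The law of a sequence of independent standard Gaussian variables. -/
def stdNoise : Measure (ℕ → ℝ) := Measure.infinitePi fun _ => gaussianReal 0 1

instance : IsProbabilityMeasure stdNoise := by unfold stdNoise; infer_instance

theorem isCenteredGaussian_stdNoise :
    IsCenteredGaussian (fun n (g : ℕ → ℝ) => g n) stdNoise (fun n m => if n = m then 1 else 0) := by
  have hind : iIndepFun (fun n (g : ℕ → ℝ) => g n) stdNoise :=
    iIndepFun_infinitePi (P := fun _ : ℕ => gaussianReal 0 1) (X := fun _ x => x) (by fun_prop)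
  have hmap : ∀ n, stdNoise.map (fun g : ℕ → ℝ => g n) = gaussianReal 0 1 := fun n =>
    Measure.infinitePi_map_eval _ n
  have hlaw : ∀ n, HasGaussianLaw (fun g : ℕ → ℝ => g n) stdNoise := fun n =>
    ⟨by rw [hmap]; infer_instance⟩
  have hmean : ∀ n, ∫ g, g n ∂stdNoise = 0 := fun n => by
    rw [← integral_map (φ := fun g : ℕ → ℝ => g n) (f := fun x => x)
      (measurable_pi_apply n).aemeasurable (by fun_prop), hmap, integral_id_gaussianReal]
  refine ⟨⟨fun I => ?_⟩, hmean, fun n m => ?_⟩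
  · exact iIndepFun.hasGaussianLaw (X := fun (i : I) (g : ℕ → ℝ) => g i)
      (fun i => hlaw i) (hind.precomp Subtype.val_injective)
  · split_ifs with h
    · subst h
      have hv : Var[fun g : ℕ → ℝ => g n; stdNoise] = 1 := by
        have h1 : Var[fun x : ℝ => x; stdNoise.map (fun g : ℕ → ℝ => g n)] = 1 := by
          rw [hmap, variance_fun_id_gaussianReal]; rfl
        rwa [variance_map (X := fun x : ℝ => x) (Y := fun g : ℕ → ℝ => g n) (by fun_prop)
          (measurable_pi_apply n).aemeasurable] at h1
      rw [variance_of_integral_eq_zero (measurable_pi_apply n).aemeasurable (hmean n)] at hv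
      simpa [sq] using hv
    · rw [(hind.indepFun h).integral_fun_mul_eq_mul_integral
        (measurable_pi_apply n).aestronglyMeasurable
        (measurable_pi_apply m).aestronglyMeasurable, hmean]
      simp

/-- A sequence running through all of a nonempty countable type. -/
def countableSeq (ι : Type*) [Countable ι] [Nonempty ι] : ℕ → ι :=
  (exists_surjective_nat ι).choose

theorem countableSeq_surjective (ι : Type*) [Countable ι] [Nonempty ι] :
    Function.Surjective (countableSeq ι) :=
  (exists_surjective_nat ι).choose_spec

/-- The centered Gaussian family with covariance `C`, as a function of white noise: the Cholesky
factor of `C` (along an enumeration of the index type, in which every index is represented by one of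
its positions) applied to the noise. -/
def gaussField {ι : Type*} [Countable ι] [Nonempty ι] (C : ι → ι → ℝ) (g : ℕ → ℝ) (i : ι) : ℝ :=
  ∑ k ∈ Finset.range (Function.surjInv (countableSeq_surjective ι) i + 1),
    choleskyFactor (fun n m => C (countableSeq ι n) (countableSeq ι m))
      (Function.surjInv (countableSeq_surjective ι) i) k * g k

theorem isCenteredGaussian_gaussField {ι : Type*} [Countable ι] [Nonempty ι] {C : ι → ι → ℝ}
    (hC : (Matrix.of C).PosSemidef) :
    IsCenteredGaussian (fun i g => gaussField C g i) stdNoise C := by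
  have h := isCenteredGaussian_stdNoise.linear
    (fun i : ι => Finset.range (Function.surjInv (countableSeq_surjective ι) i + 1))
    (fun i => choleskyFactor (fun n m => C (countableSeq ι n) (countableSeq ι m))
      (Function.surjInv (countableSeq_surjective ι) i))
  refine ⟨h.gaussian, h.mean_zero, fun i j => (h.covariance i j).trans ?_⟩
  have hC' := posSemidef_of_comp hC (countableSeq ι)
  set n := Function.surjInv (countableSeq_surjective ι) i with hn
  set m := Function.surjInv (countableSeq_surjective ι) j with hm
  have key := sum_choleskyFactor_mul hC' (n + m + 1) n m
  have en : countableSeq ι n = i := Function.surjInv_eq _ i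
  have em : countableSeq ι m = j := Function.surjInv_eq _ j
  rw [schurComplement_eq_zero hC' (by omega), sub_zero, en, em] at key
  rw [← key]
  have : ∀ x ∈ Finset.range (n + 1), ∑ y ∈ Finset.range (m + 1),
      choleskyFactor (fun n m => C (countableSeq ι n) (countableSeq ι m)) n x *
        choleskyFactor (fun n m => C (countableSeq ι n) (countableSeq ι m)) m y *
        (if x = y then 1 else 0) =
      choleskyFactor (fun n m => C (countableSeq ι n) (countableSeq ι m)) n x *
        choleskyFactor (fun n m => C (countableSeq ι n) (countableSeq ι m)) m x := by
    intro x _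
    simp only [mul_ite, mul_one, mul_zero, Finset.sum_ite_eq, Finset.mem_range]
    split_ifs with hx
    · rfl
    · rw [choleskyFactor_eq_zero hC' (n := m) (k := x) (by omega), mul_zero]
  rw [Finset.sum_congr rfl this]
  refine Finset.sum_subset (Finset.range_subset_range.2 (by omega)) fun x _ hx => ?_
  rw [choleskyFactor_eq_zero hC' (n := n) (k := x) (by simpa using hx), zero_mul]

theorem isGaussianLaw_gaussianLaw {ι : Type*} [Countable ι] [Nonempty ι] {C : ι → ι → ℝ}
    (hC : (Matrix.of C).PosSemidef) : IsGaussianLaw (gaussianLaw C) C :=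
  gaussianLaw_spec ⟨_, (isCenteredGaussian_gaussField hC).isGaussianLaw_map⟩

theorem gaussianLaw_eq_map_gaussField {ι : Type*} [Countable ι] [Nonempty ι] {C : ι → ι → ℝ}
    (hC : (Matrix.of C).PosSemidef) : gaussianLaw C = stdNoise.map (gaussField C) := by
  have h := IsCenteredGaussian.map_eq (isGaussianLaw_gaussianLaw hC)
    (isCenteredGaussian_gaussField hC)
  simpa using h

theorem measurable_gaussField {ι Ω : Type*} [Countable ι] [Nonempty ι] [MeasurableSpace Ω]
    {C : Ω → ι → ι → ℝ} (hC : ∀ i j, Measurable fun ω => C ω i j) :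
    Measurable fun p : Ω × (ℕ → ℝ) => gaussField (C p.1) p.2 := by
  refine measurable_pi_lambda _ fun i => Finset.measurable_sum _ fun k _ => ?_
  refine Measurable.mul ?_ (by fun_prop)
  exact (measurable_choleskyFactor (C := fun ω n m => C ω (countableSeq ι n) (countableSeq ι m))
    (fun n m => hC _ _) _ k).comp measurable_fst

/-! ### Gaussian integration by parts -/

theorem integrable_gaussianPDFReal_mul {v : NNReal} (hv : v ≠ 0) {f : ℝ → ℝ}
    (hf : Integrable f (gaussianReal 0 v)) :
    Integrable (fun x => gaussianPDFReal 0 v x * f x) := by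
  rw [gaussianReal_of_var_ne_zero _ hv,
    integrable_withDensity_iff_integrable_smul₀' (measurable_gaussianPDF _ _).aemeasurable
      (ae_of_all _ fun _ => gaussianPDF_lt_top)] at hf
  simpa using hf

/-- Integration by parts with respect to a one-dimensional Gaussian measure, possibly degenerate. -/
theorem integral_mul_gaussianReal {v : NNReal} {h h' : ℝ → ℝ} (hd : ∀ x, HasDerivAt h (h' x) x)
    {B : ℝ} (hB : ∀ x, |h x| ≤ B) (hB' : ∀ x, |h' x| ≤ B) (hm : Measurable h') :
    ∫ x, x * h x ∂(gaussianReal 0 v) = v * ∫ x, h' x ∂(gaussianReal 0 v) := by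
  rcases eq_or_ne v 0 with rfl | hv
  · simp [gaussianReal_zero_var]
  have hv' : (v : ℝ) ≠ 0 := by simpa using hv
  have hc : Measurable h := (continuous_iff_continuousAt.2 fun x => (hd x).continuousAt).measurable
  have hpdf : ∀ x, HasDerivAt (gaussianPDFReal 0 v) (-(x / v) * gaussianPDFReal 0 v x) x := by
    intro x
    have h1 : HasDerivAt (fun x : ℝ => -(x - 0) ^ 2 / (2 * (v : ℝ))) (-(x / v)) x := by
      have := (((hasDerivAt_id x).sub_const 0).pow 2).neg.div_const (2 * (v : ℝ))
      refine this.congr_deriv ?_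
      simp
      field_simp
    have := (h1.exp.const_mul (Real.sqrt (2 * Real.pi * v))⁻¹)
    rw [gaussianPDFReal_def]
    refine this.congr_deriv ?_
    ring
  have ih : Integrable h (gaussianReal 0 v) :=
    Integrable.of_bound hc.aestronglyMeasurable B (ae_of_all _ hB)
  have ih' : Integrable h' (gaussianReal 0 v) :=
    Integrable.of_bound hm.aestronglyMeasurable B (ae_of_all _ hB')
  have iid : Integrable (fun x : ℝ => x) (gaussianReal 0 v) :=
    memLp_one_iff_integrable.1 (memLp_id_gaussianReal 1)
  have ixh : Integrable (fun x : ℝ => x * h x) (gaussianReal 0 v) :=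
    iid.mul_bdd hc.aestronglyMeasurable (ae_of_all _ hB)
  have key := integral_mul_deriv_eq_deriv_mul_of_integrable (u := h) (u' := h')
    (v := gaussianPDFReal 0 v) (v' := fun x => -(x / v) * gaussianPDFReal 0 v x)
    (fun x _ => hd x) (fun x _ => hpdf x)
    (((integrable_gaussianPDFReal_mul hv ixh).const_mul (-(v : ℝ)⁻¹)).congr
      (ae_of_all _ fun x => by simp only [Pi.mul_apply]; ring))
    ((integrable_gaussianPDFReal_mul hv ih').congr
      (ae_of_all _ fun x => by simp only [Pi.mul_apply]; ring))
    ((integrable_gaussianPDFReal_mul hv ih).congr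
      (ae_of_all _ fun x => by simp only [Pi.mul_apply]; ring))
  rw [integral_gaussianReal_eq_integral_smul hv, integral_gaussianReal_eq_integral_smul hv]
  simp only [smul_eq_mul]
  have e1 : ∀ x, gaussianPDFReal 0 v x * (x * h x) =
      -(v : ℝ) * (h x * (-(x / v) * gaussianPDFReal 0 v x)) := fun x => by field_simp
  simp_rw [e1]
  rw [integral_const_mul, key]
  simp_rw [mul_comm (h' _)]
  ring

/-- Gaussian integration by parts for the multiplier `U = W none` and a function `F` of the vector
`Zᵢ = W (some i)`, with partial derivatives `F'`; both are bounded. The proof splits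
`Zᵢ = cᵢ U + Rᵢ` with `R` independent of `U` and integrates by parts in `U` alone. -/
theorem IsCenteredGaussian.integral_mul_comp {ι Ω : Type*} [Fintype ι] [MeasurableSpace Ω]
    {P : Measure Ω} {W : Option ι → Ω → ℝ} {C : Option ι → Option ι → ℝ}
    (hW : IsCenteredGaussian W P C) {F : (ι → ℝ) → ℝ} {F' : ι → (ι → ℝ) → ℝ} {B : ℝ}
    (hF : ∀ (z c : ι → ℝ) (t : ℝ), HasDerivAt (fun t => F fun i => t * c i + z i)
      (∑ i, c i * F' i fun i => t * c i + z i) t)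
    (hFm : Measurable F) (hFm' : ∀ i, Measurable (F' i))
    (hB : ∀ z, |F z| ≤ B) (hB' : ∀ i z, |F' i z| ≤ B) :
    ∫ ω, W none ω * F (fun i => W (some i) ω) ∂P =
      ∑ i, C none (some i) * ∫ ω, F' i (fun i => W (some i) ω) ∂P := by
  classical
  have := hW.isProbabilityMeasure
  set v := C none none with hv
  by_cases hv0 : v = 0
  · -- a multiplier of variance zero vanishes almost surely, and so do its covariances
    have hU : W none =ᵐ[P] 0 := by
      have h1 : ∫ ω, W none ω * W none ω ∂P = 0 := by rw [hW.covariance, ← hv, hv0]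
      have h2 := (integral_eq_zero_iff_of_nonneg (fun ω => mul_self_nonneg _)
        (hW.integrable_mul none none)).1 h1
      filter_upwards [h2] with ω hω using by simpa using hω
    have h0 : ∀ g : Ω → ℝ, ∫ ω, W none ω * g ω ∂P = 0 := fun g => by
      rw [integral_congr_ae (g := fun _ => (0 : ℝ)) (by filter_upwards [hU] with ω h; simp [h])]
      simp
    rw [h0]
    simp_rw [← hW.covariance none, h0]
    simp
  set c : ι → ℝ := fun i => C none (some i) / v with hc
  have hvpos : 0 ≤ v := hW.covariance_diag_nonneg none
  -- `inl` is `U`, `inr i` is the remainder `Rᵢ`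
  have hV := hW.linear (τ := Unit ⊕ ι) (fun _ => Finset.univ)
    (fun t => Sum.elim (fun _ => fun o => if o = none then 1 else 0)
      (fun i => fun o => (if o = some i then 1 else 0) - if o = none then c i else 0) t)
  have eV : (fun (t : Unit ⊕ ι) ω => ∑ o, (Sum.elim (fun _ => fun o => if o = none then 1 else 0)
      (fun i => fun o => (if o = some i then 1 else 0) - if o = none then c i else 0) t :
        Option ι → ℝ) o * W o ω) =
      Sum.elim (fun _ => W none) (fun i ω => W (some i) ω - c i * W none ω) := by
    funext t ω
    rcases t with _ | i
    · simp
    · simp [sub_mul, Finset.sum_sub_distrib]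
  rw [eV] at hV
  set R : ι → Ω → ℝ := fun i ω => W (some i) ω - c i * W none ω with hR
  have hRm : AEMeasurable (fun ω i => R i ω) P :=
    aemeasurable_pi_lambda _ fun i => hV.aemeasurable (Sum.inr i)
  have hind : IndepFun (W none) (fun ω i => R i ω) P := by
    have h := hV.gaussian.indepFun_of_covariance_eq_zero (fun _ => hW.aemeasurable none)
      (fun i => hV.aemeasurable (Sum.inr i)) (fun s i => by
        refine (hV.cov_eq (Sum.inl s) (Sum.inr i)).trans ?_
        simp only [Sum.elim_inl, Sum.elim_inr, Fintype.sum_option, if_true, reduceCtorEq,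
          if_false, one_mul, zero_mul, Finset.sum_const_zero, add_zero, zero_sub, sub_zero,
          Option.some.injEq, ite_mul, Finset.sum_ite_eq', Finset.mem_univ, ← hv]
        simp only [hc]
        field_simp
        ring)
    exact h.comp (φ := fun x : Unit → ℝ => x ()) (ψ := id) (measurable_pi_apply ()) measurable_id
  set γ := gaussianReal 0 v.toNNReal with hγ
  set ρ := P.map (fun ω i => R i ω) with hρ
  have : IsProbabilityMeasure ρ := Measure.isProbabilityMeasure_map hRm
  have hjoint : P.map (fun ω => (W none ω, fun i => R i ω)) = γ.prod ρ := by
    rw [hind.map_prod_eq_prod_map_map (hW.aemeasurable none) hRm, hW.map_eval]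
  have hjm : AEMeasurable (fun ω => (W none ω, fun i => R i ω)) P :=
    (hW.aemeasurable none).prodMk hRm
  have hrec : ∀ ω, (fun i => W (some i) ω) = fun i => W none ω * c i + R i ω := fun ω => by
    funext i; simp only [hR]; ring
  have hmeas : Measurable fun p : ℝ × (ι → ℝ) => fun i => p.1 * c i + p.2 i := by fun_prop
  have tr : ∀ G : ℝ × (ι → ℝ) → ℝ, Measurable G →
      ∫ ω, G (W none ω, fun i => R i ω) ∂P = ∫ p, G p ∂(γ.prod ρ) := fun G hG => by
    rw [← hjoint, integral_map hjm hG.aestronglyMeasurable]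
  simp_rw [hrec]
  rw [tr (fun p => p.1 * F fun i => p.1 * c i + p.2 i) (measurable_fst.mul (hFm.comp hmeas))]
  have tr2 : ∀ i, ∫ ω, F' i (fun i => W none ω * c i + R i ω) ∂P =
      ∫ p, F' i (fun i => p.1 * c i + p.2 i) ∂(γ.prod ρ) := fun i =>
    tr (fun p => F' i fun i => p.1 * c i + p.2 i) ((hFm' i).comp hmeas)
  simp_rw [tr2]
  have i1 : Integrable (fun p : ℝ × (ι → ℝ) => p.1 * F fun i => p.1 * c i + p.2 i)
      (γ.prod ρ) := by
    refine Integrable.mul_bdd ?_ (hFm.comp hmeas).aestronglyMeasurable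
      (ae_of_all _ fun p => hB _)
    exact Integrable.comp_fst (f := fun x : ℝ => x)
      (memLp_one_iff_integrable.1 (memLp_id_gaussianReal 1)) ρ
  have i2 : ∀ i, Integrable (fun p : ℝ × (ι → ℝ) => F' i fun i => p.1 * c i + p.2 i)
      (γ.prod ρ) := fun i =>
    Integrable.of_bound ((hFm' i).comp hmeas).aestronglyMeasurable B (ae_of_all _ fun p => hB' _ _)
  rw [integral_prod_symm _ i1]
  have inner : ∀ r : ι → ℝ, ∫ x, x * F (fun i => x * c i + r i) ∂γ =
      v * ∫ x, ∑ i, c i * F' i (fun i => x * c i + r i) ∂γ := fun r => by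
    have hm : Measurable fun x : ℝ => ∑ i, c i * F' i (fun i => x * c i + r i) :=
      Finset.measurable_sum _ fun i _ => ((hFm' i).comp (by fun_prop)).const_mul _
    have h := integral_mul_gaussianReal (v := v.toNNReal) (h := fun x => F fun i => x * c i + r i)
      (h' := fun x => ∑ i, c i * F' i (fun i => x * c i + r i))
      (B := max B (∑ i, |c i| * B)) (fun x => hF r c x) (fun x => (hB _).trans (le_max_left _ _))
      (fun x => by
        refine le_trans (Finset.abs_sum_le_sum_abs _ _) (le_trans ?_ (le_max_right _ _))
        refine Finset.sum_le_sum fun i _ => ?_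
        rw [abs_mul]
        exact mul_le_mul_of_nonneg_left (hB' _ _) (abs_nonneg _)) hm
    rwa [Real.coe_toNNReal _ hvpos] at h
  simp only [inner]
  rw [integral_const_mul, ← integral_prod_symm
    (fun p : ℝ × (ι → ℝ) => ∑ i, c i * F' i (fun i => p.1 * c i + p.2 i))
    (integrable_finsetSum _ fun i _ => (i2 i).const_mul _),
    integral_finsetSum _ fun i _ => (i2 i).const_mul _, Finset.mul_sum]
  refine Finset.sum_congr rfl fun i _ => ?_
  rw [integral_const_mul]
  simp only [hc]
  field_simp

/-! ### Weighted log-sum-exp -/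

/-- The free energy `log ∑ᵢ wᵢ exp xᵢ` of the field `x` with reference weights `w`. The index type
may be infinite; the value is meaningful when the series converges. -/
def lse {ι : Type*} (w x : ι → ℝ) : ℝ := Real.log (∑' i, w i * Real.exp (x i))

/-- The Gibbs weights `wᵢ exp xᵢ / ∑ⱼ wⱼ exp xⱼ`. -/
def gibbs {ι : Type*} [Fintype ι] (w x : ι → ℝ) (i : ι) : ℝ :=
  w i * Real.exp (x i) / ∑ j, w j * Real.exp (x j)

section Finite

variable {ι : Type*} [Fintype ι] {w : ι → ℝ}

theorem lse_eq_log_sum (w x : ι → ℝ) : lse w x = Real.log (∑ i, w i * Real.exp (x i)) := by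
  rw [lse, tsum_fintype]

theorem sum_mul_exp_pos (hw : ∀ i, 0 ≤ w i) (hW : 0 < ∑ i, w i) (x : ι → ℝ) :
    0 < ∑ i, w i * Real.exp (x i) := by
  obtain ⟨i, hi, hpos⟩ := Finset.exists_lt_of_sum_lt (f := fun _ => (0 : ℝ)) (g := w)
    (s := Finset.univ) (by simpa using hW)
  exact Finset.sum_pos' (fun j _ => mul_nonneg (hw j) (Real.exp_pos _).le)
    ⟨i, hi, mul_pos hpos (Real.exp_pos _)⟩

theorem gibbs_nonneg (hw : ∀ i, 0 ≤ w i) (x : ι → ℝ) (i : ι) : 0 ≤ gibbs w x i :=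
  div_nonneg (mul_nonneg (hw i) (Real.exp_pos _).le)
    (Finset.sum_nonneg fun j _ => mul_nonneg (hw j) (Real.exp_pos _).le)

theorem sum_gibbs (hw : ∀ i, 0 ≤ w i) (hW : 0 < ∑ i, w i) (x : ι → ℝ) :
    ∑ i, gibbs w x i = 1 := by
  simp only [gibbs]
  rw [← Finset.sum_div, div_self (sum_mul_exp_pos hw hW x).ne']

theorem gibbs_le_one (hw : ∀ i, 0 ≤ w i) (hW : 0 < ∑ i, w i) (x : ι → ℝ) (i : ι) :
    gibbs w x i ≤ 1 := by
  rw [← sum_gibbs hw hW x]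
  exact Finset.single_le_sum (fun j _ => gibbs_nonneg hw x j) (Finset.mem_univ i)

theorem continuous_gibbs (hw : ∀ i, 0 ≤ w i) (hW : 0 < ∑ i, w i) (i : ι) :
    Continuous fun x => gibbs w x i := by
  unfold gibbs
  exact Continuous.div (by fun_prop) (by fun_prop) fun x => (sum_mul_exp_pos hw hW x).ne'

theorem continuous_lse (hw : ∀ i, 0 ≤ w i) (hW : 0 < ∑ i, w i) : Continuous (lse w) := by
  have : lse w = fun x => Real.log (∑ i, w i * Real.exp (x i)) :=
    funext fun x => lse_eq_log_sum w x
  rw [this]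
  exact Continuous.log (by fun_prop) fun x => (sum_mul_exp_pos hw hW x).ne'

theorem hasDerivAt_sum_mul_exp {z : ℝ → ι → ℝ} {z' : ι → ℝ} {t : ℝ}
    (hz : ∀ i, HasDerivAt (fun t => z t i) (z' i) t) :
    HasDerivAt (fun t => ∑ i, w i * Real.exp (z t i)) (∑ i, w i * Real.exp (z t i) * z' i) t := by
  refine (HasDerivAt.fun_sum fun i _ => ((hz i).exp.const_mul (w i))).congr_deriv ?_
  exact Finset.sum_congr rfl fun i _ => by ring

theorem hasDerivAt_lse (hw : ∀ i, 0 ≤ w i) (hW : 0 < ∑ i, w i) {z : ℝ → ι → ℝ} {z' : ι → ℝ}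
    {t : ℝ} (hz : ∀ i, HasDerivAt (fun t => z t i) (z' i) t) :
    HasDerivAt (fun t => lse w (z t)) (∑ i, gibbs w (z t) i * z' i) t := by
  simp only [lse_eq_log_sum]
  refine ((hasDerivAt_sum_mul_exp hz).log (sum_mul_exp_pos hw hW _).ne').congr_deriv ?_
  simp only [gibbs]
  rw [Finset.sum_div]
  exact Finset.sum_congr rfl fun i _ => by ring

theorem hasDerivAt_gibbs [DecidableEq ι] (hw : ∀ i, 0 ≤ w i) (hW : 0 < ∑ i, w i)
    {z : ℝ → ι → ℝ} {z' : ι → ℝ} {t : ℝ} (hz : ∀ i, HasDerivAt (fun t => z t i) (z' i) t) (i : ι) :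
    HasDerivAt (fun t => gibbs w (z t) i)
      (∑ j, z' j * (gibbs w (z t) i * ((if i = j then 1 else 0) - gibbs w (z t) j))) t := by
  have hS := (sum_mul_exp_pos hw hW (z t)).ne'
  refine (((hz i).exp.const_mul (w i)).div (hasDerivAt_sum_mul_exp hz) hS).congr_deriv ?_
  simp only [mul_sub, Finset.sum_sub_distrib, mul_ite, mul_one, mul_zero, Finset.sum_ite_eq,
    Finset.mem_univ, if_true]
  simp only [gibbs]
  set S := ∑ i, w i * Real.exp (z t i)
  have e : ∑ x, z' x * (w i * Real.exp (z t i) / S * (w x * Real.exp (z t x) / S)) =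
      w i * Real.exp (z t i) * (∑ x, w x * Real.exp (z t x) * z' x) / S ^ 2 := by
    rw [Finset.mul_sum, Finset.sum_div]
    exact Finset.sum_congr rfl fun x _ => by ring
  rw [e]
  field_simp

theorem abs_lse_le (hw : ∀ i, 0 ≤ w i) (hW : 0 < ∑ i, w i) (x : ι → ℝ) :
    |lse w x| ≤ |Real.log (∑ i, w i)| + ∑ i, |x i| := by
  have hle : ∀ i, |x i| ≤ ∑ i, |x i| := fun i =>
    Finset.single_le_sum (f := fun i => |x i|) (fun j _ => abs_nonneg _) (Finset.mem_univ i)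
  set m := ∑ i, |x i|
  have h1 : ∑ i, w i * Real.exp (x i) ≤ (∑ i, w i) * Real.exp m := by
    rw [Finset.sum_mul]
    exact Finset.sum_le_sum fun i _ => mul_le_mul_of_nonneg_left
      (Real.exp_le_exp.2 ((le_abs_self _).trans (hle i))) (hw i)
  have h2 : (∑ i, w i) * Real.exp (-m) ≤ ∑ i, w i * Real.exp (x i) := by
    rw [Finset.sum_mul]
    exact Finset.sum_le_sum fun i _ => mul_le_mul_of_nonneg_left
      (Real.exp_le_exp.2 (by have := neg_abs_le (x i); have := hle i; linarith)) (hw i)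
  have hS := sum_mul_exp_pos hw hW x
  have l1 := Real.log_le_log hS h1
  have l2 := Real.log_le_log (mul_pos hW (Real.exp_pos _)) h2
  rw [Real.log_mul hW.ne' (Real.exp_pos _).ne', Real.log_exp] at l1 l2
  rw [lse_eq_log_sum, abs_le]
  have a1 := neg_abs_le (Real.log (∑ i, w i))
  have a2 := le_abs_self (Real.log (∑ i, w i))
  constructor <;> linarith

theorem sum_mul_indicator_sub [DecidableEq ι] {p : ι → ℝ} (hp : ∑ j, p j = 1) (a : ι → ℝ)
    (i : ι) :
    ∑ j, a j * (p i * ((if i = j then 1 else 0) - p j)) = ∑ j, p i * p j * (a i - a j) := by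
  have h1 : ∑ j, p i * p j * a i = p i * a i := by
    rw [← Finset.sum_mul, ← Finset.mul_sum, hp, mul_one]
  simp only [mul_sub, Finset.sum_sub_distrib, h1, mul_ite, mul_one, mul_zero, Finset.sum_ite_eq,
    Finset.mem_univ, if_true]
  congr 1
  · ring
  · exact Finset.sum_congr rfl fun j _ => by ring

variable {Ω Ω' : Type*} [MeasurableSpace Ω] [MeasurableSpace Ω'] {P : Measure Ω} {Q : Measure Ω'}
  {X : ι → Ω → ℝ} {Y : ι → Ω' → ℝ} {C D : ι → ι → ℝ}

theorem IsCenteredGaussian.integrable_lse (hX : IsCenteredGaussian X P C) (hw : ∀ i, 0 ≤ w i)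
    (hW : 0 < ∑ i, w i) : Integrable (fun ω => lse w fun i => X i ω) P := by
  have := hX.isProbabilityMeasure
  refine Integrable.mono' (g := fun ω => |Real.log (∑ i, w i)| + ∑ i, |X i ω|)
    ((integrable_const _).add (integrable_finsetSum _ fun i _ => (hX.integrable i).abs))
    ((continuous_lse hw hW).measurable.comp_aemeasurable hX.aemeasurable_pi).aestronglyMeasurable
    (ae_of_all _ fun ω => abs_lse_le hw hW _)

/-- The derivative of the free energy along the rotation from `Y` to `X`: integration by parts
turns it into the Gibbs average, over two replicas, of the difference of the covariances. -/
theorem IsCenteredGaussian.hasDerivAt_integral_lse (hX : IsCenteredGaussian X P C)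
    (hY : IsCenteredGaussian Y Q D) (hw : ∀ i, 0 ≤ w i) (hW : 0 < ∑ i, w i) (θ : ℝ) :
    HasDerivAt
      (fun θ => ∫ ω, lse w (fun i => Real.sin θ * X i ω.1 + Real.cos θ * Y i ω.2) ∂(P.prod Q))
      (Real.sin θ * Real.cos θ * ∫ ω, ∑ i, ∑ j,
        gibbs w (fun i => Real.sin θ * X i ω.1 + Real.cos θ * Y i ω.2) i *
        gibbs w (fun i => Real.sin θ * X i ω.1 + Real.cos θ * Y i ω.2) j *
        (C i i - C i j - (D i i - D i j)) ∂(P.prod Q)) θ := by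
  classical
  have := hX.isProbabilityMeasure
  have := hY.isProbabilityMeasure
  set Z : ℝ → ι → Ω × Ω' → ℝ := fun θ i ω => Real.sin θ * X i ω.1 + Real.cos θ * Y i ω.2 with hZ
  have hZG : ∀ θ, IsCenteredGaussian (Z θ) (P.prod Q) _ := fun θ =>
    hX.prod hY id id (fun _ => Real.sin θ) (fun _ => Real.cos θ)
  have hbint : Integrable (fun ω : Ω × Ω' => ∑ i, (|X i ω.1| + |Y i ω.2|)) (P.prod Q) :=
    integrable_finsetSum _ fun i _ =>
      ((hX.integrable i).comp_fst Q).abs.add ((hY.integrable i).comp_snd P).abs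
  have hgm : ∀ θ i, AEStronglyMeasurable (fun ω => gibbs w (fun i => Z θ i ω) i) (P.prod Q) :=
    fun θ i => ((continuous_gibbs hw hW i).measurable.comp_aemeasurable
      (hZG θ).aemeasurable_pi).aestronglyMeasurable
  have hgi : ∀ {f : Ω × Ω' → ℝ} (θ i), Integrable f (P.prod Q) →
      Integrable (fun ω => gibbs w (fun i => Z θ i ω) i * f ω) (P.prod Q) := fun θ i hf =>
    hf.bdd_mul (hgm θ i) (c := 1) (ae_of_all _ fun ω => by
      rw [Real.norm_eq_abs, abs_of_nonneg (gibbs_nonneg hw _ _)]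
      exact gibbs_le_one hw hW _ _)
  have hZ'i : ∀ θ i, Integrable
      (fun ω : Ω × Ω' => Real.cos θ * X i ω.1 - Real.sin θ * Y i ω.2) (P.prod Q) := fun θ i =>
    (((hX.integrable i).comp_fst Q).const_mul _).sub (((hY.integrable i).comp_snd P).const_mul _)
  have hder := hasDerivAt_integral_of_dominated_loc_of_deriv_le (μ := P.prod Q) (x₀ := θ)
    (F := fun θ ω => lse w fun i => Z θ i ω)
    (F' := fun θ ω => ∑ i, gibbs w (fun i => Z θ i ω) i *
      (Real.cos θ * X i ω.1 - Real.sin θ * Y i ω.2))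
    (bound := fun ω => ∑ i, (|X i ω.1| + |Y i ω.2|)) univ_mem
    (Eventually.of_forall fun θ => ((hZG θ).integrable_lse hw hW).aestronglyMeasurable)
    ((hZG θ).integrable_lse hw hW)
    (integrable_finsetSum _ fun i _ => hgi θ i (hZ'i θ i)).aestronglyMeasurable
    (ae_of_all _ fun ω θ _ => by
      rw [Real.norm_eq_abs]
      refine (Finset.abs_sum_le_sum_abs _ _).trans (Finset.sum_le_sum fun i _ => ?_)
      rw [abs_mul, abs_of_nonneg (gibbs_nonneg hw _ _)]
      refine (mul_le_of_le_one_left (abs_nonneg _) (gibbs_le_one hw hW _ _)).trans ?_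
      refine (abs_sub _ _).trans (add_le_add ?_ ?_)
      · rw [abs_mul]
        exact mul_le_of_le_one_left (abs_nonneg _) (Real.abs_cos_le_one _)
      · rw [abs_mul]
        exact mul_le_of_le_one_left (abs_nonneg _) (Real.abs_sin_le_one _))
    hbint
    (ae_of_all _ fun ω θ _ => by
      refine hasDerivAt_lse hw hW (z := fun θ i => Z θ i ω) fun i => ?_
      refine (((Real.hasDerivAt_sin θ).mul_const _).add
        ((Real.hasDerivAt_cos θ).mul_const _)).congr_deriv ?_
      ring)
  refine hder.2.congr_deriv ?_
  rw [integral_finsetSum _ fun i _ => hgi θ i (hZ'i θ i)]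
  -- integration by parts, for each `i`, with `U = cos θ Xᵢ - sin θ Yᵢ`
  have hibp : ∀ i, ∫ ω, gibbs w (fun i => Z θ i ω) i *
      (Real.cos θ * X i ω.1 - Real.sin θ * Y i ω.2) ∂(P.prod Q) =
      ∑ j, Real.sin θ * Real.cos θ * (C i j - D i j) * ∫ ω, gibbs w (fun i => Z θ i ω) i *
        ((if i = j then 1 else 0) - gibbs w (fun i => Z θ i ω) j) ∂(P.prod Q) := by
    intro i
    have hW' := hX.prod hY (τ := Option ι) (fun o => o.elim i id) (fun o => o.elim i id)
      (fun o => o.elim (Real.cos θ) fun _ => Real.sin θ)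
      (fun o => o.elim (-Real.sin θ) fun _ => Real.cos θ)
    have h := hW'.integral_mul_comp (F := fun z => gibbs w z i)
      (F' := fun j z => gibbs w z i * ((if i = j then 1 else 0) - gibbs w z j)) (B := 1)
      (fun z c t => hasDerivAt_gibbs hw hW (z := fun t i => t * c i + z i)
        (fun j => ((hasDerivAt_id t).mul_const (c j)).add_const (z j) |>.congr_deriv (by ring)) i)
      (continuous_gibbs hw hW i).measurable
      (fun j => ((continuous_gibbs hw hW i).mul
        (continuous_const.sub (continuous_gibbs hw hW j))).measurable)
      (fun z => by
        rw [abs_of_nonneg (gibbs_nonneg hw _ _)]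
        exact gibbs_le_one hw hW _ _)
      (fun j z => by
        rw [abs_mul, abs_of_nonneg (gibbs_nonneg hw _ _)]
        refine mul_le_one₀ (gibbs_le_one hw hW _ _) (abs_nonneg _) ?_
        have h1 := gibbs_nonneg hw z j
        have h2 := gibbs_le_one hw hW z j
        rw [abs_le]
        split_ifs <;> constructor <;> linarith)
    simp only [Option.elim, id] at h
    refine Eq.trans (integral_congr_ae (ae_of_all _ fun ω => ?_)) (h.trans ?_)
    · simp only [hZ]; ring
    · exact Finset.sum_congr rfl fun j _ => by ring
  simp_rw [hibp]
  have hgg : ∀ i j, Integrable (fun ω => gibbs w (fun i => Z θ i ω) i *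
      gibbs w (fun i => Z θ i ω) j) (P.prod Q) := fun i j =>
    hgi θ i (Integrable.of_bound (hgm θ j) 1 (ae_of_all _ fun ω => by
      rw [Real.norm_eq_abs, abs_of_nonneg (gibbs_nonneg hw _ _)]
      exact gibbs_le_one hw hW _ _))
  have hg1 : ∀ i j, Integrable (fun ω => gibbs w (fun i => Z θ i ω) i *
        ((if i = j then 1 else 0) - gibbs w (fun i => Z θ i ω) j)) (P.prod Q) := fun i j => by
    simp_rw [mul_sub]
    exact (hgi θ i (integrable_const _)).sub (hgg i j)
  have hstep : ∀ i, ∑ j, Real.sin θ * Real.cos θ * (C i j - D i j) *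
      ∫ ω, gibbs w (fun i => Z θ i ω) i *
        ((if i = j then 1 else 0) - gibbs w (fun i => Z θ i ω) j) ∂(P.prod Q) =
      ∫ ω, ∑ j, Real.sin θ * Real.cos θ * (C i j - D i j) * (gibbs w (fun i => Z θ i ω) i *
        ((if i = j then 1 else 0) - gibbs w (fun i => Z θ i ω) j)) ∂(P.prod Q) := fun i => by
    rw [integral_finsetSum _ fun j _ => (hg1 i j).const_mul _]
    simp_rw [integral_const_mul]
  simp_rw [hstep]
  rw [← integral_finsetSum _ fun i _ => integrable_finsetSum _ fun j _ => (hg1 i j).const_mul _,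
    ← integral_const_mul]
  refine integral_congr_ae (ae_of_all _ fun ω => ?_)
  have hsum := sum_gibbs hw hW fun i => Z θ i ω
  simp only [Finset.mul_sum _ _ (Real.sin θ * Real.cos θ)]
  refine Finset.sum_congr rfl fun i _ => ?_
  rw [sum_mul_indicator_sub hsum]
  exact Finset.sum_congr rfl fun j _ => by ring

/-- Slepian–Kahane comparison for log-sum-exp: the free energy is nondecreasing in the quantities
`C i i - C i j`, in a quantitative form. -/
theorem IsCenteredGaussian.integral_lse_le (hX : IsCenteredGaussian X P C)
    (hY : IsCenteredGaussian Y Q D) (hw : ∀ i, 0 ≤ w i) (hW : 0 < ∑ i, w i) {c : ℝ}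
    (hc : ∀ i j, C i i - C i j - (D i i - D i j) ≤ c) :
    ∫ ω, lse w (fun i => X i ω) ∂P ≤ ∫ ω, lse w (fun i => Y i ω) ∂Q + c / 2 := by
  have := hX.isProbabilityMeasure
  have := hY.isProbabilityMeasure
  set u : ℝ → ℝ := fun θ =>
    ∫ ω, lse w (fun i => Real.sin θ * X i ω.1 + Real.cos θ * Y i ω.2) ∂(P.prod Q) with hu
  have hd := hX.hasDerivAt_integral_lse hY hw hW
  have hv : ∀ θ, HasDerivAt (fun θ => u θ - c / 2 * Real.sin θ ^ 2)
      (_ - c / 2 * (2 * Real.sin θ * Real.cos θ)) θ := fun θ =>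
    (hd θ).sub ((((Real.hasDerivAt_sin θ).pow 2).const_mul (c / 2)).congr_deriv (by simp))
  -- `sin θ ^ 2` increases from `0` to `1` on `[0, π / 2]` and absorbs the constant `c`
  have hanti : AntitoneOn (fun θ => u θ - c / 2 * Real.sin θ ^ 2) (Icc 0 (Real.pi / 2)) := by
    refine antitoneOn_of_deriv_nonpos (convex_Icc _ _)
      (fun θ _ => (hv θ).continuousAt.continuousWithinAt)
      (fun θ _ => (hv θ).differentiableAt.differentiableWithinAt) fun θ hθ => ?_
    rw [interior_Icc] at hθ
    rw [(hv θ).deriv]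
    have hs : 0 ≤ Real.sin θ :=
      Real.sin_nonneg_of_nonneg_of_le_pi hθ.1.le (by linarith [hθ.2, Real.pi_pos])
    have hco : 0 ≤ Real.cos θ :=
      Real.cos_nonneg_of_mem_Icc ⟨by linarith [hθ.1, Real.pi_pos], hθ.2.le⟩
    have hI : ∫ ω, ∑ i, ∑ j,
        gibbs w (fun i => Real.sin θ * X i ω.1 + Real.cos θ * Y i ω.2) i *
        gibbs w (fun i => Real.sin θ * X i ω.1 + Real.cos θ * Y i ω.2) j *
        (C i i - C i j - (D i i - D i j)) ∂(P.prod Q) ≤ c := by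
      have hc' : ∀ z, ∑ i, ∑ j, gibbs w z i * gibbs w z j * (C i i - C i j - (D i i - D i j)) ≤ c :=
        fun z => by
          calc _ ≤ ∑ i, ∑ j, gibbs w z i * gibbs w z j * c :=
                Finset.sum_le_sum fun i _ => Finset.sum_le_sum fun j _ =>
                  mul_le_mul_of_nonneg_left (hc i j)
                    (mul_nonneg (gibbs_nonneg hw _ _) (gibbs_nonneg hw _ _))
            _ = (∑ i, gibbs w z i) * (∑ i, gibbs w z i) * c := by
                rw [Finset.sum_mul_sum, Finset.sum_mul]
                simp_rw [Finset.sum_mul]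
            _ = c := by rw [sum_gibbs hw hW]; ring
      by_cases hint : Integrable (fun ω : Ω × Ω' => ∑ i, ∑ j,
        gibbs w (fun i => Real.sin θ * X i ω.1 + Real.cos θ * Y i ω.2) i *
        gibbs w (fun i => Real.sin θ * X i ω.1 + Real.cos θ * Y i ω.2) j *
        (C i i - C i j - (D i i - D i j))) (P.prod Q)
      · exact (integral_mono hint (integrable_const c) fun ω => hc' _).trans (by simp)
      · -- the hypothesis with `i = j` gives `0 ≤ c`, so that the case `integral = 0` needs no
        -- integrability
        rw [integral_undef hint]
        obtain ⟨i, -, -⟩ := Finset.exists_lt_of_sum_lt (f := fun _ => (0 : ℝ)) (g := w)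
          (s := Finset.univ) (by simpa using hW)
        simpa using hc i i
    nlinarith [mul_nonneg hs hco]
  have h := hanti (a := 0) (b := Real.pi / 2) ⟨le_rfl, by positivity⟩ ⟨by positivity, le_rfl⟩
    (by positivity)
  simp only [hu, Real.sin_zero, Real.cos_zero, Real.sin_pi_div_two, Real.cos_pi_div_two, zero_mul,
    one_mul, zero_add, add_zero] at h
  rw [integral_fun_fst (fun x => lse w fun i => X i x),
    integral_fun_snd (fun y => lse w fun i => Y i y)] at h
  simp at h
  linarith

end Finite

/-! ### Concentration of the free energy -/

/-- Jensen's inequality for the fourth power; the fourth moment may be infinite. -/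
theorem ofReal_integral_pow_four_le {α : Type*} [MeasurableSpace α] {μ : Measure α}
    [IsProbabilityMeasure μ] {f : α → ℝ} (hf : Integrable f μ) :
    ENNReal.ofReal ((∫ x, f x ∂μ) ^ 4) ≤ ∫⁻ x, ENNReal.ofReal (f x ^ 4) ∂μ := by
  by_cases h : ∫⁻ x, ENNReal.ofReal (f x ^ 4) ∂μ = ⊤
  · rw [h]; exact le_top
  have hnn : ∀ x, 0 ≤ f x ^ 4 := fun x => by positivity
  have hi : Integrable (fun x => f x ^ 4) μ := by
    refine ⟨hf.aestronglyMeasurable.pow 4, ?_⟩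
    rw [hasFiniteIntegral_iff_ofReal (ae_of_all _ hnn)]
    exact lt_top_iff_ne_top.2 h
  rw [← ofReal_integral_eq_lintegral_ofReal hi (ae_of_all _ hnn)]
  refine ENNReal.ofReal_le_ofReal ?_
  exact (Even.convexOn_pow (𝕜 := ℝ) (n := 4) ⟨2, rfl⟩).map_integral_le (by fun_prop) isClosed_univ
    (ae_of_all _ fun _ => mem_univ _) hf hi

/-- The fourth moment of a standard Gaussian variable. -/
def gaussianFourthMoment : ℝ := ∫ x, x ^ 4 ∂(gaussianReal 0 1)

theorem gaussianFourthMoment_nonneg : 0 ≤ gaussianFourthMoment :=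
  integral_nonneg fun x => by positivity

section

variable {ι : Type*} [Fintype ι] {w : ι → ℝ} {C : ι → ι → ℝ} {μ : Measure (ι → ℝ)}

/-- The increment of the free energy is the integral of its derivative along the rotation from `y`
to `x`; this derivative is a Gibbs average of the velocity, to which Jensen's inequality applies. -/
theorem ofReal_lse_sub_lse_pow_four_le (hw : ∀ i, 0 ≤ w i) (hW : 0 < ∑ i, w i) (x y : ι → ℝ) :
    ENNReal.ofReal ((lse w x - lse w y) ^ 4) ≤ ∫⁻ s in Ioc (0 : ℝ) 1,
      ENNReal.ofReal ((Real.pi / 2) ^ 4 * ∑ i,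
        gibbs w (fun i => Real.sin (Real.pi / 2 * s) * x i + Real.cos (Real.pi / 2 * s) * y i) i *
        (Real.cos (Real.pi / 2 * s) * x i + -Real.sin (Real.pi / 2 * s) * y i) ^ 4) := by
  have : IsProbabilityMeasure (volume.restrict (Ioc (0 : ℝ) 1)) := ⟨by simp⟩
  set z : ℝ → ι → ℝ := fun s i =>
    Real.sin (Real.pi / 2 * s) * x i + Real.cos (Real.pi / 2 * s) * y i with hz
  set z' : ℝ → ι → ℝ := fun s i =>
    Real.cos (Real.pi / 2 * s) * x i + -Real.sin (Real.pi / 2 * s) * y i with hz'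
  have hd : ∀ s, HasDerivAt (fun s => lse w (z s))
      (∑ i, gibbs w (z s) i * (Real.pi / 2 * z' s i)) s := fun s => by
    refine hasDerivAt_lse hw hW fun i => ?_
    have h0 : HasDerivAt (fun s : ℝ => Real.pi / 2 * s) (Real.pi / 2) s := by
      simpa using (hasDerivAt_id s).const_mul (Real.pi / 2)
    refine ((h0.sin.mul_const (x i)).add (h0.cos.mul_const (y i))).congr_deriv ?_
    simp only [hz']; ring
  have hzc : Continuous z := by fun_prop
  have hcont : Continuous fun s => ∑ i, gibbs w (z s) i * (Real.pi / 2 * z' s i) := by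
    refine continuous_finsetSum _ fun i _ => ((continuous_gibbs hw hW i).comp hzc).mul ?_
    fun_prop
  have hftc := intervalIntegral.integral_eq_sub_of_hasDerivAt (a := 0) (b := 1)
    (fun s _ => hd s) (hcont.intervalIntegrable 0 1)
  have e1 : lse w (z 1) = lse w x := by simp [hz]
  have e0 : lse w (z 0) = lse w y := by simp [hz]
  rw [e1, e0, intervalIntegral.integral_of_le zero_le_one] at hftc
  rw [← hftc]
  refine (ofReal_integral_pow_four_le (hcont.intervalIntegrable 0 1).1).trans
    (lintegral_mono fun s => ENNReal.ofReal_le_ofReal ?_)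
  refine (Real.pow_arith_mean_le_arith_mean_pow_of_even _ _ _ (fun i _ => gibbs_nonneg hw _ i)
    (sum_gibbs hw hW _) (n := 4) ⟨2, rfl⟩).trans_eq ?_
  rw [Finset.mul_sum]
  exact Finset.sum_congr rfl fun i _ => by ring

/-- Position and velocity of the rotation are independent at every angle, with the law of `(y, x)`;
hence the Gibbs weights of the position average out to `1`. -/
theorem lintegral_sum_gibbs_mul_pow_four_le (hμ : IsGaussianLaw μ C) {v : ℝ}
    (hv : ∀ i, C i i ≤ v) (hw : ∀ i, 0 ≤ w i) (hW : 0 < ∑ i, w i) (θ : ℝ) :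
    ∫⁻ p, ENNReal.ofReal ((Real.pi / 2) ^ 4 * ∑ i,
        gibbs w (fun i => Real.sin θ * p.1 i + Real.cos θ * p.2 i) i *
        (Real.cos θ * p.1 i + -Real.sin θ * p.2 i) ^ 4) ∂(μ.prod μ) ≤
      ENNReal.ofReal ((Real.pi / 2) ^ 4 * (v ^ 2 * gaussianFourthMoment)) := by
  have hμ' : IsCenteredGaussian (fun (i : ι) (x : ι → ℝ) => x i) μ C := hμ
  have := hμ'.isProbabilityMeasure
  -- the pair (position, velocity) has the same law at `θ` as at angle `0`
  have hpair : ∀ θ : ℝ, IsCenteredGaussian (fun (t : ι ⊕ ι) (p : (ι → ℝ) × (ι → ℝ)) =>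
      Sum.elim (fun _ => Real.sin θ) (fun _ => Real.cos θ) t * p.1 (Sum.elim id id t) +
      Sum.elim (fun _ => Real.cos θ) (fun _ => -Real.sin θ) t * p.2 (Sum.elim id id t))
      (μ.prod μ) (fun t u => Sum.elim (fun i => Sum.elim (fun j => C i j) (fun _ => 0) u)
        (fun i => Sum.elim (fun _ => 0) (fun j => C i j) u) t) := fun θ => by
    have h := hμ'.prod hμ' (τ := ι ⊕ ι) (Sum.elim id id) (Sum.elim id id)
      (Sum.elim (fun _ => Real.sin θ) (fun _ => Real.cos θ))
      (Sum.elim (fun _ => Real.cos θ) (fun _ => -Real.sin θ))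
    refine ⟨h.gaussian, h.mean_zero, fun t u => (h.covariance t u).trans ?_⟩
    have hsc := Real.sin_sq_add_cos_sq θ
    rcases t with i | i <;> rcases u with j | j <;> simp only [Sum.elim_inl, Sum.elim_inr, id]
    · linear_combination C i j * hsc
    · ring
    · ring
    · linear_combination C i j * hsc
  set G : (ι ⊕ ι → ℝ) → ENNReal := fun q => ENNReal.ofReal ((Real.pi / 2) ^ 4 * ∑ i,
    gibbs w (fun i => q (Sum.inl i)) i * q (Sum.inr i) ^ 4) with hG
  have hGm : Measurable G := by
    have hc : Continuous fun q : ι ⊕ ι → ℝ => (Real.pi / 2) ^ 4 * ∑ i,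
        gibbs w (fun i => q (Sum.inl i)) i * q (Sum.inr i) ^ 4 := by
      refine continuous_const.mul (continuous_finsetSum _ fun i _ => Continuous.mul ?_ (by fun_prop))
      exact (continuous_gibbs hw hW i).comp
        (f := fun (q : ι ⊕ ι → ℝ) i => q (Sum.inl i)) (by fun_prop)
    exact ENNReal.measurable_ofReal.comp hc.measurable
  have hrot : ∀ θ : ℝ, ∫⁻ p, ENNReal.ofReal ((Real.pi / 2) ^ 4 * ∑ i,
        gibbs w (fun i => Real.sin θ * p.1 i + Real.cos θ * p.2 i) i *
        (Real.cos θ * p.1 i + -Real.sin θ * p.2 i) ^ 4) ∂(μ.prod μ) =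
      ∫⁻ q, G q ∂((μ.prod μ).map fun (p : (ι → ℝ) × (ι → ℝ)) (t : ι ⊕ ι) =>
        Sum.elim (fun _ => Real.sin θ) (fun _ => Real.cos θ) t * p.1 (Sum.elim id id t) +
        Sum.elim (fun _ => Real.cos θ) (fun _ => -Real.sin θ) t * p.2 (Sum.elim id id t)) :=
    fun θ => by
      rw [lintegral_map' hGm.aemeasurable (hpair θ).aemeasurable_pi]
      rfl
  rw [hrot, (hpair θ).map_eq (hpair 0), ← hrot]
  simp only [Real.sin_zero, Real.cos_zero, zero_mul, one_mul, zero_add, neg_zero, add_zero]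
  have hx4 : ∀ i, Integrable (fun x : ι → ℝ => x i ^ 4) μ := fun i => by
    have h := (hμ'.memLp i (p := 4) (by simp)).integrable_norm_pow (p := 4) (by simp)
    refine h.congr (ae_of_all _ fun x => ?_)
    simp only [Real.norm_eq_abs]
    rw [← abs_pow, abs_of_nonneg (by positivity)]
  have hgi : ∀ i, Integrable (fun y : ι → ℝ => gibbs w y i) μ := fun i =>
    Integrable.of_bound (continuous_gibbs hw hW i).aestronglyMeasurable 1
      (ae_of_all _ fun y => by
        rw [Real.norm_eq_abs, abs_of_nonneg (gibbs_nonneg hw _ _)]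
        exact gibbs_le_one hw hW _ _)
  have hprod : ∀ i, Integrable (fun p : (ι → ℝ) × (ι → ℝ) => p.1 i ^ 4 * gibbs w p.2 i)
      (μ.prod μ) := fun i => (hx4 i).mul_prod (hgi i)
  have hint : Integrable (fun p : (ι → ℝ) × (ι → ℝ) =>
      (Real.pi / 2) ^ 4 * ∑ i, gibbs w (fun i => p.2 i) i * p.1 i ^ 4) (μ.prod μ) :=
    (integrable_finsetSum _ fun i _ => (hprod i).congr
      (ae_of_all _ fun p => mul_comm _ _)).const_mul _
  rw [← ofReal_integral_eq_lintegral_ofReal hint (ae_of_all _ fun p => mul_nonneg (by positivity)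
    (Finset.sum_nonneg fun i _ => mul_nonneg (gibbs_nonneg hw _ _) (by positivity)))]
  refine ENNReal.ofReal_le_ofReal ?_
  rw [integral_const_mul]
  refine mul_le_mul_of_nonneg_left ?_ (by positivity)
  simp_rw [mul_comm (gibbs w _ _)]
  rw [integral_finsetSum _ fun i _ => hprod i]
  have hle : ∀ i, ∫ p : (ι → ℝ) × (ι → ℝ), p.1 i ^ 4 * gibbs w p.2 i ∂(μ.prod μ) ≤
      v ^ 2 * gaussianFourthMoment * ∫ y, gibbs w y i ∂μ := fun i => by
    rw [integral_prod_mul (fun x : ι → ℝ => x i ^ 4) (fun y => gibbs w y i),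
      hμ'.integral_pow_four i]
    refine mul_le_mul_of_nonneg_right (mul_le_mul_of_nonneg_right ?_ gaussianFourthMoment_nonneg)
      (integral_nonneg fun y => gibbs_nonneg hw y i)
    exact pow_le_pow_left₀ (hμ'.covariance_diag_nonneg i) (hv i) 2
  refine (Finset.sum_le_sum fun i _ => hle i).trans_eq ?_
  rw [← Finset.mul_sum, ← integral_finsetSum _ fun i _ => hgi i]
  simp_rw [sum_gibbs hw hW]
  simp

/-- Concentration of the free energy: its fourth central moment is of the order of the square of
the variance of the field, uniformly in the number of sites. -/
theorem lintegral_lse_sub_integral_pow_four_le (hμ : IsGaussianLaw μ C) {v : ℝ}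
    (hv : ∀ i, C i i ≤ v) (hw : ∀ i, 0 ≤ w i) (hW : 0 < ∑ i, w i) :
    ∫⁻ x, ENNReal.ofReal ((lse w x - ∫ y, lse w y ∂μ) ^ 4) ∂μ ≤
      ENNReal.ofReal ((Real.pi / 2) ^ 4 * (v ^ 2 * gaussianFourthMoment)) := by
  have hμ' : IsCenteredGaussian (fun (i : ι) (x : ι → ℝ) => x i) μ C := hμ
  have := hμ'.isProbabilityMeasure
  have : IsProbabilityMeasure (volume.restrict (Ioc (0 : ℝ) 1)) := ⟨by simp⟩
  have hi : Integrable (lse w) μ := hμ'.integrable_lse hw hW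
  have hc := continuous_lse hw hW
  have step1 : ∀ x, ENNReal.ofReal ((lse w x - ∫ y, lse w y ∂μ) ^ 4) ≤
      ∫⁻ y, ENNReal.ofReal ((lse w x - lse w y) ^ 4) ∂μ := fun x => by
    have h := ofReal_integral_pow_four_le (μ := μ) (f := fun y => lse w x - lse w y)
      ((integrable_const _).sub hi)
    rwa [integral_sub (integrable_const _) hi, integral_const, probReal_univ, one_smul] at h
  refine (lintegral_mono step1).trans ?_
  rw [← lintegral_prod (fun p : (ι → ℝ) × (ι → ℝ) => ENNReal.ofReal ((lse w p.1 - lse w p.2) ^ 4))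
    (Measurable.aemeasurable (by
      have h1 := hc.measurable
      fun_prop))]
  set H : (ι → ℝ) × (ι → ℝ) → ℝ → ENNReal := fun p s => ENNReal.ofReal ((Real.pi / 2) ^ 4 * ∑ i,
    gibbs w (fun i => Real.sin (Real.pi / 2 * s) * p.1 i + Real.cos (Real.pi / 2 * s) * p.2 i) i *
    (Real.cos (Real.pi / 2 * s) * p.1 i + -Real.sin (Real.pi / 2 * s) * p.2 i) ^ 4) with hH
  have step2 : ∀ p : (ι → ℝ) × (ι → ℝ), ENNReal.ofReal ((lse w p.1 - lse w p.2) ^ 4) ≤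
      ∫⁻ s in Ioc (0 : ℝ) 1, H p s := fun p => ofReal_lse_sub_lse_pow_four_le hw hW p.1 p.2
  have step3 : ∀ s, ∫⁻ p, H p s ∂(μ.prod μ) ≤
      ENNReal.ofReal ((Real.pi / 2) ^ 4 * (v ^ 2 * gaussianFourthMoment)) := fun s =>
    lintegral_sum_gibbs_mul_pow_four_le hμ hv hw hW (Real.pi / 2 * s)
  refine (lintegral_mono step2).trans ?_
  rw [lintegral_lintegral_swap]
  · refine (lintegral_mono step3).trans ?_
    simp
  · have hcont : Continuous fun q : ((ι → ℝ) × (ι → ℝ)) × ℝ => (Real.pi / 2) ^ 4 * ∑ i,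
        gibbs w (fun i => Real.sin (Real.pi / 2 * q.2) * q.1.1 i +
          Real.cos (Real.pi / 2 * q.2) * q.1.2 i) i *
        (Real.cos (Real.pi / 2 * q.2) * q.1.1 i +
          -Real.sin (Real.pi / 2 * q.2) * q.1.2 i) ^ 4 := by
      refine continuous_const.mul (continuous_finsetSum _ fun i _ => Continuous.mul ?_ (by fun_prop))
      exact (continuous_gibbs hw hW i).comp
        (f := fun (q : ((ι → ℝ) × (ι → ℝ)) × ℝ) i => Real.sin (Real.pi / 2 * q.2) * q.1.1 i +
          Real.cos (Real.pi / 2 * q.2) * q.1.2 i) (by fun_prop)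
    exact (ENNReal.measurable_ofReal.comp hcont.measurable).aemeasurable

end

/-! ### The free energy on a countable index set -/

theorem measurable_tsum_of_nonneg {ι α : Type*} [Countable ι] [MeasurableSpace α] {f : ι → α → ℝ}
    (hf : ∀ i, Measurable (f i)) (h0 : ∀ i a, 0 ≤ f i a) : Measurable fun a => ∑' i, f i a := by
  have h : (fun a => ∑' i, f i a) = fun a => (∑' i, ENNReal.ofReal (f i a)).toReal := by
    funext a
    rw [ENNReal.tsum_toReal_eq fun i => ENNReal.ofReal_ne_top]
    exact tsum_congr fun i => (ENNReal.toReal_ofReal (h0 i a)).symm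
  rw [h]
  exact (Measurable.tsum fun i => (hf i).ennreal_ofReal).ennreal_toReal

theorem measurable_lse {ι : Type*} [Countable ι] {w : ι → ℝ} (hw : ∀ i, 0 ≤ w i) :
    Measurable (lse w) :=
  (measurable_tsum_of_nonneg (f := fun i (x : ι → ℝ) => w i * Real.exp (x i))
    (fun i => (measurable_pi_apply i).exp.const_mul _)
    fun i _ => mul_nonneg (hw i) (Real.exp_pos _).le).log

/-- A two-sided bound on the free energy, obtained from `1 / y ≤ ∑ᵢ pᵢ exp (-xᵢ)`
for `y = ∑ᵢ pᵢ exp xᵢ` and normalized weights `p`. -/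
theorem abs_lse_sub_log_le {ι : Type*} {w x : ι → ℝ} (hw : ∀ i, 0 ≤ w i) (hs : Summable w)
    (hW : 0 < ∑' i, w i) (h1 : Summable fun i => w i * Real.exp (x i))
    (h2 : Summable fun i => w i * Real.exp (-x i)) :
    |lse w x - Real.log (∑' i, w i)| ≤
      (∑' i, w i * (Real.exp (x i) + Real.exp (-x i))) / ∑' i, w i := by
  set W := ∑' i, w i with hWdef
  set S := ∑' i, w i * Real.exp (x i) with hS
  set T := ∑' i, w i * Real.exp (-x i) with hT
  have hsum : ∑' i, w i * (Real.exp (x i) + Real.exp (-x i)) = S + T := by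
    rw [hS, hT, ← h1.tsum_add h2]
    exact tsum_congr fun i => by ring
  have hSpos : 0 < S := by
    obtain ⟨i, hi⟩ : ∃ i, w i ≠ 0 := by
      by_contra! h
      simp [hWdef, h] at hW
    have : 0 < w i * Real.exp (x i) := mul_pos (lt_of_le_of_ne (hw i) (Ne.symm hi)) (Real.exp_pos _)
    exact this.trans_le (h1.le_tsum i fun j _ => mul_nonneg (hw j) (Real.exp_pos _).le)
  set y := S / W with hy
  have hypos : 0 < y := div_pos hSpos hW
  have hinv : 1 / y ≤ T / W := by
    -- tangent line at `y` of the convex function `t ↦ 1 / t`, averaged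
    have hle : ∑' i, (w i * (2 / y) - w i * Real.exp (x i) * (1 / y ^ 2)) ≤ T := by
      refine Summable.tsum_le_tsum (fun i => ?_)
        ((hs.mul_right _).sub (h1.mul_right _)) h2
      have he : 2 / y - Real.exp (x i) * (1 / y ^ 2) ≤ Real.exp (-x i) := by
        rw [Real.exp_neg]
        have hE := Real.exp_pos (x i)
        rw [← sub_nonneg]
        have : (Real.exp (x i))⁻¹ - (2 / y - Real.exp (x i) * (1 / y ^ 2)) =
            (Real.exp (x i) - y) ^ 2 / (Real.exp (x i) * y ^ 2) := by field_simp; ring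
        rw [this]
        positivity
      calc _ = w i * (2 / y - Real.exp (x i) * (1 / y ^ 2)) := by ring
        _ ≤ _ := mul_le_mul_of_nonneg_left he (hw i)
    rw [(hs.mul_right _).tsum_sub (h1.mul_right _), tsum_mul_right, tsum_mul_right, ← hWdef,
      ← hS] at hle
    rw [le_div_iff₀ hW]
    refine le_trans (le_of_eq ?_) hle
    have : S = y * W := by rw [hy]; field_simp
    rw [this]; field_simp; ring
  have hlog : lse w x - Real.log W = Real.log y := by
    rw [lse, ← hS, hy, Real.log_div hSpos.ne' hW.ne']
  rw [hlog, hsum, add_div, abs_le]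
  have l1 := Real.log_le_sub_one_of_pos hypos
  have l2 := Real.log_le_sub_one_of_pos (x := 1 / y) (by positivity)
  rw [one_div, Real.log_inv, ← one_div] at l2
  have hypos' : 0 < 1 / y := by positivity
  constructor <;> linarith

section

variable {ι Ω Ω' : Type*} [Countable ι] [MeasurableSpace Ω] [MeasurableSpace Ω'] {P : Measure Ω}
  {Q : Measure Ω'} {X : ι → Ω → ℝ} {Y : ι → Ω' → ℝ} {C D : ι → ι → ℝ} {w : ι → ℝ} {v : ℝ}

theorem IsCenteredGaussian.lintegral_tsum_exp_le (hX : IsCenteredGaussian X P C)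
    (hv : ∀ i, C i i ≤ v) (hw : ∀ i, 0 ≤ w i) (hs : Summable w) :
    ∫⁻ ω, ∑' i, ENNReal.ofReal (w i * (Real.exp (X i ω) + Real.exp (-X i ω))) ∂P ≤
      ENNReal.ofReal (2 * Real.exp (v / 2) * ∑' i, w i) := by
  have hexp : ∀ i, Integrable (fun ω => w i * (Real.exp (X i ω) + Real.exp (-X i ω))) P :=
    fun i => (((hX.integrable_exp i 1).congr (ae_of_all _ fun ω => by simp)).add
      ((hX.integrable_exp i (-1)).congr (ae_of_all _ fun ω => by simp))).const_mul _
  rw [lintegral_tsum fun i => (hexp i).aestronglyMeasurable.aemeasurable.ennreal_ofReal]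
  rw [← tsum_mul_left, ENNReal.ofReal_tsum_of_nonneg (fun i => mul_nonneg (by positivity) (hw i))
    (hs.mul_left _)]
  refine ENNReal.tsum_le_tsum fun i => ?_
  rw [← ofReal_integral_eq_lintegral_ofReal (hexp i)
    (ae_of_all _ fun ω => mul_nonneg (hw i) (add_pos (Real.exp_pos _) (Real.exp_pos _)).le)]
  refine ENNReal.ofReal_le_ofReal ?_
  have e1 := hX.integral_exp i 1
  have e2 := hX.integral_exp i (-1)
  have i1 := hX.integrable_exp i 1
  have i2 := hX.integrable_exp i (-1)
  simp only [one_mul, neg_mul, one_pow, mul_one, neg_sq] at e1 e2 i1 i2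
  rw [integral_const_mul, integral_add i1 i2, e1, e2]
  have : Real.exp (C i i / 2) ≤ Real.exp (v / 2) := Real.exp_le_exp.2 (by linarith [hv i])
  nlinarith [hw i]

theorem IsCenteredGaussian.ae_summable_exp (hX : IsCenteredGaussian X P C)
    (hv : ∀ i, C i i ≤ v) (hw : ∀ i, 0 ≤ w i) (hs : Summable w) :
    ∀ᵐ ω ∂P, (Summable fun i => w i * Real.exp (X i ω)) ∧
      Summable fun i => w i * Real.exp (-X i ω) := by
  have hfin := ae_lt_top' (AEMeasurable.tsum fun i =>
    (((hX.aemeasurable i).exp.add (hX.aemeasurable i).neg.exp).const_mul (w i)).ennreal_ofReal)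
    ((hX.lintegral_tsum_exp_le hv hw hs).trans_lt ENNReal.ofReal_lt_top).ne
  filter_upwards [hfin] with ω hω
  have hsum : Summable fun i => w i * (Real.exp (X i ω) + Real.exp (-X i ω)) := by
    refine (ENNReal.summable_toReal hω.ne).congr fun i => ?_
    exact ENNReal.toReal_ofReal
      (mul_nonneg (hw i) (add_pos (Real.exp_pos _) (Real.exp_pos _)).le)
  constructor
  · exact Summable.of_nonneg_of_le (fun i => mul_nonneg (hw i) (Real.exp_pos _).le)
      (fun i => mul_le_mul_of_nonneg_left (le_add_of_nonneg_right (Real.exp_pos _).le) (hw i)) hsum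
  · exact Summable.of_nonneg_of_le (fun i => mul_nonneg (hw i) (Real.exp_pos _).le)
      (fun i => mul_le_mul_of_nonneg_left (le_add_of_nonneg_left (Real.exp_pos _).le) (hw i)) hsum

/-- The free energy is within a bounded distance, in mean, of the logarithm of the total weight; the
bound depends only on the maximal variance. -/
theorem IsCenteredGaussian.lintegral_abs_lse_sub_le (hX : IsCenteredGaussian X P C)
    (hv : ∀ i, C i i ≤ v) (hw : ∀ i, 0 ≤ w i) (hs : Summable w) (hW : 0 < ∑' i, w i) :
    ∫⁻ ω, ENNReal.ofReal |lse w (fun i => X i ω) - Real.log (∑' i, w i)| ∂P ≤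
      ENNReal.ofReal (2 * Real.exp (v / 2)) := by
  calc _ ≤ ∫⁻ ω, ENNReal.ofReal (1 / ∑' i, w i) *
        ∑' i, ENNReal.ofReal (w i * (Real.exp (X i ω) + Real.exp (-X i ω))) ∂P := by
        refine lintegral_mono_ae ?_
        filter_upwards [hX.ae_summable_exp hv hw hs] with ω hω
        rw [← ENNReal.ofReal_tsum_of_nonneg (fun i => mul_nonneg (hw i) (by positivity)),
          ← ENNReal.ofReal_mul (by positivity)]
        · refine ENNReal.ofReal_le_ofReal ((abs_lse_sub_log_le hw hs hW hω.1 hω.2).trans_eq ?_)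
          ring
        · exact (hω.1.add hω.2).congr fun i => by ring
    _ = ENNReal.ofReal (1 / ∑' i, w i) *
        ∫⁻ ω, ∑' i, ENNReal.ofReal (w i * (Real.exp (X i ω) + Real.exp (-X i ω))) ∂P :=
        lintegral_const_mul' _ _ ENNReal.ofReal_ne_top
    _ ≤ ENNReal.ofReal (1 / ∑' i, w i) * ENNReal.ofReal (2 * Real.exp (v / 2) * ∑' i, w i) := by
        gcongr
        exact hX.lintegral_tsum_exp_le hv hw hs
    _ = ENNReal.ofReal (2 * Real.exp (v / 2)) := by
        rw [← ENNReal.ofReal_mul (by positivity)]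
        congr 1
        field_simp

theorem IsCenteredGaussian.integrable_lse_of_summable (hX : IsCenteredGaussian X P C)
    (hv : ∀ i, C i i ≤ v) (hw : ∀ i, 0 ≤ w i) (hs : Summable w) (hW : 0 < ∑' i, w i) :
    Integrable (fun ω => lse w fun i => X i ω) P := by
  have := hX.isProbabilityMeasure
  have hm : AEStronglyMeasurable (fun ω => lse w fun i => X i ω) P :=
    ((measurable_lse hw).comp_aemeasurable hX.aemeasurable_pi).aestronglyMeasurable
  have h : Integrable (fun ω => (lse w fun i => X i ω) - Real.log (∑' i, w i)) P := by
    refine ⟨hm.sub aestronglyMeasurable_const, ?_⟩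
    rw [hasFiniteIntegral_iff_norm]
    exact (hX.lintegral_abs_lse_sub_le hv hw hs hW).trans_lt ENNReal.ofReal_lt_top
  exact (h.add (integrable_const (Real.log (∑' i, w i)))).congr
    (ae_of_all _ fun ω => sub_add_cancel _ _)

theorem IsCenteredGaussian.integral_abs_lse_sub_le (hX : IsCenteredGaussian X P C)
    (hv : ∀ i, C i i ≤ v) (hw : ∀ i, 0 ≤ w i) (hs : Summable w) (hW : 0 < ∑' i, w i) :
    ∫ ω, |lse w (fun i => X i ω) - Real.log (∑' i, w i)| ∂P ≤ 2 * Real.exp (v / 2) := by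
  have := hX.isProbabilityMeasure
  have h := hX.lintegral_abs_lse_sub_le hv hw hs hW
  have hi : Integrable (fun ω => |lse w (fun i => X i ω) - Real.log (∑' i, w i)|) P :=
    ((hX.integrable_lse_of_summable hv hw hs hW).sub (integrable_const _)).abs
  rw [← ofReal_integral_eq_lintegral_ofReal hi (ae_of_all _ fun ω => abs_nonneg _)] at h
  exact (ENNReal.ofReal_le_ofReal_iff (by positivity)).1 h

/-- The free energy is the limit of its truncations to finite index sets. -/
theorem IsCenteredGaussian.tendsto_integral_lse_restrict (hX : IsCenteredGaussian X P C)
    (hv : ∀ i, C i i ≤ v) (hw : ∀ i, 0 ≤ w i) (hs : Summable w) (hW : 0 < ∑' i, w i) :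
    Tendsto (fun s : Finset ι => ∫ ω, lse (fun i : s => w i) (fun i : s => X i ω) ∂P) atTop
      (𝓝 (∫ ω, lse w (fun i => X i ω) ∂P)) := by
  have := hX.isProbabilityMeasure
  obtain ⟨i₀, hi₀⟩ : ∃ i, w i ≠ 0 := by
    by_contra! h
    simp [h] at hW
  have hpos : 0 < w i₀ := lt_of_le_of_ne (hw i₀) (Ne.symm hi₀)
  have hfin : ∀ (s : Finset ι) ω, lse (fun i : s => w i) (fun i : s => X i ω) =
      Real.log (∑ i ∈ s, w i * Real.exp (X i ω)) := fun s ω => by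
    rw [lse_eq_log_sum, Finset.sum_coe_sort s fun i => w i * Real.exp (X i ω)]
  -- the truncated sums lie between their term of index `i₀` and the full sum
  refine tendsto_integral_filter_of_dominated_convergence
    (fun ω => |Real.log (w i₀)| + |X i₀ ω| + |lse w fun i => X i ω|)
    (Eventually.of_forall fun s => ?_) ?_ ?_ ?_
  · exact ((measurable_lse fun i : s => hw i).comp_aemeasurable
      (hX.comp fun i : s => (i : ι)).aemeasurable_pi).aestronglyMeasurable
  · filter_upwards [eventually_ge_atTop {i₀}] with s hs'
    filter_upwards [hX.ae_summable_exp hv hw hs] with ω hω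
    have hmem : i₀ ∈ s := hs' (Finset.mem_singleton_self i₀)
    have hnn : ∀ i, 0 ≤ w i * Real.exp (X i ω) := fun i => mul_nonneg (hw i) (Real.exp_pos _).le
    have h0 : 0 < w i₀ * Real.exp (X i₀ ω) := mul_pos hpos (Real.exp_pos _)
    have h1 : w i₀ * Real.exp (X i₀ ω) ≤ ∑ i ∈ s, w i * Real.exp (X i ω) :=
      Finset.single_le_sum (f := fun i => w i * Real.exp (X i ω)) (fun i _ => hnn i) hmem
    have h2 : ∑ i ∈ s, w i * Real.exp (X i ω) ≤ ∑' i, w i * Real.exp (X i ω) :=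
      hω.1.sum_le_tsum s fun i _ => hnn i
    have l1 := Real.log_le_log h0 h1
    have l2 := Real.log_le_log (h0.trans_le h1) h2
    rw [Real.log_mul hpos.ne' (Real.exp_pos _).ne', Real.log_exp] at l1
    rw [hfin, Real.norm_eq_abs, abs_le]
    have a1 := neg_abs_le (Real.log (w i₀))
    have a2 := neg_abs_le (X i₀ ω)
    have a3 := le_abs_self (lse w fun i => X i ω)
    have a4 := abs_nonneg (lse w fun i => X i ω)
    have a5 := abs_nonneg (Real.log (w i₀))
    have a6 := abs_nonneg (X i₀ ω)
    change _ ≤ lse w fun i => X i ω at l2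
    constructor <;> linarith
  · exact ((integrable_const _).add (hX.integrable i₀).abs).add
      (hX.integrable_lse_of_summable hv hw hs hW).abs
  · filter_upwards [hX.ae_summable_exp hv hw hs] with ω hω
    simp_rw [hfin]
    refine Tendsto.log hω.1.hasSum ?_
    have h0 : 0 < w i₀ * Real.exp (X i₀ ω) := mul_pos hpos (Real.exp_pos _)
    exact (h0.trans_le (hω.1.le_tsum i₀ fun i _ => mul_nonneg (hw i) (Real.exp_pos _).le)).ne'

/-- The comparison of free energies on a countable index set. -/
theorem IsCenteredGaussian.integral_lse_le_of_summable (hX : IsCenteredGaussian X P C)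
    (hY : IsCenteredGaussian Y Q D) (hv : ∀ i, C i i ≤ v) (hv' : ∀ i, D i i ≤ v)
    (hw : ∀ i, 0 ≤ w i) (hs : Summable w) (hW : 0 < ∑' i, w i)
    (hc : ∀ i j, C i i - C i j ≤ D i i - D i j) :
    ∫ ω, lse w (fun i => X i ω) ∂P ≤ ∫ ω, lse w (fun i => Y i ω) ∂Q := by
  obtain ⟨i₀, hi₀⟩ : ∃ i, w i ≠ 0 := by
    by_contra! h
    simp [h] at hW
  refine le_of_tendsto_of_tendsto (hX.tendsto_integral_lse_restrict hv hw hs hW)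
    (hY.tendsto_integral_lse_restrict hv' hw hs hW) ?_
  filter_upwards [eventually_ge_atTop {i₀}] with s hs'
  have hpos : 0 < ∑ i : s, w i :=
    Finset.sum_pos' (fun i _ => hw i) ⟨⟨i₀, hs' (Finset.mem_singleton_self i₀)⟩,
      Finset.mem_univ _, lt_of_le_of_ne (hw i₀) (Ne.symm hi₀)⟩
  have h := (hX.comp fun i : s => (i : ι)).integral_lse_le (hY.comp fun i : s => (i : ι))
    (fun i => hw i) hpos (c := 0) (fun i j => by linarith [hc i j])
  simpa using h

end

/-! ### Overlaps of spin configurations -/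

theorem spinVal_mul_self (s : ℤˣ) : spinVal s * spinVal s = 1 := by
  rcases Int.units_eq_one_or s with rfl | rfl <;> simp [spinVal]

theorem overlap_self {N : ℕ} (hN : 1 ≤ N) (σ : SpinConfig N) : overlap σ σ = 1 := by
  have : (N : ℝ) ≠ 0 := by positivity
  simp [overlap, spinVal_mul_self, this]

theorem overlap_posSemidef (N : ℕ) :
    (Matrix.of fun σ σ' : SpinConfig N => overlap σ σ').PosSemidef := by
  refine posSemidef_of_iff.2 ⟨fun σ σ' => ?_, fun s x => ?_⟩
  · unfold overlap
    exact congrArg _ (Finset.sum_congr rfl fun i _ => mul_comm _ _)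
  · have : ∑ σ ∈ s, ∑ σ' ∈ s, x σ * overlap σ σ' * x σ' =
        (1 / (N : ℝ)) * ∑ i, (∑ σ ∈ s, x σ * spinVal (σ i)) ^ 2 := by
      simp only [sq, overlap, Finset.mul_sum, Finset.sum_mul]
      simp_rw [Finset.sum_comm (s := s) (t := Finset.univ)]
      refine Finset.sum_congr rfl fun i _ => ?_
      rw [Finset.sum_comm]
      refine Finset.sum_congr rfl fun σ _ => Finset.sum_congr rfl fun σ' _ => ?_
      ring
    rw [this]
    positivity

theorem overlap_mem_Icc {N : ℕ} (σ σ' : SpinConfig N) : overlap σ σ' ∈ Icc (-1 : ℝ) 1 := by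
  rcases Nat.eq_zero_or_pos N with rfl | hN
  · simp [overlap]
  · exact abs_le_one_of_diag_eq_one (overlap_posSemidef N) (fun σ => overlap_self hN σ) σ σ'

/-! ### The covariance function and its derivative -/

section

variable {a : ℕ → ℝ}

theorem summable_covFun (ha : HasSum (fun r : ℕ => |a (r + 1)| ^ 2) 1) {x : ℝ}
    (hx : x ∈ Icc (-1 : ℝ) 1) : Summable fun r : ℕ => |a (r + 1)| ^ 2 * x ^ (r + 1) := by
  refine Summable.of_norm_bounded ha.summable fun r => ?_
  rw [norm_mul, Real.norm_of_nonneg (sq_nonneg |a (r + 1)|), norm_pow, Real.norm_eq_abs]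
  exact mul_le_of_le_one_right (sq_nonneg _) (pow_le_one₀ (abs_nonneg _) (abs_le.2 hx))

theorem covFun_one (ha : HasSum (fun r : ℕ => |a (r + 1)| ^ 2) 1) : covFun a 1 = 1 := by
  simpa [covFun] using ha.tsum_eq

theorem covFun_posSemidef (ha : HasSum (fun r : ℕ => |a (r + 1)| ^ 2) 1) {ι : Type*}
    {C : ι → ι → ℝ} (hC : (Matrix.of C).PosSemidef) (h1 : ∀ i j, C i j ∈ Icc (-1 : ℝ) 1) :
    (Matrix.of fun i j => covFun a (C i j)).PosSemidef :=
  posSemidef_of_powerSeries hC (fun _ => sq_nonneg _) (fun r => r + 1) fun i j =>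
    summable_covFun ha (h1 i j)

theorem summable_deriv_covFun (ha : HasSum (fun r : ℕ => |a (r + 1)| ^ 2) 1) {s : ℝ}
    (h0 : 0 ≤ s) (h1 : s < 1) :
    Summable fun r : ℕ => |a (r + 1)| ^ 2 * (((r : ℝ) + 1) * s ^ r) := by
  have hs : Summable fun r : ℕ => ((r : ℝ) + 1) * s ^ r := by
    have h := summable_pow_mul_geometric_of_norm_lt_one (R := ℝ) 1 (r := s)
      (by rwa [Real.norm_of_nonneg h0])
    have h' := summable_geometric_of_lt_one h0 h1
    exact (h.add h').congr fun r => by simp; ring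
  refine Summable.of_nonneg_of_le (fun r => by positivity) (fun r => ?_) hs
  exact mul_le_of_le_one_left (by positivity) (le_hasSum ha r fun _ _ => sq_nonneg _)

theorem hasDerivAt_covFun (ha : HasSum (fun r : ℕ => |a (r + 1)| ^ 2) 1) {x : ℝ}
    (hx : |x| < 1) :
    HasDerivAt (covFun a) (∑' r : ℕ, |a (r + 1)| ^ 2 * (((r : ℝ) + 1) * x ^ r)) x := by
  obtain ⟨s, hxs, hs1⟩ := exists_between hx
  have h0 : 0 ≤ s := (abs_nonneg x).trans hxs.le
  refine hasDerivAt_tsum_of_isPreconnected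
    (g := fun (r : ℕ) (y : ℝ) => |a (r + 1)| ^ 2 * y ^ (r + 1))
    (g' := fun (r : ℕ) (y : ℝ) => |a (r + 1)| ^ 2 * (((r : ℝ) + 1) * y ^ r))
    (t := Ioo (-s) s) (y₀ := x) (summable_deriv_covFun ha h0 hs1)
    isOpen_Ioo isPreconnected_Ioo (fun r y _ => ?_) (fun r y hy => ?_) (abs_lt.1 hxs)
    (summable_covFun ha (abs_le.1 hx.le)) (abs_lt.1 hxs)
  · have := (hasDerivAt_pow (r + 1) y).const_mul (|a (r + 1)| ^ 2)
    simpa using this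
  · rw [norm_mul, norm_mul, Real.norm_of_nonneg (sq_nonneg |a (r + 1)|), norm_pow,
      Real.norm_of_nonneg (by positivity : (0 : ℝ) ≤ r + 1), Real.norm_eq_abs]
    have : |y| ≤ s := (abs_lt.2 hy).le
    gcongr

theorem covDeriv_covFun (ha : HasSum (fun r : ℕ => |a (r + 1)| ^ 2) 1) {x : ℝ} (hx : |x| < 1) :
    covDeriv (covFun a) x = ∑' r : ℕ, |a (r + 1)| ^ 2 * (((r : ℝ) + 1) * x ^ r) := by
  rw [covDeriv, derivWithin_of_mem_nhds (Icc_mem_nhds (abs_lt.1 hx).1 (abs_lt.1 hx).2)]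
  exact (hasDerivAt_covFun ha hx).deriv

theorem continuousOn_covDeriv {f : ℝ → ℝ} (hf : ContDiffOn ℝ 2 f (Icc (-1 : ℝ) 1)) :
    ContinuousOn (covDeriv f) (Icc (-1 : ℝ) 1) :=
  hf.continuousOn_derivWithin (uniqueDiffOn_Icc (by norm_num)) (by norm_num)

theorem hasDerivWithinAt_covDeriv {f : ℝ → ℝ} (hf : ContDiffOn ℝ 2 f (Icc (-1 : ℝ) 1)) {x : ℝ}
    (hx : x ∈ Icc (-1 : ℝ) 1) : HasDerivWithinAt f (covDeriv f x) (Icc (-1) 1) x :=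
  ((hf.differentiableOn (by norm_num)) x hx).hasDerivWithinAt

theorem abs_scale_lt_one {x s : ℝ} (hx : x ∈ Icc (-1 : ℝ) 1) (hs : s ∈ Ico (0 : ℝ) 1) :
    |s * x| < 1 := by
  rw [abs_mul, abs_of_nonneg hs.1]
  exact (mul_le_of_le_one_right hs.1 (abs_le.2 hx)).trans_lt hs.2

theorem eventually_mem_Ico_zero_one : ∀ᶠ s in 𝓝[<] (1 : ℝ), s ∈ Ico (0 : ℝ) 1 := by
  filter_upwards [Ioo_mem_nhdsLT (zero_lt_one' ℝ)] with s hs using ⟨hs.1.le, hs.2⟩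

theorem tendsto_scale_nhdsWithin {x : ℝ} (hx : x ∈ Icc (-1 : ℝ) 1) :
    Tendsto (fun s => s * x) (𝓝[<] (1 : ℝ)) (𝓝[Icc (-1 : ℝ) 1] x) := by
  refine tendsto_nhdsWithin_iff.2 ⟨?_, ?_⟩
  · have h : Tendsto (fun s : ℝ => s * x) (𝓝 1) (𝓝 (1 * x)) := (continuous_mul_const x).tendsto 1
    rw [one_mul] at h
    exact h.mono_left nhdsWithin_le_nhds
  · filter_upwards [eventually_mem_Ico_zero_one] with s hs
      using abs_le.1 (abs_scale_lt_one hx hs).le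

/-- Inside the interval of convergence the derivative is a power series with nonnegative
coefficients; the endpoints are reached by continuity. -/
theorem covDeriv_posSemidef (ha : HasSum (fun r : ℕ => |a (r + 1)| ^ 2) 1)
    (hf : ContDiffOn ℝ 2 (covFun a) (Icc (-1 : ℝ) 1)) {ι : Type*} {C : ι → ι → ℝ}
    (hC : (Matrix.of C).PosSemidef) (h1 : ∀ i j, C i j ∈ Icc (-1 : ℝ) 1) :
    (Matrix.of fun i j => covDeriv (covFun a) (C i j)).PosSemidef := by
  refine posSemidef_of_tendsto (l := 𝓝[<] (1 : ℝ))
    (D := fun s i j => covDeriv (covFun a) (s * C i j)) ?_ fun i j =>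
      ((continuousOn_covDeriv hf) _ (h1 i j)).tendsto.comp (tendsto_scale_nhdsWithin (h1 i j))
  filter_upwards [eventually_mem_Ico_zero_one] with s hs
  have h : ∀ i j, covDeriv (covFun a) (s * C i j) =
      ∑' r : ℕ, (|a (r + 1)| ^ 2 * ((r : ℝ) + 1)) * (s * C i j) ^ r := fun i j => by
    rw [covDeriv_covFun ha (abs_scale_lt_one (h1 i j) hs)]
    exact tsum_congr fun r => by ring
  simp only [h]
  refine posSemidef_of_powerSeries (posSemidef_of_const_mul hC hs.1) (fun r => by positivity)
    (fun r => r) fun i j => ?_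
  refine Summable.of_norm_bounded (summable_deriv_covFun ha (abs_nonneg (s * C i j))
    (abs_scale_lt_one (h1 i j) hs)) fun r => le_of_eq ?_
  rw [norm_mul, norm_pow, Real.norm_eq_abs (s * C i j), Real.norm_of_nonneg (by positivity)]
  ring

/-- `φ(x) = x f'(x) - f(x)` is again a power series with nonnegative coefficients. -/
theorem covPhi_posSemidef (ha : HasSum (fun r : ℕ => |a (r + 1)| ^ 2) 1)
    (hf : ContDiffOn ℝ 2 (covFun a) (Icc (-1 : ℝ) 1)) {ι : Type*} {C : ι → ι → ℝ}
    (hC : (Matrix.of C).PosSemidef) (h1 : ∀ i j, C i j ∈ Icc (-1 : ℝ) 1) :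
    (Matrix.of fun i j => covPhi (covFun a) (C i j)).PosSemidef := by
  have hcont : ContinuousOn (covPhi (covFun a)) (Icc (-1 : ℝ) 1) :=
    (continuousOn_id.mul (continuousOn_covDeriv hf)).sub hf.continuousOn
  refine posSemidef_of_tendsto (l := 𝓝[<] (1 : ℝ))
    (D := fun s i j => covPhi (covFun a) (s * C i j)) ?_ fun i j =>
      (hcont _ (h1 i j)).tendsto.comp (tendsto_scale_nhdsWithin (h1 i j))
  filter_upwards [eventually_mem_Ico_zero_one] with s hs
  have hsum : ∀ x : ℝ, |x| < 1 →
      Summable fun r : ℕ => |a (r + 1)| ^ 2 * (((r : ℝ) + 1) * x ^ r) := fun x hx => by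
    refine Summable.of_norm_bounded (summable_deriv_covFun ha (abs_nonneg x) hx) fun r =>
      le_of_eq ?_
    rw [norm_mul, norm_mul, Real.norm_of_nonneg (sq_nonneg |a (r + 1)|), norm_pow,
      Real.norm_of_nonneg (by positivity : (0 : ℝ) ≤ r + 1), Real.norm_eq_abs]
  have hcoef : ∀ (x : ℝ) (r : ℕ), x * (|a (r + 1)| ^ 2 * (((r : ℝ) + 1) * x ^ r)) -
      |a (r + 1)| ^ 2 * x ^ (r + 1) = (|a (r + 1)| ^ 2 * r) * x ^ (r + 1) := fun x r => by ring
  have h : ∀ i j, covPhi (covFun a) (s * C i j) =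
      ∑' r : ℕ, (|a (r + 1)| ^ 2 * r) * (s * C i j) ^ (r + 1) := fun i j => by
    have hx := abs_scale_lt_one (h1 i j) hs
    rw [covPhi, covDeriv_covFun ha hx, covFun, ← tsum_mul_left,
      ← ((hsum _ hx).mul_left _).tsum_sub (summable_covFun ha (abs_le.1 hx.le))]
    exact tsum_congr fun r => hcoef _ r
  simp only [h]
  refine posSemidef_of_powerSeries (posSemidef_of_const_mul hC hs.1) (fun r => by positivity)
    (fun r => r + 1) fun i j => ?_
  have hx := abs_scale_lt_one (h1 i j) hs
  exact (((hsum _ hx).mul_left (s * C i j)).sub (summable_covFun ha (abs_le.1 hx.le))).congr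
    fun r => hcoef _ r

end

theorem ConvexOn.tangent_le {f : ℝ → ℝ} (hc : ConvexOn ℝ (Icc (-1 : ℝ) 1) f)
    (hf : ContDiffOn ℝ 2 f (Icc (-1 : ℝ) 1)) {x y : ℝ} (hx : x ∈ Icc (-1 : ℝ) 1)
    (hy : y ∈ Icc (-1 : ℝ) 1) : f x + covDeriv f x * (y - x) ≤ f y := by
  have hd := hasDerivWithinAt_covDeriv hf hx
  rcases lt_trichotomy x y with h | rfl | h
  · have := hc.le_slope_of_hasDerivWithinAt hx hy h hd
    rw [slope_def_field, le_div_iff₀ (by linarith)] at this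
    linarith
  · simp
  · have := hc.slope_le_of_hasDerivWithinAt hy hx h hd
    rw [slope_def_field, div_le_iff₀ (by linarith)] at this
    linarith

/-- A function of class `C²` on `[-1, 1]` has a Lipschitz derivative and a quadratic Taylor
remainder. -/
theorem exists_taylor_bound {f : ℝ → ℝ} (hf : ContDiffOn ℝ 2 f (Icc (-1 : ℝ) 1)) :
    ∃ B : ℝ, 0 ≤ B ∧ ∀ x ∈ Icc (-1 : ℝ) 1, ∀ y ∈ Icc (-1 : ℝ) 1,
      |covDeriv f y - covDeriv f x| ≤ B * |y - x| ∧
      |f y - f x - covDeriv f x * (y - x)| ≤ B * (y - x) ^ 2 := by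
  have hu : UniqueDiffOn ℝ (Icc (-1 : ℝ) 1) := uniqueDiffOn_Icc (by norm_num)
  have h1 : ContDiffOn ℝ 1 (covDeriv f) (Icc (-1 : ℝ) 1) := hf.derivWithin hu (by norm_num)
  have hc2 := h1.continuousOn_derivWithin hu le_rfl
  obtain ⟨B, hB⟩ := isCompact_Icc.exists_bound_of_continuousOn hc2
  have hlip : ∀ x ∈ Icc (-1 : ℝ) 1, ∀ y ∈ Icc (-1 : ℝ) 1,
      |covDeriv f y - covDeriv f x| ≤ B * |y - x| := fun x hx y hy =>
    (convex_Icc (-1 : ℝ) 1).norm_image_sub_le_of_norm_hasDerivWithin_le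
      (fun z hz => ((h1.differentiableOn (by norm_num)) z hz).hasDerivWithinAt) hB hx hy
  refine ⟨B, (norm_nonneg _).trans (hB 0 (by norm_num)), fun x hx y hy => ⟨hlip x hx y hy, ?_⟩⟩
  have hsub : uIcc x y ⊆ Icc (-1 : ℝ) 1 := uIcc_subset_Icc hx hy
  have key := (convex_uIcc x y).norm_image_sub_le_of_norm_hasDerivWithin_le
    (f := fun z => f z - covDeriv f x * z) (f' := fun z => covDeriv f z - covDeriv f x)
    (C := B * |y - x|) (fun z hz => ?_) (fun z hz => ?_) left_mem_uIcc right_mem_uIcc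
  · rw [Real.norm_eq_abs, Real.norm_eq_abs, mul_assoc, ← sq, sq_abs] at key
    refine le_trans (le_of_eq ?_) key
    congr 1
    ring
  · have := ((hasDerivWithinAt_covDeriv hf (hsub hz)).mono hsub).sub
      ((hasDerivWithinAt_id z (uIcc x y)).const_mul (covDeriv f x))
    rw [mul_one] at this
    exact this
  · refine (hlip x hx z (hsub hz)).trans ?_
    have hB0 : 0 ≤ B := (norm_nonneg _).trans (hB 0 (by norm_num))
    gcongr 1
    exact abs_sub_left_of_mem_uIcc hz

/-! ### The mean free energy of the model -/

/-- The weight `exp (β h · σ)` of a configuration in the magnetic field. -/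
def spinWeight {N : ℕ} (β h : ℝ) (σ : SpinConfig N) : ℝ := Real.exp (β * fieldTerm h σ)

theorem spinWeight_pos {N : ℕ} (β h : ℝ) (σ : SpinConfig N) : 0 < spinWeight β h σ :=
  Real.exp_pos _

theorem sum_spinWeight_pos (N : ℕ) (β h : ℝ) : 0 < ∑ σ : SpinConfig N, spinWeight β h σ :=
  Finset.sum_pos (fun σ _ => spinWeight_pos β h σ) Finset.univ_nonempty

theorem log_partitionFn {N : ℕ} (β h : ℝ) (k : SpinConfig N → ℝ) :
    Real.log (partitionFn β h k) = lse (spinWeight β h) fun σ => β * k σ := by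
  rw [lse_eq_log_sum, partitionFn]
  congr 1
  refine Finset.sum_congr rfl fun σ _ => ?_
  rw [spinWeight, ← Real.exp_add, hamiltonian]
  congr 1
  ring

theorem measurable_log_partitionFn {N : ℕ} (β h : ℝ) :
    Measurable fun k : SpinConfig N → ℝ => Real.log (partitionFn β h k) := by
  unfold partitionFn hamiltonian
  fun_prop

theorem fieldTerm_append {N M : ℕ} (h : ℝ) (σ : SpinConfig N) (τ : SpinConfig M) :
    fieldTerm h (Fin.append σ τ) = fieldTerm h σ + fieldTerm h τ := by
  simp [fieldTerm, Fin.sum_univ_add]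

theorem spinWeight_append {N M : ℕ} (β h : ℝ) (σ : SpinConfig N) (τ : SpinConfig M) :
    spinWeight β h (Fin.append σ τ) = spinWeight β h σ * spinWeight β h τ := by
  rw [spinWeight, fieldTerm_append, mul_add, Real.exp_add, spinWeight, spinWeight]

theorem natCast_mul_overlap {N : ℕ} (σ σ' : SpinConfig N) :
    (N : ℝ) * overlap σ σ' = ∑ i, spinVal (σ i) * spinVal (σ' i) := by
  rcases Nat.eq_zero_or_pos N with rfl | hN
  · simp
  · have : (N : ℝ) ≠ 0 := by positivity
    rw [overlap]; field_simp

theorem overlap_append {N M : ℕ} (σ σ' : SpinConfig N) (τ τ' : SpinConfig M) :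
    ((N : ℝ) + M) * overlap (Fin.append σ τ) (Fin.append σ' τ') =
      N * overlap σ σ' + M * overlap τ τ' := by
  rw [← Nat.cast_add, natCast_mul_overlap, natCast_mul_overlap, natCast_mul_overlap,
    Fin.sum_univ_add]
  simp

/-- Factorization of the free energy over a product. -/
theorem lse_prod {ι κ : Type*} {w x : ι → ℝ} {w' y : κ → ℝ} (hw : ∀ i, 0 ≤ w i)
    (hw' : ∀ j, 0 ≤ w' j) (h1 : Summable fun i => w i * Real.exp (x i))
    (h2 : Summable fun j => w' j * Real.exp (y j))
    (h1' : 0 < ∑' i, w i * Real.exp (x i)) (h2' : 0 < ∑' j, w' j * Real.exp (y j)) :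
    lse (fun p : ι × κ => w p.1 * w' p.2) (fun p => x p.1 + y p.2) = lse w x + lse w' y := by
  rw [lse, lse, lse, ← Real.log_mul h1'.ne' h2'.ne', tsum_mul_tsum_of_summable_norm]
  · congr 1
    exact tsum_congr fun p => by rw [Real.exp_add]; ring
  · exact h1.congr fun i => by
      rw [Real.norm_of_nonneg (mul_nonneg (hw i) (Real.exp_pos _).le)]
  · exact h2.congr fun i => by
      rw [Real.norm_of_nonneg (mul_nonneg (hw' i) (Real.exp_pos _).le)]

theorem lse_prod_fintype {ι κ : Type*} [Fintype ι] [Fintype κ] {w : ι → ℝ} {w' : κ → ℝ}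
    (hw : ∀ i, 0 ≤ w i) (hw' : ∀ j, 0 ≤ w' j) (hW : 0 < ∑ i, w i) (hW' : 0 < ∑ j, w' j)
    (x : ι → ℝ) (y : κ → ℝ) :
    lse (fun p : ι × κ => w p.1 * w' p.2) (fun p => x p.1 + y p.2) = lse w x + lse w' y :=
  lse_prod hw hw' (hasSum_fintype _).summable (hasSum_fintype _).summable
    (by rw [tsum_fintype]; exact sum_mul_exp_pos hw hW x)
    (by rw [tsum_fintype]; exact sum_mul_exp_pos hw' hW' y)

theorem lse_comp_equiv {ι κ : Type*} (e : ι ≃ κ) (w x : κ → ℝ) :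
    lse (fun i => w (e i)) (fun i => x (e i)) = lse w x := by
  rw [lse, lse, e.tsum_eq fun k => w k * Real.exp (x k)]

/-- The covariance of the interaction `K_N`. -/
def interactionCov (a : ℕ → ℝ) (N : ℕ) (σ σ' : SpinConfig N) : ℝ :=
  (N : ℝ) / 2 * covFun a (overlap σ σ')

/-- The mean `𝔼 ln Z_N`, computed with the canonical law of the interaction. -/
def meanLogPartition (a : ℕ → ℝ) (β h : ℝ) (N : ℕ) : ℝ :=
  quenched (gaussianLaw (interactionCov a N)) β h fun σ k => k σ

section

variable {a : ℕ → ℝ}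

theorem interactionCov_posSemidef (ha : HasSum (fun r : ℕ => |a (r + 1)| ^ 2) 1) (N : ℕ) :
    (Matrix.of (interactionCov a N)).PosSemidef :=
  posSemidef_of_const_mul (covFun_posSemidef ha (overlap_posSemidef N) overlap_mem_Icc)
    (by positivity)

theorem interactionCov_self (ha : HasSum (fun r : ℕ => |a (r + 1)| ^ 2) 1) {N : ℕ}
    (σ : SpinConfig N) : interactionCov a N σ σ = N / 2 := by
  rcases Nat.eq_zero_or_pos N with rfl | hN
  · simp [interactionCov]
  · rw [interactionCov, overlap_self hN, covFun_one ha, mul_one]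

theorem isCenteredGaussian_interaction (ha : HasSum (fun r : ℕ => |a (r + 1)| ^ 2) 1) (N : ℕ) :
    IsCenteredGaussian (fun (σ : SpinConfig N) k => k σ) (gaussianLaw (interactionCov a N))
      (interactionCov a N) :=
  isGaussianLaw_gaussianLaw (interactionCov_posSemidef ha N)

variable {Ω : Type*} [MeasurableSpace Ω] {ν : Measure Ω} {N : ℕ} {K : SpinConfig N → Ω → ℝ}

theorem quenched_eq_meanLogPartition (ha : HasSum (fun r : ℕ => |a (r + 1)| ^ 2) 1)
    (hK : IsInteraction ν (covFun a) K) (β h : ℝ) :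
    quenched ν β h K = meanLogPartition a β h N :=
  IsCenteredGaussian.integral_comp_eq (C := interactionCov a N) hK
    (isCenteredGaussian_interaction ha N) (measurable_log_partitionFn β h)

theorem meanLogPartition_eq_integral_lse (a : ℕ → ℝ) (β h : ℝ) (N : ℕ) :
    meanLogPartition a β h N = ∫ k, lse (spinWeight β h) (fun σ => β * k σ)
      ∂(gaussianLaw (interactionCov a N)) := by
  rw [meanLogPartition, quenched]
  simp only [log_partitionFn]

theorem integrable_log_partitionFn (hK : IsInteraction ν (covFun a) K) (β h : ℝ) :
    Integrable (fun ω => Real.log (partitionFn β h fun σ => K σ ω)) ν := by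
  simp only [log_partitionFn]
  exact (IsCenteredGaussian.const_mul (C := interactionCov a N) hK β).integrable_lse
    (fun σ => (spinWeight_pos β h σ).le) (sum_spinWeight_pos N β h)

/-- Splitting a system into two non-interacting parts lowers the mean free energy: by convexity of
`f`, the interaction of the whole system is less correlated than the sum of the two parts. -/
theorem meanLogPartition_superadditive (ha : HasSum (fun r : ℕ => |a (r + 1)| ^ 2) 1)
    (hconv : ConvexOn ℝ (Icc (-1 : ℝ) 1) (covFun a)) (β h : ℝ) (N M : ℕ) :
    meanLogPartition a β h N + meanLogPartition a β h M ≤ meanLogPartition a β h (N + M) := by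
  have hN := isCenteredGaussian_interaction ha N
  have hM := isCenteredGaussian_interaction ha M
  have hNM := isCenteredGaussian_interaction ha (N + M)
  have := hN.isProbabilityMeasure
  have := hM.isProbabilityMeasure
  have hX := hN.prod hM (τ := SpinConfig N × SpinConfig M) Prod.fst Prod.snd
    (fun _ => β) (fun _ => β)
  have hY := (hNM.comp fun p : SpinConfig N × SpinConfig M => Fin.append p.1 p.2).const_mul β
  have hw : ∀ p : SpinConfig N × SpinConfig M, 0 ≤ spinWeight β h p.1 * spinWeight β h p.2 :=
    fun p => mul_nonneg (spinWeight_pos β h _).le (spinWeight_pos β h _).le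
  have hW : 0 < ∑ p : SpinConfig N × SpinConfig M, spinWeight β h p.1 * spinWeight β h p.2 :=
    Finset.sum_pos (fun p _ => mul_pos (spinWeight_pos β h _) (spinWeight_pos β h _))
      Finset.univ_nonempty
  have key := hX.integral_lse_le hY hw hW (c := 0) fun p p' => by
    simp only [interactionCov_self ha]
    simp only [interactionCov]
    rcases Nat.eq_zero_or_pos (N + M) with h0 | h0
    · obtain ⟨rfl, rfl⟩ := Nat.add_eq_zero_iff.1 h0
      simp
    have hpos : (0 : ℝ) < N + M := by exact_mod_cast h0
    have hc := hconv.2 (overlap_mem_Icc p.1 p'.1) (overlap_mem_Icc p.2 p'.2)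
      (by positivity : (0 : ℝ) ≤ (N : ℝ) / ((N : ℝ) + M))
      (by positivity : (0 : ℝ) ≤ (M : ℝ) / ((N : ℝ) + M)) (by field_simp)
    have he : (N / (N + M) : ℝ) • overlap p.1 p'.1 + (M / (N + M) : ℝ) • overlap p.2 p'.2 =
        overlap (Fin.append p.1 p.2) (Fin.append p'.1 p'.2) := by
      have := overlap_append p.1 p'.1 p.2 p'.2
      rw [smul_eq_mul, smul_eq_mul]
      field_simp
      linarith
    rw [he, smul_eq_mul, smul_eq_mul, div_mul_eq_mul_div, div_mul_eq_mul_div, ← add_div,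
      le_div_iff₀ hpos] at hc
    push_cast
    nlinarith [mul_le_mul_of_nonneg_left hc (sq_nonneg β)]
  have e1 : ∀ k : (SpinConfig N → ℝ) × (SpinConfig M → ℝ),
      lse (fun p : SpinConfig N × SpinConfig M => spinWeight β h p.1 * spinWeight β h p.2)
        (fun p => β * k.1 p.1 + β * k.2 p.2) =
      lse (spinWeight β h) (fun σ => β * k.1 σ) + lse (spinWeight β h) (fun σ => β * k.2 σ) :=
    fun k => lse_prod_fintype (fun σ => (spinWeight_pos β h σ).le)
      (fun σ => (spinWeight_pos β h σ).le) (sum_spinWeight_pos N β h) (sum_spinWeight_pos M β h)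
      (fun σ => β * k.1 σ) (fun σ => β * k.2 σ)
  have e2 : ∀ k : SpinConfig (N + M) → ℝ,
      lse (fun p : SpinConfig N × SpinConfig M => spinWeight β h p.1 * spinWeight β h p.2)
        (fun p => β * k (Fin.append p.1 p.2)) = lse (spinWeight β h) fun σ => β * k σ := fun k => by
    simp only [← spinWeight_append]
    exact lse_comp_equiv (Fin.appendEquiv N M) (spinWeight β h) fun σ => β * k σ
  have i1 := (hN.const_mul β).integrable_lse (fun σ => (spinWeight_pos β h σ).le)
    (sum_spinWeight_pos N β h)
  have i2 := (hM.const_mul β).integrable_lse (fun σ => (spinWeight_pos β h σ).le)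
    (sum_spinWeight_pos M β h)
  simp only [e1, e2] at key
  rw [integral_add (i1.comp_fst _) (i2.comp_snd _), integral_fun_fst (fun k : SpinConfig N → ℝ =>
      lse (spinWeight β h) fun σ => β * k σ), integral_fun_snd (fun k : SpinConfig M → ℝ =>
      lse (spinWeight β h) fun σ => β * k σ)] at key
  simpa [meanLogPartition_eq_integral_lse] using key

theorem sum_spinWeight_le (N : ℕ) (β h : ℝ) :
    ∑ σ : SpinConfig N, spinWeight β h σ ≤ Real.exp (N * (Real.log 2 + |β * h|)) := by
  have h1 : ∀ σ : SpinConfig N, spinWeight β h σ ≤ Real.exp (N * |β * h|) := fun σ => by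
    refine Real.exp_le_exp.2 ?_
    rw [fieldTerm, Finset.mul_sum]
    refine (Finset.sum_le_sum (g := fun _ => |β * h|) fun i _ => ?_).trans (by simp)
    rcases Int.units_eq_one_or (σ i) with hs | hs
    · simpa [spinVal, hs] using le_abs_self (β * h)
    · simpa [spinVal, hs] using neg_le_abs (β * h)
  refine (Finset.sum_le_sum fun σ _ => h1 σ).trans (le_of_eq ?_)
  rw [Finset.sum_const, Finset.card_univ, Fintype.card_fun, Fintype.card_fin,
    Fintype.card_units_int, nsmul_eq_mul, mul_add, Real.exp_add, Real.exp_nat_mul (Real.log 2),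
    Real.exp_log (by norm_num)]
  norm_num

theorem meanLogPartition_le (ha : HasSum (fun r : ℕ => |a (r + 1)| ^ 2) 1) (β h : ℝ) (N : ℕ) :
    meanLogPartition a β h N ≤ N * (Real.log 2 + |β * h| + β ^ 2 / 2) := by
  have hN := isCenteredGaussian_interaction ha N
  have := hN.isProbabilityMeasure
  have hbd : ∀ σ σ' : SpinConfig N, |covFun a (overlap σ σ')| ≤ 1 := fun σ σ' => by
    refine (norm_tsum_le_tsum_norm (summable_covFun ha (overlap_mem_Icc σ σ')).norm).trans ?_
    rw [← ha.tsum_eq]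
    refine (summable_covFun ha (overlap_mem_Icc σ σ')).norm.tsum_le_tsum (fun r => ?_) ha.summable
    rw [norm_mul, Real.norm_of_nonneg (sq_nonneg |a (r + 1)|), norm_pow, Real.norm_eq_abs]
    exact mul_le_of_le_one_right (sq_nonneg _)
      (pow_le_one₀ (abs_nonneg _) (abs_le.2 (overlap_mem_Icc σ σ')))
  -- comparison with the field that vanishes identically
  have key := (hN.const_mul β).integral_lse_le (hN.const_mul 0)
    (fun σ => (spinWeight_pos β h σ).le) (sum_spinWeight_pos N β h) (c := N * β ^ 2)
    fun σ σ' => by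
      rw [interactionCov_self ha, interactionCov]
      have := mul_le_mul_of_nonneg_left (abs_le.1 (hbd σ σ')).1
        (by positivity : (0 : ℝ) ≤ β ^ 2 * N / 2)
      nlinarith
  rw [← meanLogPartition_eq_integral_lse] at key
  refine key.trans ?_
  have hl : ∀ k : SpinConfig N → ℝ, lse (spinWeight β h) (fun σ => 0 * k σ) ≤
      N * (Real.log 2 + |β * h|) := fun k => by
    simp only [lse_eq_log_sum, zero_mul, Real.exp_zero, mul_one]
    exact (Real.log_le_log (sum_spinWeight_pos N β h) (sum_spinWeight_le N β h)).trans_eq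
      (Real.log_exp _)
  have := integral_mono ((hN.const_mul 0).integrable_lse (fun σ => (spinWeight_pos β h σ).le)
    (sum_spinWeight_pos N β h)) (integrable_const (N * (Real.log 2 + |β * h|))) hl
  simp only [integral_const, probReal_univ, one_smul] at this
  linarith

/-- Fekete's lemma for the mean free energy; the limit is also the supremum. -/
theorem exists_tendsto_meanLogPartition (ha : HasSum (fun r : ℕ => |a (r + 1)| ^ 2) 1)
    (hconv : ConvexOn ℝ (Icc (-1 : ℝ) 1) (covFun a)) (β h : ℝ) :
    ∃ P : ℝ, Tendsto (fun N : ℕ => meanLogPartition a β h N / N) atTop (𝓝 P) ∧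
      ∀ N : ℕ, 1 ≤ N → meanLogPartition a β h N ≤ N * P := by
  have hsub : Subadditive fun N => -meanLogPartition a β h N := fun N M => by
    have := meanLogPartition_superadditive ha hconv β h N M
    linarith
  have hbdd : BddBelow (range fun N : ℕ => -meanLogPartition a β h N / N) := by
    refine ⟨-(Real.log 2 + |β * h| + β ^ 2 / 2), ?_⟩
    rintro _ ⟨N, rfl⟩
    rcases Nat.eq_zero_or_pos N with rfl | hN
    · have : 0 ≤ Real.log 2 + |β * h| + β ^ 2 / 2 := by positivity
      simpa only [Nat.cast_zero, div_zero, Left.neg_nonpos_iff] using this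
    · have hN' : (0 : ℝ) < N := by exact_mod_cast hN
      simp only
      rw [le_div_iff₀ hN']
      linarith [meanLogPartition_le ha β h N]
  refine ⟨-hsub.lim, ?_, fun N hN => ?_⟩
  · refine (hsub.tendsto_lim hbdd).neg.congr fun N => ?_
    ring
  · have := hsub.lim_le_div hbdd (n := N) (by omega)
    have hN' : (0 : ℝ) < N := by exact_mod_cast hN
    rw [le_div_iff₀ hN'] at this
    linarith

/-! ### Almost sure convergence -/

theorem lintegral_log_partitionFn_sub_pow_four_le
    (ha : HasSum (fun r : ℕ => |a (r + 1)| ^ 2) 1) (hK : IsInteraction ν (covFun a) K) (β h : ℝ) :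
    ∫⁻ ω, ENNReal.ofReal ((Real.log (partitionFn β h fun σ => K σ ω) -
        meanLogPartition a β h N) ^ 4) ∂ν ≤
      ENNReal.ofReal ((Real.pi / 2) ^ 4 * ((β ^ 2 * (N / 2)) ^ 2 * gaussianFourthMoment)) := by
  have hβ := IsCenteredGaussian.const_mul (C := interactionCov a N) hK β
  have key := lintegral_lse_sub_integral_pow_four_le hβ.isGaussianLaw_map (v := β ^ 2 * (N / 2))
    (fun σ => by rw [interactionCov_self ha]) (fun σ => (spinWeight_pos β h σ).le)
    (sum_spinWeight_pos N β h)
  have hm := (continuous_lse (w := spinWeight (N := N) β h) (fun σ => (spinWeight_pos β h σ).le)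
    (sum_spinWeight_pos N β h)).measurable
  rw [lintegral_map' (((hm.sub_const _).pow_const 4).ennreal_ofReal.aemeasurable)
    hβ.aemeasurable_pi, integral_map hβ.aemeasurable_pi hm.aestronglyMeasurable] at key
  rw [← quenched_eq_meanLogPartition ha hK, quenched]
  simpa only [log_partitionFn] using key

/-- Almost sure convergence from the summability of the fourth moments. -/
theorem ae_tendsto_zero_of_summable_lintegral {Y : ℕ → Ω → ℝ} (hY : ∀ n, AEMeasurable (Y n) ν)
    {c : ℕ → ℝ} (hc : ∀ n, 0 ≤ c n) (hs : Summable c)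
    (h : ∀ n, ∫⁻ ω, ENNReal.ofReal (Y n ω ^ 4) ∂ν ≤ ENNReal.ofReal (c n)) :
    ∀ᵐ ω ∂ν, Tendsto (fun n => Y n ω) atTop (𝓝 0) := by
  have hfin : ∫⁻ ω, ∑' n, ENNReal.ofReal (Y n ω ^ 4) ∂ν ≠ ⊤ := by
    rw [lintegral_tsum fun n => ((hY n).pow_const 4).ennreal_ofReal]
    refine ((ENNReal.tsum_le_tsum h).trans_lt ?_).ne
    rw [← ENNReal.ofReal_tsum_of_nonneg hc hs]
    exact ENNReal.ofReal_lt_top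
  filter_upwards [ae_lt_top' (AEMeasurable.tsum fun n =>
    ((hY n).pow_const 4).ennreal_ofReal) hfin] with ω hω
  have h4 := ENNReal.tendsto_atTop_zero_of_tsum_ne_top hω.ne
  have h4' : Tendsto (fun n => Y n ω ^ 4) atTop (𝓝 0) := by
    have := (ENNReal.tendsto_toReal ENNReal.zero_ne_top).comp h4
    refine this.congr fun n => ?_
    exact ENNReal.toReal_ofReal (by positivity)
  refine Metric.tendsto_atTop.2 fun ε hε => ?_
  obtain ⟨n₀, hn₀⟩ := Metric.tendsto_atTop.1 h4' (ε ^ 4) (by positivity)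
  refine ⟨n₀, fun n hn => ?_⟩
  have := hn₀ n hn
  rw [Real.dist_eq, sub_zero, abs_pow] at this
  rw [Real.dist_eq, sub_zero]
  exact lt_of_pow_lt_pow_left₀ 4 hε.le this

/-- The fourth moment of `N⁻¹ (ln Z_N - 𝔼 ln Z_N)` is of order `N⁻²`, which is summable. -/
theorem ae_tendsto_randomPressure {K : (N : ℕ) → SpinConfig N → Ω → ℝ}
    (ha : HasSum (fun r : ℕ => |a (r + 1)| ^ 2) 1)
    (hK : ∀ N, 1 ≤ N → IsInteraction ν (covFun a) (K N)) {β h P : ℝ}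
    (hP : Tendsto (fun N : ℕ => meanLogPartition a β h N / N) atTop (𝓝 P)) :
    ∀ᵐ ω ∂ν, Tendsto (fun N : ℕ => randomPressure β h (K N) ω) atTop (𝓝 P) := by
  set c : ℝ := (Real.pi / 2) ^ 4 * ((β ^ 2 / 2) ^ 2 * gaussianFourthMoment) with hc
  have hc0 : 0 ≤ c := by have := gaussianFourthMoment_nonneg; positivity
  have h0 := ae_tendsto_zero_of_summable_lintegral (ν := ν)
    (Y := fun n ω => (1 / ((n + 1 : ℕ) : ℝ)) * (Real.log (partitionFn β h fun σ => K (n + 1) σ ω) -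
      meanLogPartition a β h (n + 1)))
    (c := fun n => c * (1 / ((n : ℝ) + 1) ^ 2)) (fun n => ?_) (fun n => by positivity) ?_ fun n => ?_
  · filter_upwards [h0] with ω hω
    rw [← tendsto_add_atTop_iff_nat 1] at hP ⊢
    refine ((hω.add hP).congr fun n => ?_).trans (by rw [zero_add])
    rw [randomPressure]
    ring
  · exact (((integrable_log_partitionFn (hK (n + 1) (by omega)) β h).aemeasurable).sub_const
      _).const_mul _
  · refine Summable.mul_left _ ?_
    have := (summable_nat_add_iff 1).2 (Real.summable_one_div_nat_pow.2 one_lt_two)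
    simpa using this
  · have key := lintegral_log_partitionFn_sub_pow_four_le ha (hK (n + 1) (by omega)) β h
    have hpos : (0 : ℝ) < ((n + 1 : ℕ) : ℝ) := by positivity
    simp only [mul_pow]
    simp only [ENNReal.ofReal_mul (by positivity : (0 : ℝ) ≤ (1 / ((n + 1 : ℕ) : ℝ)) ^ 4)]
    rw [lintegral_const_mul' _ _ ENNReal.ofReal_ne_top]
    refine (mul_le_mul_right key _).trans ?_
    rw [← ENNReal.ofReal_mul (by positivity)]
    refine ENNReal.ofReal_le_ofReal (le_of_eq ?_)
    rw [hc]
    push_cast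
    field_simp

end

/-! ### The functional of a random overlap structure -/

/-- The deterministic part of the definition of a random overlap structure, at one configuration. -/
structure ROSt.IsRegular (S : ROSt.{v}) (ω : S.Ω) : Prop where
  nonneg : ∀ n, 0 ≤ S.ξ n ω
  summable : Summable fun n => S.ξ n ω
  sum_pos : 0 < ∑' n, S.ξ n ω
  posSemidef : (Matrix.of fun n n' => S.q n n' ω).PosSemidef
  diag_one : ∀ n, S.q n n ω = 1

theorem ROSt.ae_isRegular (S : ROSt.{v}) : ∀ᵐ ω ∂S.μ, S.IsRegular ω := by
  filter_upwards [S.nonneg, S.summable, S.sum_pos, S.posSemidef, S.diag_one] with ω h1 h2 h3 h4 h5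
  exact ⟨h1, h2, h3, h4, h5⟩

/-- The weights `ξ_α exp (β h · σ)` of the numerator of `G_M`. -/
def ROSt.cavityWeight (S : ROSt.{v}) (β h : ℝ) (M : ℕ) (ω : S.Ω) (p : ℕ × SpinConfig M) : ℝ :=
  S.ξ p.1 ω * spinWeight β h p.2

theorem tsum_mul_exp_pos {ι : Type*} {w x : ι → ℝ} (hw : ∀ i, 0 ≤ w i) (hW : 0 < ∑' i, w i)
    (hs : Summable fun i => w i * Real.exp (x i)) : 0 < ∑' i, w i * Real.exp (x i) := by
  obtain ⟨i, hi⟩ : ∃ i, w i ≠ 0 := by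
    by_contra! h
    simp [h] at hW
  have : 0 < w i * Real.exp (x i) := mul_pos (lt_of_le_of_ne (hw i) (Ne.symm hi)) (Real.exp_pos _)
  exact this.trans_le (hs.le_tsum i fun j _ => mul_nonneg (hw j) (Real.exp_pos _).le)

theorem integral_prod_snd_add_fst_add_const {α γ : Type*} [MeasurableSpace α] [MeasurableSpace γ]
    {μ : Measure α} {ρ : Measure γ} [IsProbabilityMeasure μ] [IsProbabilityMeasure ρ] {F : γ → ℝ}
    {G : α → ℝ} (hF : Integrable F ρ) (hG : Integrable G μ) (c : ℝ) :
    ∫ x, (F x.2 + G x.1 + c) ∂(μ.prod ρ) = ∫ y, F y ∂ρ + ∫ x, G x ∂μ + c := by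
  have h2 : Integrable (fun x : α × γ => F x.2) (μ.prod ρ) := hF.comp_snd μ
  have h1 : Integrable (fun x : α × γ => G x.1) (μ.prod ρ) := hG.comp_fst ρ
  have h3 : Integrable (fun x : α × γ => F x.2 + G x.1) (μ.prod ρ) := h2.add h1
  rw [integral_add h3 (integrable_const c), integral_add h2 h1, integral_fun_snd, integral_fun_fst]
  simp

namespace ROSt.IsRegular

variable {a : ℕ → ℝ} {S : ROSt.{v}} {ω : S.Ω}

theorem q_mem_Icc (hS : S.IsRegular ω) (n n' : ℕ) : S.q n n' ω ∈ Icc (-1 : ℝ) 1 :=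
  abs_le_one_of_diag_eq_one hS.posSemidef hS.diag_one n n'

theorem kappaCov_posSemidef (hS : S.IsRegular ω)
    (ha : HasSum (fun r : ℕ => |a (r + 1)| ^ 2) 1)
    (hf : ContDiffOn ℝ 2 (covFun a) (Icc (-1 : ℝ) 1)) :
    (Matrix.of (S.kappaCov (covFun a) ω)).PosSemidef := by
  have := posSemidef_of_const_mul (covPhi_posSemidef ha hf hS.posSemidef hS.q_mem_Icc)
    (c := 1 / 2) (by norm_num)
  convert this using 3
  unfold kappaCov
  ext n
  ring

theorem cavityCov_posSemidef (hS : S.IsRegular ω)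
    (ha : HasSum (fun r : ℕ => |a (r + 1)| ^ 2) 1)
    (hf : ContDiffOn ℝ 2 (covFun a) (Icc (-1 : ℝ) 1)) (M : ℕ) :
    (Matrix.of (S.cavityCov (covFun a) M ω)).PosSemidef :=
  posSemidef_of_mul (posSemidef_of_comp (posSemidef_of_const_mul
      (covDeriv_posSemidef ha hf hS.posSemidef hS.q_mem_Icc)
      (by positivity : (0 : ℝ) ≤ (M : ℝ) / 2)) Prod.fst)
    (posSemidef_of_comp (overlap_posSemidef M) Prod.snd)

theorem isCenteredGaussian_kappa (hS : S.IsRegular ω)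
    (ha : HasSum (fun r : ℕ => |a (r + 1)| ^ 2) 1)
    (hf : ContDiffOn ℝ 2 (covFun a) (Icc (-1 : ℝ) 1)) :
    IsCenteredGaussian (fun n (x : ℕ → ℝ) => x n) (gaussianLaw (S.kappaCov (covFun a) ω))
      (S.kappaCov (covFun a) ω) :=
  isGaussianLaw_gaussianLaw (hS.kappaCov_posSemidef ha hf)

theorem isCenteredGaussian_cavity (hS : S.IsRegular ω)
    (ha : HasSum (fun r : ℕ => |a (r + 1)| ^ 2) 1)
    (hf : ContDiffOn ℝ 2 (covFun a) (Icc (-1 : ℝ) 1)) (M : ℕ) :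
    IsCenteredGaussian (fun p (x : ℕ × SpinConfig M → ℝ) => x p)
      (gaussianLaw (S.cavityCov (covFun a) M ω)) (S.cavityCov (covFun a) M ω) :=
  isGaussianLaw_gaussianLaw (hS.cavityCov_posSemidef ha hf M)

theorem kappaCov_self (hS : S.IsRegular ω) (ha : HasSum (fun r : ℕ => |a (r + 1)| ^ 2) 1) (n : ℕ) :
    S.kappaCov (covFun a) ω n n = (covDeriv (covFun a) 1 - 1) / 2 := by
  rw [kappaCov, hS.diag_one, covPhi, covFun_one ha, one_mul]

theorem cavityCov_self (hS : S.IsRegular ω) {M : ℕ} (hM : 1 ≤ M) (p : ℕ × SpinConfig M) :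
    S.cavityCov (covFun a) M ω p p = M / 2 * covDeriv (covFun a) 1 := by
  rw [cavityCov, hS.diag_one, overlap_self hM, mul_one]

theorem cavityWeight_nonneg (hS : S.IsRegular ω) (β h : ℝ) (M : ℕ) (p : ℕ × SpinConfig M) :
    0 ≤ S.cavityWeight β h M ω p :=
  mul_nonneg (hS.nonneg _) (spinWeight_pos _ _ _).le

theorem summable_cavityWeight (hS : S.IsRegular ω) (β h : ℝ) (M : ℕ) :
    Summable (S.cavityWeight β h M ω) :=
  hS.summable.mul_of_nonneg (hasSum_fintype (spinWeight (N := M) β h)).summable hS.nonneg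
    fun σ => (spinWeight_pos β h σ).le

theorem tsum_cavityWeight (hS : S.IsRegular ω) (β h : ℝ) (M : ℕ) :
    ∑' p, S.cavityWeight β h M ω p = (∑' n, S.ξ n ω) * ∑ σ : SpinConfig M, spinWeight β h σ := by
  rw [← tsum_fintype (L := .unconditional _), hS.summable.tsum_mul_tsum
    (hasSum_fintype (spinWeight (N := M) β h)).summable (hS.summable_cavityWeight β h M)]
  rfl

theorem tsum_cavityWeight_pos (hS : S.IsRegular ω) (β h : ℝ) (M : ℕ) :
    0 < ∑' p, S.cavityWeight β h M ω p := by
  rw [hS.tsum_cavityWeight]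
  exact mul_pos hS.sum_pos (sum_spinWeight_pos M β h)

/-- Almost surely in the fields both series converge and are positive, so that the logarithm of the
quotient is a difference of free energies. -/
theorem ae_logRatio_eq (hS : S.IsRegular ω)
    (ha : HasSum (fun r : ℕ => |a (r + 1)| ^ 2) 1)
    (hf : ContDiffOn ℝ 2 (covFun a) (Icc (-1 : ℝ) 1)) (β h : ℝ) {M : ℕ} (hM : 1 ≤ M) :
    ∀ᵐ x ∂(S.fieldLaw (covFun a) M ω), S.logRatio β h M ω x =
      lse (S.cavityWeight β h M ω) (fun p => β * x.2 p) -
        lse (fun n => S.ξ n ω) (fun n => β * Real.sqrt M * x.1 n) := by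
  have hκ := (hS.isCenteredGaussian_kappa ha hf).const_mul (β * Real.sqrt M)
  have hV := (hS.isCenteredGaussian_cavity ha hf M).const_mul β
  have := hκ.isProbabilityMeasure
  have := hV.isProbabilityMeasure
  have h1 := hκ.ae_summable_exp (fun n => by rw [hS.kappaCov_self ha]) hS.nonneg hS.summable
  have h2 := hV.ae_summable_exp (fun n => by rw [hS.cavityCov_self hM])
    (hS.cavityWeight_nonneg β h M) (hS.summable_cavityWeight β h M)
  filter_upwards [Measure.quasiMeasurePreserving_fst.ae h1,
    Measure.quasiMeasurePreserving_snd.ae h2] with x hx1 hx2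
  have p1 := tsum_mul_exp_pos hS.nonneg hS.sum_pos hx1.1
  have p2 := tsum_mul_exp_pos (hS.cavityWeight_nonneg β h M) (hS.tsum_cavityWeight_pos β h M) hx2.1
  rw [lse, lse, ← Real.log_div p2.ne' p1.ne', logRatio]
  congr 2
  rw [hx2.1.tsum_prod]
  refine tsum_congr fun n => ?_
  rw [tsum_fintype]
  refine Finset.sum_congr rfl fun σ _ => ?_
  rw [cavityWeight, spinWeight, mul_assoc, ← Real.exp_add]
  congr 2
  ring

theorem integrable_lse_kappa (hS : S.IsRegular ω)
    (ha : HasSum (fun r : ℕ => |a (r + 1)| ^ 2) 1)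
    (hf : ContDiffOn ℝ 2 (covFun a) (Icc (-1 : ℝ) 1)) (β : ℝ) (M : ℕ) :
    Integrable (fun x : ℕ → ℝ => lse (fun n => S.ξ n ω) (fun n => β * Real.sqrt M * x n))
      (gaussianLaw (S.kappaCov (covFun a) ω)) :=
  ((hS.isCenteredGaussian_kappa ha hf).const_mul (β * Real.sqrt M)).integrable_lse_of_summable
    (fun n => by rw [hS.kappaCov_self ha]) hS.nonneg hS.summable hS.sum_pos

theorem integrable_lse_cavity (hS : S.IsRegular ω)
    (ha : HasSum (fun r : ℕ => |a (r + 1)| ^ 2) 1)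
    (hf : ContDiffOn ℝ 2 (covFun a) (Icc (-1 : ℝ) 1)) (β h : ℝ) {M : ℕ} (hM : 1 ≤ M) :
    Integrable (fun x : ℕ × SpinConfig M → ℝ => lse (S.cavityWeight β h M ω) (fun p => β * x p))
      (gaussianLaw (S.cavityCov (covFun a) M ω)) :=
  ((hS.isCenteredGaussian_cavity ha hf M).const_mul β).integrable_lse_of_summable
    (fun n => by rw [hS.cavityCov_self hM])
    (hS.cavityWeight_nonneg β h M) (hS.summable_cavityWeight β h M) (hS.tsum_cavityWeight_pos β h M)

theorem integrable_logRatio (hS : S.IsRegular ω)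
    (ha : HasSum (fun r : ℕ => |a (r + 1)| ^ 2) 1)
    (hf : ContDiffOn ℝ 2 (covFun a) (Icc (-1 : ℝ) 1)) (β h : ℝ) {M : ℕ} (hM : 1 ≤ M) :
    Integrable (S.logRatio β h M ω) (S.fieldLaw (covFun a) M ω) := by
  have := (hS.isCenteredGaussian_kappa ha hf).isProbabilityMeasure
  have := (hS.isCenteredGaussian_cavity ha hf M).isProbabilityMeasure
  refine Integrable.congr ?_ ((hS.ae_logRatio_eq ha hf β h hM).mono fun _ h => h.symm)
  exact ((hS.integrable_lse_cavity ha hf β h hM).comp_snd _).sub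
    ((hS.integrable_lse_kappa ha hf β M).comp_fst _)

theorem integral_logRatio (hS : S.IsRegular ω)
    (ha : HasSum (fun r : ℕ => |a (r + 1)| ^ 2) 1)
    (hf : ContDiffOn ℝ 2 (covFun a) (Icc (-1 : ℝ) 1)) (β h : ℝ) {M : ℕ} (hM : 1 ≤ M) :
    ∫ x, S.logRatio β h M ω x ∂(S.fieldLaw (covFun a) M ω) =
      ∫ y, lse (S.cavityWeight β h M ω) (fun p => β * y p)
          ∂(gaussianLaw (S.cavityCov (covFun a) M ω)) -
        ∫ x, lse (fun n => S.ξ n ω) (fun n => β * Real.sqrt M * x n)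
          ∂(gaussianLaw (S.kappaCov (covFun a) ω)) := by
  have := (hS.isCenteredGaussian_kappa ha hf).isProbabilityMeasure
  have := (hS.isCenteredGaussian_cavity ha hf M).isProbabilityMeasure
  rw [integral_congr_ae (hS.ae_logRatio_eq ha hf β h hM), fieldLaw, integral_sub
    ((hS.integrable_lse_cavity ha hf β h hM).comp_snd _)
    ((hS.integrable_lse_kappa ha hf β M).comp_fst _),
    integral_fun_snd (fun y : ℕ × SpinConfig M → ℝ =>
      lse (S.cavityWeight β h M ω) fun p => β * y p),
    integral_fun_fst (fun x : ℕ → ℝ => lse (fun n => S.ξ n ω) fun n => β * Real.sqrt M * x n)]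
  simp

/-- The numerator and the denominator of `G_M` are each close to the sum of their weights, uniformly
over all overlap structures; the total weight `∑ ξ` cancels in the quotient. -/
theorem integral_abs_logRatio_le (hS : S.IsRegular ω)
    (ha : HasSum (fun r : ℕ => |a (r + 1)| ^ 2) 1)
    (hf : ContDiffOn ℝ 2 (covFun a) (Icc (-1 : ℝ) 1)) (β h : ℝ) {M : ℕ} (hM : 1 ≤ M) :
    ∫ x, |S.logRatio β h M ω x| ∂(S.fieldLaw (covFun a) M ω) ≤
      2 * Real.exp (β ^ 2 * (M / 2 * covDeriv (covFun a) 1) / 2) +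
        2 * Real.exp ((β * Real.sqrt M) ^ 2 * ((covDeriv (covFun a) 1 - 1) / 2) / 2) +
        |Real.log (∑ σ : SpinConfig M, spinWeight β h σ)| := by
  have hκ := (hS.isCenteredGaussian_kappa ha hf).const_mul (β * Real.sqrt M)
  have hV := (hS.isCenteredGaussian_cavity ha hf M).const_mul β
  have := hκ.isProbabilityMeasure
  have := hV.isProbabilityMeasure
  have b1 := hκ.integral_abs_lse_sub_le (fun n => by rw [hS.kappaCov_self ha])
    hS.nonneg hS.summable hS.sum_pos
  have b2 := hV.integral_abs_lse_sub_le (fun n => by rw [hS.cavityCov_self hM])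
    (hS.cavityWeight_nonneg β h M) (hS.summable_cavityWeight β h M) (hS.tsum_cavityWeight_pos β h M)
  have i1 : Integrable (fun x : ℕ → ℝ => |lse (fun n => S.ξ n ω)
      (fun n => β * Real.sqrt M * x n) - Real.log (∑' n, S.ξ n ω)|)
      (gaussianLaw (S.kappaCov (covFun a) ω)) := ((hS.integrable_lse_kappa ha hf β M).sub
    (integrable_const (Real.log (∑' n, S.ξ n ω)))).abs
  have i2 : Integrable (fun y : ℕ × SpinConfig M → ℝ => |lse (S.cavityWeight β h M ω)
      (fun p => β * y p) - Real.log (∑' p, S.cavityWeight β h M ω p)|)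
      (gaussianLaw (S.cavityCov (covFun a) M ω)) := ((hS.integrable_lse_cavity ha hf β h hM).sub
    (integrable_const (Real.log (∑' p, S.cavityWeight β h M ω p)))).abs
  have hle : ∫ x, |S.logRatio β h M ω x| ∂(S.fieldLaw (covFun a) M ω) ≤
      ∫ x, (|lse (S.cavityWeight β h M ω) (fun p => β * x.2 p) -
          Real.log (∑' p, S.cavityWeight β h M ω p)| +
        |lse (fun n => S.ξ n ω) (fun n => β * Real.sqrt M * x.1 n) - Real.log (∑' n, S.ξ n ω)| +
        |Real.log (∑ σ : SpinConfig M, spinWeight β h σ)|) ∂(S.fieldLaw (covFun a) M ω) := by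
    refine integral_mono_ae (hS.integrable_logRatio ha hf β h hM).abs
      (((i2.comp_snd _).add (i1.comp_fst _)).add (integrable_const _)) ?_
    filter_upwards [hS.ae_logRatio_eq ha hf β h hM] with x hx
    simp only [hx]
    have hlog : Real.log (∑' p, S.cavityWeight β h M ω p) =
        Real.log (∑' n, S.ξ n ω) + Real.log (∑ σ : SpinConfig M, spinWeight β h σ) := by
      rw [hS.tsum_cavityWeight, Real.log_mul hS.sum_pos.ne' (sum_spinWeight_pos M β h).ne']
    refine le_trans (le_of_eq ?_) ((abs_add_le _ _).trans (add_le_add_left (abs_sub _ _) _))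
    rw [hlog]
    congr 1
    ring
  refine hle.trans ?_
  rw [fieldLaw, integral_prod_snd_add_fst_add_const i2 i1]
  gcongr

/-- The cavity field of an overlap structure is less correlated than the sum of the interaction and
of the field `√M κ`: this is the tangent inequality for the convex function `f`. -/
theorem meanLogPartition_le_integral_logRatio (hS : S.IsRegular ω)
    (ha : HasSum (fun r : ℕ => |a (r + 1)| ^ 2) 1)
    (hconv : ConvexOn ℝ (Icc (-1 : ℝ) 1) (covFun a))
    (hf : ContDiffOn ℝ 2 (covFun a) (Icc (-1 : ℝ) 1)) (β h : ℝ) {M : ℕ} (hM : 1 ≤ M) :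
    meanLogPartition a β h M ≤ ∫ x, S.logRatio β h M ω x ∂(S.fieldLaw (covFun a) M ω) := by
  have hκ := hS.isCenteredGaussian_kappa ha hf
  have hK := isCenteredGaussian_interaction ha M
  have hV := (hS.isCenteredGaussian_cavity ha hf M).const_mul β
  have := hκ.isProbabilityMeasure
  have := hK.isProbabilityMeasure
  have hX := hκ.prod hK (τ := ℕ × SpinConfig M) Prod.fst Prod.snd (fun _ => β * Real.sqrt M)
    fun _ => β
  have hsq : (β * Real.sqrt M) * (β * Real.sqrt M) = β ^ 2 * M := by
    rw [mul_mul_mul_comm, Real.mul_self_sqrt (Nat.cast_nonneg M), sq]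
  have key := hX.integral_lse_le_of_summable hV (v := β ^ 2 * (M / 2 * covDeriv (covFun a) 1))
    (fun p => by
      rw [hS.kappaCov_self ha, interactionCov_self ha, hsq]
      exact le_of_eq (by ring))
    (fun p => by rw [hS.cavityCov_self hM])
    (hS.cavityWeight_nonneg β h M) (hS.summable_cavityWeight β h M)
    (hS.tsum_cavityWeight_pos β h M) fun p p' => by
      simp only [hS.kappaCov_self ha, interactionCov_self ha, hS.cavityCov_self hM, hsq]
      rw [kappaCov, cavityCov, interactionCov, covPhi]
      have ht := hconv.tangent_le hf (hS.q_mem_Icc p.1 p'.1) (overlap_mem_Icc p.2 p'.2)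
      have := mul_le_mul_of_nonneg_left ht (by positivity : (0 : ℝ) ≤ β ^ 2 * M / 2)
      linarith
  rw [hS.integral_logRatio ha hf β h hM]
  have hlse : ∀ᵐ x ∂((gaussianLaw (S.kappaCov (covFun a) ω)).prod
      (gaussianLaw (interactionCov a M))),
      lse (S.cavityWeight β h M ω) (fun p => β * Real.sqrt M * x.1 p.1 + β * x.2 p.2) =
      lse (fun n => S.ξ n ω) (fun n => β * Real.sqrt M * x.1 n) +
        lse (spinWeight β h) (fun σ => β * x.2 σ) := by
    have h1 := (hκ.const_mul (β * Real.sqrt M)).ae_summable_exp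
      (fun n => by rw [hS.kappaCov_self ha]) hS.nonneg hS.summable
    filter_upwards [Measure.quasiMeasurePreserving_fst.ae h1] with x hx
    exact lse_prod (y := fun σ => β * x.2 σ) hS.nonneg (fun σ => (spinWeight_pos β h σ).le) hx.1
      (hasSum_fintype _).summable (tsum_mul_exp_pos hS.nonneg hS.sum_pos hx.1)
      (by rw [tsum_fintype]
          exact sum_mul_exp_pos (fun σ => (spinWeight_pos β h σ).le) (sum_spinWeight_pos M β h) _)
  have iK := (hK.const_mul β).integrable_lse (fun σ => (spinWeight_pos β h σ).le)
    (sum_spinWeight_pos M β h)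
  rw [integral_congr_ae hlse, integral_add ((hS.integrable_lse_kappa ha hf β M).comp_fst _)
    (iK.comp_snd _), integral_fun_fst (fun x : ℕ → ℝ =>
      lse (fun n => S.ξ n ω) fun n => β * Real.sqrt M * x n),
    integral_fun_snd (fun k : SpinConfig M → ℝ => lse (spinWeight β h) fun σ => β * k σ),
    ← meanLogPartition_eq_integral_lse] at key
  simp only [probReal_univ, one_smul] at key
  linarith

end ROSt.IsRegular

/-! ### Measurability of the functional in the overlap structure -/

/-- The logarithm of the ratio defining `G_M`, as a function of the weights (truncated to
nonnegative values) and of the two fields. -/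
def logRatioOf (β h : ℝ) (M : ℕ) (ξ : ℕ → ℝ) (x : (ℕ → ℝ) × (ℕ × SpinConfig M → ℝ)) : ℝ :=
  Real.log
    ((∑' n, ∑ σ : SpinConfig M, max (ξ n) 0 * Real.exp (β * (x.2 (n, σ) + fieldTerm h σ))) /
      (∑' n, max (ξ n) 0 * Real.exp (β * Real.sqrt (M : ℝ) * x.1 n)))

theorem measurable_logRatioOf (β h : ℝ) (M : ℕ) :
    Measurable fun p : (ℕ → ℝ) × (ℕ → ℝ) × (ℕ × SpinConfig M → ℝ) =>
      logRatioOf β h M p.1 p.2 := by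
  unfold logRatioOf
  refine Measurable.log (Measurable.div ?_ ?_)
  · exact measurable_tsum_of_nonneg (fun n => by fun_prop)
      fun n p => Finset.sum_nonneg fun σ _ => mul_nonneg (le_max_right _ _) (Real.exp_pos _).le
  · exact measurable_tsum_of_nonneg (fun n => by fun_prop)
      fun n p => mul_nonneg (le_max_right _ _) (Real.exp_pos _).le

theorem ROSt.IsRegular.logRatio_eq {S : ROSt.{v}} {ω : S.Ω} (hS : S.IsRegular ω) (β h : ℝ) (M : ℕ) :
    S.logRatio β h M ω = logRatioOf β h M fun n => S.ξ n ω := by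
  funext x
  simp only [ROSt.logRatio, logRatioOf, max_eq_left (hS.nonneg _)]

/-- A continuous function on `[-1, 1]`, extended to a measurable function on the line. -/
theorem measurable_comp_projIcc {g : ℝ → ℝ} (hg : ContinuousOn g (Icc (-1 : ℝ) 1)) :
    Measurable fun x => g (projIcc (-1 : ℝ) 1 (by norm_num) x) :=
  (continuousOn_iff_continuous_domRestrict.1 hg |>.comp continuous_projIcc).measurable

theorem stronglyMeasurable_integral_logRatioOf (β h : ℝ) (M : ℕ) {Ω : Type*} [MeasurableSpace Ω]
    {ξ : Ω → ℕ → ℝ} (hξ : ∀ n, Measurable fun ω => ξ ω n) {C : Ω → ℕ → ℕ → ℝ}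
    (hC : ∀ n n', Measurable fun ω => C ω n n')
    {D : Ω → ℕ × SpinConfig M → ℕ × SpinConfig M → ℝ} (hD : ∀ x y, Measurable fun ω => D ω x y)
    {g : ℝ → ℝ} (hg : Measurable g) :
    StronglyMeasurable fun ω => ∫ z, g (logRatioOf β h M (ξ ω)
      (gaussField (C ω) z.1, gaussField (D ω) z.2)) ∂(stdNoise.prod stdNoise) := by
  have hc := measurable_gaussField hC
  have hd := measurable_gaussField hD
  have m0 : Measurable fun p : Ω × (ℕ → ℝ) × (ℕ → ℝ) => ξ p.1 :=
    measurable_pi_lambda _ fun n => (hξ n).comp measurable_fst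
  have m1 : Measurable fun p : Ω × (ℕ → ℝ) × (ℕ → ℝ) => gaussField (C p.1) p.2.1 :=
    hc.comp (measurable_fst.prodMk measurable_snd.fst)
  have m2 : Measurable fun p : Ω × (ℕ → ℝ) × (ℕ → ℝ) => gaussField (D p.1) p.2.2 :=
    hd.comp (measurable_fst.prodMk measurable_snd.snd)
  have m3 := hg.comp ((measurable_logRatioOf β h M).comp (m0.prodMk (m1.prodMk m2)))
  exact StronglyMeasurable.integral_prod_right (f := fun ω (z : (ℕ → ℝ) × (ℕ → ℝ)) =>
    g (logRatioOf β h M (ξ ω) (gaussField (C ω) z.1, gaussField (D ω) z.2))) m3.stronglyMeasurable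

/-- Both laws are images of white noise under a map depending measurably on the covariance, so that
the mean over the fields is a parametric integral with respect to a fixed measure. -/
theorem ROSt.aestronglyMeasurable_integral_fieldLaw {a : ℕ → ℝ}
    (ha : HasSum (fun r : ℕ => |a (r + 1)| ^ 2) 1)
    (hf : ContDiffOn ℝ 2 (covFun a) (Icc (-1 : ℝ) 1)) (β h : ℝ) (M : ℕ) (S : ROSt.{v})
    {g : ℝ → ℝ} (hg : Measurable g) :
    AEStronglyMeasurable
      (fun ω => ∫ x, g (S.logRatio β h M ω x) ∂(S.fieldLaw (covFun a) M ω)) S.μ := by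
  -- the overlaps lie in `[-1, 1]` only almost surely, and `f`, `f'` are continuous only there
  obtain ⟨c, hc⟩ : ∃ c : S.Ω → ℕ → ℕ → ℝ, c = fun ω n n' =>
    ((projIcc (-1 : ℝ) 1 (by norm_num) (S.q n n' ω) : Icc (-1 : ℝ) 1) : ℝ) := ⟨_, rfl⟩
  obtain ⟨Cκ, hCκ⟩ : ∃ C : S.Ω → ℕ → ℕ → ℝ, C = fun ω n n' =>
    covPhi (covFun a) (c ω n n') / 2 := ⟨_, rfl⟩
  obtain ⟨CV, hCV⟩ : ∃ C : S.Ω → ℕ × SpinConfig M → ℕ × SpinConfig M → ℝ, C = fun ω x y =>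
    (M : ℝ) / 2 * covDeriv (covFun a) (c ω x.1 y.1) * overlap x.2 y.2 := ⟨_, rfl⟩
  have hcont : ContinuousOn (covPhi (covFun a)) (Icc (-1 : ℝ) 1) :=
    (continuousOn_id.mul (continuousOn_covDeriv hf)).sub hf.continuousOn
  have mκ : ∀ n n', Measurable fun ω => Cκ ω n n' := fun n n' => by
    rw [hCκ, hc]
    exact ((measurable_comp_projIcc hcont).comp (S.measurable_q n n')).div_const 2
  have mV : ∀ x y, Measurable fun ω => CV ω x y := fun x y => by
    rw [hCV, hc]
    exact (((measurable_comp_projIcc (continuousOn_covDeriv hf)).comp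
        (S.measurable_q x.1 y.1)).const_mul _).mul_const _
  refine ⟨fun ω => ∫ z, g (logRatioOf β h M (fun n => S.ξ n ω)
      (gaussField (Cκ ω) z.1, gaussField (CV ω) z.2)) ∂(stdNoise.prod stdNoise),
    stronglyMeasurable_integral_logRatioOf β h M S.measurable_ξ mκ mV hg, ?_⟩
  filter_upwards [S.ae_isRegular] with ω hω
  have e0 : c ω = fun n n' => S.q n n' ω := by
    funext n n'
    simp only [hc, projIcc_of_mem _ (hω.q_mem_Icc n n')]
  have eκ : S.kappaCov (covFun a) ω = Cκ ω := by
    simp only [hCκ, e0]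
    rfl
  have eV : S.cavityCov (covFun a) M ω = CV ω := by
    simp only [hCV, e0]
    rfl
  have hpκ : (Matrix.of (S.kappaCov (covFun a) ω)).PosSemidef := hω.kappaCov_posSemidef ha hf
  have hpV : (Matrix.of (S.cavityCov (covFun a) M ω)).PosSemidef := hω.cavityCov_posSemidef ha hf M
  have m1 : Measurable (gaussField (Cκ ω)) := (measurable_gaussField mκ).comp measurable_prodMk_left
  have m2 : Measurable (gaussField (CV ω)) := (measurable_gaussField mV).comp measurable_prodMk_left
  rw [fieldLaw, gaussianLaw_eq_map_gaussField hpκ, gaussianLaw_eq_map_gaussField hpV, eκ, eV,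
    Measure.map_prod_map _ _ m1 m2, hω.logRatio_eq, integral_map (m1.prodMap m2).aemeasurable]
  · rfl
  · exact (hg.comp ((measurable_logRatioOf β h M).comp
      measurable_prodMk_left)).aestronglyMeasurable

theorem ROSt.gWellDefined {a : ℕ → ℝ}
    (ha : HasSum (fun r : ℕ => |a (r + 1)| ^ 2) 1)
    (hf : ContDiffOn ℝ 2 (covFun a) (Icc (-1 : ℝ) 1)) (β h : ℝ) {M : ℕ} (hM : 1 ≤ M)
    (S : ROSt.{v}) : ROSt.GWellDefined (covFun a) β h M S := by
  have hint : Integrable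
      (fun ω => ∫ x, |S.logRatio β h M ω x| ∂(S.fieldLaw (covFun a) M ω)) S.μ := by
    refine Integrable.of_bound (S.aestronglyMeasurable_integral_fieldLaw ha hf β h M
      (g := fun t => |t|) (by fun_prop))
      (C := 2 * Real.exp (β ^ 2 * (M / 2 * covDeriv (covFun a) 1) / 2) +
        2 * Real.exp ((β * Real.sqrt M) ^ 2 * ((covDeriv (covFun a) 1 - 1) / 2) / 2) +
        |Real.log (∑ σ : SpinConfig M, spinWeight β h σ)|) (S.ae_isRegular.mono fun ω hω => ?_)
    rw [Real.norm_of_nonneg (integral_nonneg fun x => abs_nonneg _)]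
    exact hω.integral_abs_logRatio_le ha hf β h hM
  exact {
    kappa_law := S.ae_isRegular.mono fun ω hω => hω.isCenteredGaussian_kappa ha hf
    cavity_law := S.ae_isRegular.mono fun ω hω => hω.isCenteredGaussian_cavity ha hf M
    integrable_fields := S.ae_isRegular.mono fun ω hω => hω.integrable_logRatio ha hf β h hM
    integrable_rost := hint
    integrable_mean := hint.mono' (S.aestronglyMeasurable_integral_fieldLaw ha hf β h M
      (g := fun t => t) measurable_id) (ae_of_all _ fun ω => norm_integral_le_integral_norm _) }

/-- The upper bound on the pressure by the functional of any overlap structure. -/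
theorem meanLogPartition_div_le_G {a : ℕ → ℝ}
    (ha : HasSum (fun r : ℕ => |a (r + 1)| ^ 2) 1)
    (hconv : ConvexOn ℝ (Icc (-1 : ℝ) 1) (covFun a))
    (hf : ContDiffOn ℝ 2 (covFun a) (Icc (-1 : ℝ) 1)) (β h : ℝ) {M : ℕ} (hM : 1 ≤ M)
    (S : ROSt.{v}) :
    (1 / (M : ℝ)) * meanLogPartition a β h M ≤ ROSt.G (covFun a) β h M S := by
  refine mul_le_mul_of_nonneg_left ?_ (by positivity)
  have h1 := integral_mono_ae (integrable_const (meanLogPartition a β h M))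
    (S.gWellDefined ha hf β h hM).integrable_mean (S.ae_isRegular.mono fun ω hω =>
      hω.meanLogPartition_le_integral_logRatio ha hconv hf β h hM)
  simpa using h1

/-! ### The cavity overlap structures -/

/-- A positive weight on the configurations of `N` spins, listed in decreasing order and completed
by zeros, gives a deterministic overlap structure; `j` sends a configuration to its rank. -/
theorem exists_rost_of_weight {N : ℕ} (hN : 1 ≤ N) {w : SpinConfig N → ℝ} (hw : ∀ α, 0 < w α) :
    ∃ (S : ROSt.{v}) (ω : S.Ω) (j : SpinConfig N → ℕ),
      (∀ F : S.Ω → ℝ, ∫ x, F x ∂S.μ = F ω) ∧ S.IsRegular ω ∧ Function.Injective j ∧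
      (∀ α, S.ξ (j α) ω = w α) ∧ (∀ n, n ∉ range j → S.ξ n ω = 0) ∧
      ∀ α α', S.q (j α) (j α') ω = overlap α α' := by
  set m := Fintype.card (SpinConfig N) with hm
  let e₀ : Fin m ≃ SpinConfig N := (Fintype.equivFin (SpinConfig N)).symm
  let e : Fin m ≃ SpinConfig N := (Tuple.sort fun i => -w (e₀ i)).trans e₀
  have he : ∀ i i' : Fin m, i ≤ i' → w (e i') ≤ w (e i) := fun i i' h =>
    neg_le_neg_iff.1 (Tuple.monotone_sort (fun i => -w (e₀ i)) h)
  have hm0 : 0 < m := Fintype.card_pos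
  let ξ : ℕ → ℝ := fun n => if h : n < m then w (e ⟨n, h⟩) else 0
  let c : ℕ → SpinConfig N := fun n => if h : n < m then e ⟨n, h⟩ else e ⟨0, hm0⟩
  have hξ0 : ∀ n, 0 ≤ ξ n := fun n => by
    by_cases h : n < m
    · simp only [ξ, dif_pos h]; exact (hw _).le
    · simp only [ξ, dif_neg h]; exact le_rfl
  have hanti : Antitone ξ := fun n n' hn => by
    by_cases h' : n' < m
    · have h : n < m := hn.trans_lt h'
      simp only [ξ, dif_pos h, dif_pos h']
      exact he ⟨n, h⟩ ⟨n', h'⟩ hn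
    · simp only [ξ, dif_neg h']
      exact hξ0 n
  have hsum : Summable ξ := summable_of_ne_finset_zero (s := Finset.range m) fun n hn => by
    simp only [ξ, dif_neg (fun h => hn (Finset.mem_range.2 h))]
  have hpos : 0 < ∑' n, ξ n := hsum.tsum_pos hξ0 0 (by simp only [ξ, dif_pos hm0]; exact hw _)
  have hpsd : (Matrix.of fun n n' => overlap (c n) (c n')).PosSemidef :=
    posSemidef_of_comp (overlap_posSemidef N) c
  let S : ROSt.{v} :=
    { Ω := PUnit
      mΩ := inferInstance
      μ := Measure.dirac PUnit.unit
      isProb := inferInstance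
      ξ := fun n _ => ξ n
      q := fun n n' _ => overlap (c n) (c n')
      measurable_ξ := fun _ => measurable_const
      measurable_q := fun _ _ => measurable_const
      ordered := ae_of_all _ fun _ => hanti
      nonneg := ae_of_all _ fun _ => hξ0
      summable := ae_of_all _ fun _ => hsum
      sum_pos := ae_of_all _ fun _ => hpos
      posSemidef := ae_of_all _ fun _ => hpsd
      diag_one := ae_of_all _ fun _ n => overlap_self hN (c n) }
  have hlt : ∀ α, (e.symm α : ℕ) < m := fun α => (e.symm α).2
  have hc : ∀ α, c (e.symm α : ℕ) = α := fun α => by simp only [c, dif_pos (hlt α), Fin.eta,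
    Equiv.apply_symm_apply]
  refine ⟨S, PUnit.unit, fun α => (e.symm α : ℕ),
    fun F => integral_dirac F PUnit.unit,
    ⟨hξ0, hsum, hpos, hpsd, fun n => overlap_self hN (c n)⟩,
    Fin.val_injective.comp e.symm.injective, fun α => ?_, fun n hn => ?_, fun α α' => ?_⟩
  · simp only [S, ξ, dif_pos (hlt α), Fin.eta, Equiv.apply_symm_apply]
  · have h : ¬ n < m := fun h => hn ⟨e ⟨n, h⟩, by simp⟩
    simp only [S, ξ, dif_neg h]
  · simp only [S, hc]

/-- Indices of zero weight can be dropped. -/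
theorem lse_eq_of_injective {ι κ : Type*} {w : ι → ℝ} {j : κ → ι} (hj : Function.Injective j)
    (h0 : ∀ i, i ∉ range j → w i = 0) (x : ι → ℝ) :
    lse w x = lse (fun k => w (j k)) (fun k => x (j k)) := by
  rw [lse, lse, hj.tsum_eq (f := fun i => w i * Real.exp (x i))]
  intro i hi
  by_contra h
  exact hi (by simp [h0 i h])

/-- Multiplying the weights amounts to shifting the field. -/
theorem lse_mul_exp {ι : Type*} (w y x : ι → ℝ) :
    lse (fun i => w i * Real.exp (y i)) x = lse w (fun i => y i + x i) := by
  simp only [lse, mul_assoc, ← Real.exp_add]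

/-- The covariance of `κ` on the overlap structure made of the configurations of `N` spins. -/
def spinKappaCov (a : ℕ → ℝ) (N : ℕ) (α α' : SpinConfig N) : ℝ :=
  covPhi (covFun a) (overlap α α') / 2

/-- The covariance of the cavity field on the overlap structure made of the configurations of
`N` spins. -/
def spinCavityCov (a : ℕ → ℝ) (N M : ℕ) (x y : SpinConfig N × SpinConfig M) : ℝ :=
  (M : ℝ) / 2 * covDeriv (covFun a) (overlap x.1 y.1) * overlap x.2 y.2

/-- The covariance of the bath: that of `K_{N+M}`, with the contribution of the last `M` spins to the
overlap removed. -/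
def reducedCov (a : ℕ → ℝ) (N M : ℕ) (α α' : SpinConfig N) : ℝ :=
  ((N : ℝ) + M) / 2 * covFun a (N / ((N : ℝ) + M) * overlap α α')

section

variable {a : ℕ → ℝ}

theorem isCenteredGaussian_spinKappa (ha : HasSum (fun r : ℕ => |a (r + 1)| ^ 2) 1)
    (hf : ContDiffOn ℝ 2 (covFun a) (Icc (-1 : ℝ) 1)) (N : ℕ) :
    IsCenteredGaussian (fun α (x : SpinConfig N → ℝ) => x α) (gaussianLaw (spinKappaCov a N))
      (spinKappaCov a N) := by
  refine isGaussianLaw_gaussianLaw ?_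
  have := posSemidef_of_const_mul (covPhi_posSemidef ha hf (overlap_posSemidef N) overlap_mem_Icc)
    (c := 1 / 2) (by norm_num)
  convert this using 3
  unfold spinKappaCov
  ext α
  ring

theorem isCenteredGaussian_spinCavity (ha : HasSum (fun r : ℕ => |a (r + 1)| ^ 2) 1)
    (hf : ContDiffOn ℝ 2 (covFun a) (Icc (-1 : ℝ) 1)) (N M : ℕ) :
    IsCenteredGaussian (fun p (x : SpinConfig N × SpinConfig M → ℝ) => x p)
      (gaussianLaw (spinCavityCov a N M)) (spinCavityCov a N M) :=
  isGaussianLaw_gaussianLaw <| posSemidef_of_mul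
    (posSemidef_of_comp (posSemidef_of_const_mul
      (covDeriv_posSemidef ha hf (overlap_posSemidef N) overlap_mem_Icc)
      (by positivity : (0 : ℝ) ≤ (M : ℝ) / 2)) Prod.fst)
    (posSemidef_of_comp (overlap_posSemidef M) Prod.snd)

theorem ratio_mul_mem_Icc (N M : ℕ) {x : ℝ} (hx : x ∈ Icc (-1 : ℝ) 1) :
    N / ((N : ℝ) + M) * x ∈ Icc (-1 : ℝ) 1 := by
  rw [mem_Icc, ← abs_le, abs_mul, abs_of_nonneg (by positivity)]
  exact mul_le_one₀ (div_le_one_of_le₀ (by simp) (by positivity)) (abs_nonneg _) (abs_le.2 hx)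

theorem isCenteredGaussian_reduced (ha : HasSum (fun r : ℕ => |a (r + 1)| ^ 2) 1) (N M : ℕ) :
    IsCenteredGaussian (fun α (x : SpinConfig N → ℝ) => x α) (gaussianLaw (reducedCov a N M))
      (reducedCov a N M) :=
  isGaussianLaw_gaussianLaw <| posSemidef_of_const_mul (covFun_posSemidef ha
    (posSemidef_of_const_mul (overlap_posSemidef N) (by positivity))
    fun α α' => ratio_mul_mem_Icc N M (overlap_mem_Icc α α')) (by positivity)

/-- The functional of the overlap structure given by weights `w` on the configurations of `N` spins,
as a difference of two mean free energies over finite index sets. -/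
theorem exists_G_eq (ha : HasSum (fun r : ℕ => |a (r + 1)| ^ 2) 1)
    (hf : ContDiffOn ℝ 2 (covFun a) (Icc (-1 : ℝ) 1)) (β h : ℝ) {N M : ℕ} (hN : 1 ≤ N)
    (hM : 1 ≤ M) {w : SpinConfig N → ℝ} (hw : ∀ α, 0 < w α) :
    ∃ S : ROSt.{v}, ROSt.G (covFun a) β h M S = (1 / (M : ℝ)) *
      (∫ y, lse (fun p : SpinConfig N × SpinConfig M => w p.1 * spinWeight β h p.2)
          (fun p => β * y p) ∂(gaussianLaw (spinCavityCov a N M)) -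
        ∫ x, lse w (fun α => β * Real.sqrt M * x α) ∂(gaussianLaw (spinKappaCov a N))) := by
  obtain ⟨S, ω, j, hμ, hS, hj, hξ, hξ0, hq⟩ := exists_rost_of_weight.{v} hN hw
  refine ⟨S, ?_⟩
  rw [ROSt.G, hμ, hS.integral_logRatio ha hf β h hM]
  congr 2
  · have hj' : Function.Injective (Prod.map j (id : SpinConfig M → SpinConfig M)) :=
      hj.prodMap Function.injective_id
    have h0 : ∀ p, p ∉ range (Prod.map j (id : SpinConfig M → SpinConfig M)) →
        S.cavityWeight β h M ω p = 0 := fun p hp => by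
      have : p.1 ∉ range j := fun ⟨α, hα⟩ => hp ⟨(α, p.2), Prod.ext hα rfl⟩
      rw [ROSt.cavityWeight, hξ0 _ this, zero_mul]
    simp only [lse_eq_of_injective hj' h0]
    have hV := (hS.isCenteredGaussian_cavity ha hf M).comp
      (Prod.map j (id : SpinConfig M → SpinConfig M))
    have hcov : (fun p p' : SpinConfig N × SpinConfig M => S.cavityCov (covFun a) M ω
        (Prod.map j id p) (Prod.map j id p')) = spinCavityCov a N M := by
      funext p p'
      simp only [ROSt.cavityCov, Prod.map_fst, Prod.map_snd, hq, id, spinCavityCov]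
    rw [hcov] at hV
    have := hV.integral_comp_eq (isCenteredGaussian_spinCavity ha hf N M)
      (F := fun y => lse (fun p : SpinConfig N × SpinConfig M => w p.1 * spinWeight β h p.2)
        (fun p => β * y p)) ((measurable_lse fun p =>
          mul_nonneg (hw _).le (spinWeight_pos β h _).le).comp (by fun_prop))
    rw [← this]
    simp only [ROSt.cavityWeight, Prod.map_fst, Prod.map_snd, hξ, id]
  · simp only [lse_eq_of_injective hj hξ0, hξ]
    have hκ := (hS.isCenteredGaussian_kappa ha hf).comp j
    have hcov : (fun α α' : SpinConfig N => S.kappaCov (covFun a) ω (j α) (j α')) =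
        spinKappaCov a N := by
      funext α α'
      simp only [ROSt.kappaCov, hq, spinKappaCov]
    rw [hcov] at hκ
    exact hκ.integral_comp_eq (isCenteredGaussian_spinKappa ha hf N)
      (F := fun x => lse w (fun α => β * Real.sqrt M * x α))
      ((measurable_lse fun α => (hw α).le).comp (by fun_prop))

/-- The field of the numerator approximates the interaction of `N + M` spins. -/
theorem abs_interactionCov_sub_le {B : ℝ} (hB : 0 ≤ B)
    (hT : ∀ x ∈ Icc (-1 : ℝ) 1, ∀ y ∈ Icc (-1 : ℝ) 1,
      |covDeriv (covFun a) y - covDeriv (covFun a) x| ≤ B * |y - x| ∧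
      |covFun a y - covFun a x - covDeriv (covFun a) x * (y - x)| ≤ B * (y - x) ^ 2)
    {N M : ℕ} (hM : 1 ≤ M) (p p' : SpinConfig N × SpinConfig M) :
    |interactionCov a (N + M) (Fin.append p.1 p.2) (Fin.append p'.1 p'.2) -
      (reducedCov a N M p.1 p'.1 + spinCavityCov a N M p p')| ≤ B * M ^ 2 / ((N : ℝ) + M) := by
  have hL : (0 : ℝ) < (N : ℝ) + M := by positivity
  -- `q` is the overlap of the bath, `r` of the cavity, `s` of the whole, `x = N q / (N + M)`
  have hq := overlap_mem_Icc p.1 p'.1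
  have hr := overlap_mem_Icc p.2 p'.2
  have hs := overlap_mem_Icc (Fin.append p.1 p.2) (Fin.append p'.1 p'.2)
  have hx := ratio_mul_mem_Icc N M hq
  have hap := overlap_append p.1 p'.1 p.2 p'.2
  rw [interactionCov, reducedCov, spinCavityCov]
  generalize overlap (Fin.append p.1 p.2) (Fin.append p'.1 p'.2) = s at *
  generalize overlap p.1 p'.1 = q at *
  generalize overlap p.2 p'.2 = r at *
  have hsx : s - N / ((N : ℝ) + M) * q = M / ((N : ℝ) + M) * r := by
    field_simp
    linarith
  have hqx : q - N / ((N : ℝ) + M) * q = M / ((N : ℝ) + M) * q := by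
    field_simp
    ring
  obtain ⟨-, h1⟩ := hT _ hx _ hs
  obtain ⟨h2, -⟩ := hT _ hx _ hq
  rw [hsx] at h1
  rw [hqx, abs_mul, abs_of_nonneg (by positivity : (0 : ℝ) ≤ M / ((N : ℝ) + M))] at h2
  generalize covFun a s = fs at *
  generalize covFun a (N / ((N : ℝ) + M) * q) = fx at *
  generalize covDeriv (covFun a) (N / ((N : ℝ) + M) * q) = dx at *
  generalize covDeriv (covFun a) q = dq at *
  have hr2 : r ^ 2 ≤ 1 := (sq_le_one_iff_abs_le_one r).2 (abs_le.2 hr)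
  have hr1 : |r| ≤ 1 := abs_le.2 hr
  have hq1 : |q| ≤ 1 := abs_le.2 hq
  have e : ((N + M : ℕ) : ℝ) / 2 * fs - (((N : ℝ) + M) / 2 * fx + M / 2 * dq * r) =
      ((N : ℝ) + M) / 2 * (fs - fx - dx * (M / ((N : ℝ) + M) * r)) - M / 2 * ((dq - dx) * r) := by
    push_cast
    field_simp
    ring
  rw [e]
  have t1 : |((N : ℝ) + M) / 2 * (fs - fx - dx * (M / ((N : ℝ) + M) * r))| ≤
      B * M ^ 2 / ((N : ℝ) + M) / 2 := by
    rw [abs_mul, abs_of_pos (by positivity)]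
    calc _ ≤ ((N : ℝ) + M) / 2 * (B * (M / ((N : ℝ) + M) * r) ^ 2) := by gcongr
      _ = B * M ^ 2 / ((N : ℝ) + M) / 2 * r ^ 2 := by field_simp
      _ ≤ _ := mul_le_of_le_one_right (by positivity) hr2
  have t2 : |(M : ℝ) / 2 * ((dq - dx) * r)| ≤ B * M ^ 2 / ((N : ℝ) + M) / 2 := by
    rw [abs_mul, abs_mul, abs_of_nonneg (by positivity : (0 : ℝ) ≤ (M : ℝ) / 2)]
    calc _ ≤ (M : ℝ) / 2 * ((B * (M / ((N : ℝ) + M) * 1)) * 1) := by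
          gcongr
          exact h2.trans (by gcongr)
      _ = _ := by field_simp
  calc _ ≤ _ := abs_sub _ _
    _ ≤ B * M ^ 2 / ((N : ℝ) + M) / 2 + B * M ^ 2 / ((N : ℝ) + M) / 2 := add_le_add t1 t2
    _ = _ := by ring

/-- The field of the denominator approximates the interaction of `N` spins. -/
theorem abs_interactionCov_sub_le' {B : ℝ} (hB : 0 ≤ B)
    (hT : ∀ x ∈ Icc (-1 : ℝ) 1, ∀ y ∈ Icc (-1 : ℝ) 1,
      |covDeriv (covFun a) y - covDeriv (covFun a) x| ≤ B * |y - x| ∧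
      |covFun a y - covFun a x - covDeriv (covFun a) x * (y - x)| ≤ B * (y - x) ^ 2)
    {N M : ℕ} (hM : 1 ≤ M) (α α' : SpinConfig N) :
    |reducedCov a N M α α' + M * spinKappaCov a N α α' - interactionCov a N α α'| ≤
      B * M ^ 2 / ((N : ℝ) + M) := by
  have hL : (0 : ℝ) < (N : ℝ) + M := by positivity
  have hq := overlap_mem_Icc α α'
  have hx := ratio_mul_mem_Icc N M hq
  rw [interactionCov, reducedCov, spinKappaCov, covPhi]
  generalize overlap α α' = q at *
  have hqx : N / ((N : ℝ) + M) * q - q = -(M / ((N : ℝ) + M) * q) := by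
    field_simp
    ring
  obtain ⟨-, h1⟩ := hT _ hq _ hx
  rw [hqx] at h1
  have hq2 : q ^ 2 ≤ 1 := (sq_le_one_iff_abs_le_one q).2 (abs_le.2 hq)
  generalize covFun a q = fq at *
  generalize covFun a (N / ((N : ℝ) + M) * q) = fx at *
  generalize covDeriv (covFun a) q = dq at *
  have e : ((N : ℝ) + M) / 2 * fx + M * ((q * dq - fq) / 2) - (N : ℝ) / 2 * fq =
      ((N : ℝ) + M) / 2 * (fx - fq - dq * -(M / ((N : ℝ) + M) * q)) := by
    field_simp
    ring
  rw [e, abs_mul, abs_of_pos (by positivity)]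
  calc _ ≤ ((N : ℝ) + M) / 2 * (B * (-(M / ((N : ℝ) + M) * q)) ^ 2) := by gcongr
    _ = B * M ^ 2 / ((N : ℝ) + M) * (q ^ 2 / 2) := by field_simp
    _ ≤ _ := mul_le_of_le_one_right (by positivity) (by linarith)

end

/-! ### The limit of the variational problem -/

section

variable {a : ℕ → ℝ}

/-- For each realization of the bath interaction of `N` spins, the Boltzmann weights of the bath give
an overlap structure. The average of its functional is at most the increment of the mean free energy
from `N` to `N + M` spins, up to an error of order `1 / N`; some realization does at least as well as
the average. -/
theorem exists_G_le_increment (ha : HasSum (fun r : ℕ => |a (r + 1)| ^ 2) 1)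
    (hf : ContDiffOn ℝ 2 (covFun a) (Icc (-1 : ℝ) 1)) (β h : ℝ) {B : ℝ} (hB : 0 ≤ B)
    (hT : ∀ x ∈ Icc (-1 : ℝ) 1, ∀ y ∈ Icc (-1 : ℝ) 1,
      |covDeriv (covFun a) y - covDeriv (covFun a) x| ≤ B * |y - x| ∧
      |covFun a y - covFun a x - covDeriv (covFun a) x * (y - x)| ≤ B * (y - x) ^ 2)
    {N M : ℕ} (hN : 1 ≤ N) (hM : 1 ≤ M) :
    ∃ S : ROSt.{v}, M * ROSt.G (covFun a) β h M S ≤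
      meanLogPartition a β h (N + M) - meanLogPartition a β h N +
        2 * (β ^ 2 * (B * M ^ 2 / ((N : ℝ) + M))) := by
  have hk := isCenteredGaussian_reduced ha N M
  have hκ := isCenteredGaussian_spinKappa ha hf N
  have hV := isCenteredGaussian_spinCavity ha hf N M
  have hK := isCenteredGaussian_interaction ha N
  have hKM := isCenteredGaussian_interaction ha (N + M)
  have := hk.isProbabilityMeasure
  have := hκ.isProbabilityMeasure
  have := hV.isProbabilityMeasure
  set δ := B * M ^ 2 / ((N : ℝ) + M) with hδ
  have hsq : (β * Real.sqrt M) * (β * Real.sqrt M) = β ^ 2 * M := by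
    rw [mul_mul_mul_comm, Real.mul_self_sqrt (Nat.cast_nonneg M), sq]
  -- the numerator and the denominator, averaged over the reduced interaction
  have hnum := hk.prod hV (τ := SpinConfig N × SpinConfig M) Prod.fst id (fun _ => β) (fun _ => β)
  have hden := hk.prod hκ (τ := SpinConfig N) id id (fun _ => β) (fun _ => β * Real.sqrt M)
  have hw : ∀ p : SpinConfig N × SpinConfig M, 0 ≤ spinWeight β h p.1 * spinWeight β h p.2 :=
    fun p => mul_nonneg (spinWeight_pos β h _).le (spinWeight_pos β h _).le
  have hW : 0 < ∑ p : SpinConfig N × SpinConfig M, spinWeight β h p.1 * spinWeight β h p.2 :=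
    Finset.sum_pos (fun p _ => mul_pos (spinWeight_pos β h _) (spinWeight_pos β h _))
      Finset.univ_nonempty
  have hw' : ∀ α : SpinConfig N, 0 ≤ spinWeight β h α := fun α => (spinWeight_pos β h _).le
  have hW' := sum_spinWeight_pos N β h
  have inum := hnum.integrable_lse hw hW
  have iden := hden.integrable_lse hw' hW'
  have knum := hnum.integral_lse_le
    ((hKM.comp fun p : SpinConfig N × SpinConfig M => Fin.append p.1 p.2).const_mul β) hw hW
    (c := 2 * (β ^ 2 * δ)) fun p p' => by
      have h1 := abs_le.1 (abs_interactionCov_sub_le hB hT hM p p)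
      have h2 := abs_le.1 (abs_interactionCov_sub_le hB hT hM p p')
      rw [← hδ] at h1 h2
      have := mul_le_mul_of_nonneg_left (add_le_add h1.1 (neg_le_neg h2.2)) (sq_nonneg β)
      simp only [id]
      linarith
  have kden := (hK.const_mul β).integral_lse_le hden hw' hW' (c := 2 * (β ^ 2 * δ)) fun p p' => by
      have h1 := abs_le.1 (abs_interactionCov_sub_le' hB hT hM p p)
      have h2 := abs_le.1 (abs_interactionCov_sub_le' hB hT hM p p')
      rw [← hδ] at h1 h2
      have := mul_le_mul_of_nonneg_left (add_le_add h1.1 (neg_le_neg h2.2)) (sq_nonneg β)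
      simp only [id, hsq]
      linarith
  have e2 : ∀ k : SpinConfig (N + M) → ℝ,
      lse (fun p : SpinConfig N × SpinConfig M => spinWeight β h p.1 * spinWeight β h p.2)
        (fun p => β * k (Fin.append p.1 p.2)) = lse (spinWeight β h) fun σ => β * k σ := fun k => by
    simp only [← spinWeight_append]
    exact lse_comp_equiv (Fin.appendEquiv N M) (spinWeight β h) fun σ => β * k σ
  simp only [e2] at knum
  rw [← meanLogPartition_eq_integral_lse] at knum kden
  have jnum := inum.integral_prod_left
  have jden := iden.integral_prod_left
  rw [integral_prod _ inum] at knum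
  rw [integral_prod _ iden] at kden
  obtain ⟨k, hkle⟩ := exists_le_integral (jnum.sub jden)
  rw [integral_sub' jnum jden] at hkle
  simp only [Pi.sub_apply, id] at hkle knum kden
  obtain ⟨S, hS⟩ := exists_G_eq.{v} ha hf β h hN hM
    (w := fun α => spinWeight β h α * Real.exp (β * k α))
    fun α => mul_pos (spinWeight_pos β h α) (Real.exp_pos _)
  refine ⟨S, ?_⟩
  have hM' : (M : ℝ) ≠ 0 := by positivity
  have e3 : ∀ y : SpinConfig N × SpinConfig M → ℝ,
      lse (fun p : SpinConfig N × SpinConfig M =>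
        spinWeight β h p.1 * Real.exp (β * k p.1) * spinWeight β h p.2) (fun p => β * y p) =
      lse (fun p => spinWeight β h p.1 * spinWeight β h p.2) fun p => β * k p.1 + β * y p :=
    fun y => by rw [← lse_mul_exp]; congr 1; funext p; ring
  rw [hS, ← mul_assoc, mul_one_div_cancel hM', one_mul]
  simp only [e3, lse_mul_exp]
  linarith

/-- If the increments of the mean free energy over `M` spins were eventually larger than
`M (P + ε)`, the mean free energy would exceed `N P`. -/
theorem exists_increment_le {Q : ℕ → ℝ} {P ε : ℝ} (hQ : ∀ N : ℕ, 1 ≤ N → Q N ≤ N * P) (hε : 0 < ε)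
    {M : ℕ} (hM : 1 ≤ M) (N₀ : ℕ) : ∃ N, N₀ ≤ N ∧ 1 ≤ N ∧ Q (N + M) - Q N ≤ M * (P + ε) := by
  by_contra! hcon
  have hM' : (1 : ℝ) ≤ M := by exact_mod_cast hM
  have hind : ∀ j : ℕ, Q (N₀ + 1) + j * (M * (P + ε)) ≤ Q (N₀ + 1 + j * M) := fun j => by
    induction j with
    | zero => simp
    | succ j ih =>
      have := hcon (N₀ + 1 + j * M) (by omega) (by omega)
      rw [show N₀ + 1 + (j + 1) * M = N₀ + 1 + j * M + M by ring]
      push_cast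
      linarith
  obtain ⟨j, hj⟩ := exists_nat_gt ((((N₀ + 1 : ℕ) : ℝ) * P - Q (N₀ + 1)) / ε)
  rw [div_lt_iff₀ hε] at hj
  have h1 := hind j
  have h2 := hQ (N₀ + 1 + j * M) (by omega)
  push_cast at h2 hj
  have h3 : (j : ℝ) * ε ≤ j * ε * M := le_mul_of_one_le_right (by positivity) hM'
  nlinarith

/-- The lower bound on the pressure by the functional of well-chosen overlap structures. -/
theorem exists_G_le (ha : HasSum (fun r : ℕ => |a (r + 1)| ^ 2) 1)
    (hf : ContDiffOn ℝ 2 (covFun a) (Icc (-1 : ℝ) 1)) (β h : ℝ) {P : ℝ}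
    (hP : ∀ N : ℕ, 1 ≤ N → meanLogPartition a β h N ≤ N * P) {M : ℕ} (hM : 1 ≤ M) {ε : ℝ}
    (hε : 0 < ε) : ∃ S : ROSt.{v}, ROSt.G (covFun a) β h M S ≤ P + ε := by
  obtain ⟨B, hB, hT⟩ := exists_taylor_bound hf
  have hM' : (0 : ℝ) < M := by exact_mod_cast hM
  obtain ⟨N₀, hN₀⟩ := exists_nat_gt (2 * (β ^ 2 * (B * M ^ 2)) / (M * (ε / 2)))
  obtain ⟨N, hN, hN1, hinc⟩ := exists_increment_le hP (half_pos hε) hM N₀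
  obtain ⟨S, hS⟩ := exists_G_le_increment.{v} ha hf β h hB hT hN1 hM
  refine ⟨S, ?_⟩
  rw [div_lt_iff₀ (by positivity)] at hN₀
  have hNN : (N₀ : ℝ) ≤ N := by exact_mod_cast hN
  have herr : 2 * (β ^ 2 * (B * M ^ 2 / ((N : ℝ) + M))) ≤ M * (ε / 2) := by
    have : 2 * (β ^ 2 * (B * M ^ 2 / ((N : ℝ) + M))) =
        2 * (β ^ 2 * (B * M ^ 2)) / ((N : ℝ) + M) := by ring
    rw [this, div_le_iff₀ (by positivity)]
    have h1 : (N₀ : ℝ) * (M * (ε / 2)) ≤ (N + M) * (M * (ε / 2)) := by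
      gcongr
      linarith
    linarith
  have : M * ROSt.G (covFun a) β h M S ≤ M * (P + ε) := by linarith
  exact le_of_mul_le_mul_left this hM'

end

theorem theoremC2
    (a : ℕ → ℝ)
    (ha : HasSum (fun r : ℕ => |a (r + 1)| ^ 2) 1)
    (hconv : ConvexOn ℝ (Icc (-1 : ℝ) 1) (covFun a))
    (hsmooth : ContDiffOn ℝ 2 (covFun a) (Icc (-1 : ℝ) 1))
    (β h : ℝ) :
    ∃ P : ℝ,
      ∀ (Ω : Type u) [MeasurableSpace Ω] (ν : Measure Ω) [IsProbabilityMeasure ν]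
        (K : (N : ℕ) → SpinConfig N → Ω → ℝ),
        (∀ N : ℕ, 1 ≤ N → IsInteraction ν (covFun a) (K N)) →
        -- existence of the limit of the pressure, and almost sure convergence
        ((∀ N : ℕ, 1 ≤ N →
            Integrable (fun ω => Real.log (partitionFn β h (fun σ => K N σ ω))) ν) ∧
          Tendsto (fun N : ℕ => pressure ν β h (K N)) atTop (𝓝 P) ∧
          ∀ᵐ ω ∂ν, Tendsto (fun N : ℕ => randomPressure β h (K N) ω) atTop (𝓝 P)) ∧
        -- the variational principle
        (0 ≤ β →
          (∀ M : ℕ, 1 ≤ M → ∀ S : ROSt.{v}, ROSt.GWellDefined (covFun a) β h M S) ∧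
          (∀ M : ℕ, 1 ≤ M →
            ((pressure ν β h (K M) : ℝ) : EReal) ≤
              ⨅ S : ROSt.{v}, ((ROSt.G (covFun a) β h M S : ℝ) : EReal)) ∧
          Tendsto (fun M : ℕ => ⨅ S : ROSt.{v}, ((ROSt.G (covFun a) β h M S : ℝ) : EReal))
            atTop (𝓝 (P : EReal))) := by
  obtain ⟨P, hlim, hsup⟩ := exists_tendsto_meanLogPartition ha hconv β h
  refine ⟨P, fun Ω _ ν _ K hK => ?_⟩
  have hpress : ∀ N : ℕ, 1 ≤ N → pressure ν β h (K N) = (1 / (N : ℝ)) * meanLogPartition a β h N :=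
    fun N hN => by rw [pressure, quenched_eq_meanLogPartition ha (hK N hN)]
  have hlim' : Tendsto (fun N : ℕ => pressure ν β h (K N)) atTop (𝓝 P) := by
    refine hlim.congr' ?_
    filter_upwards [eventually_ge_atTop 1] with N hN
    rw [hpress N hN]
    ring
  have hlower : ∀ M : ℕ, 1 ≤ M → ((pressure ν β h (K M) : ℝ) : EReal) ≤
      ⨅ S : ROSt.{v}, ((ROSt.G (covFun a) β h M S : ℝ) : EReal) := fun M hM =>
    le_iInf fun S => by
      rw [hpress M hM]
      exact EReal.coe_le_coe_iff.2 (meanLogPartition_div_le_G ha hconv hsmooth β h hM S)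
  refine ⟨⟨fun N hN => integrable_log_partitionFn (hK N hN) β h, hlim',
    ae_tendsto_randomPressure ha hK hlim⟩, fun _ =>
    ⟨fun M hM S => S.gWellDefined ha hsmooth β h hM, hlower, ?_⟩⟩
  refine tendsto_of_tendsto_of_tendsto_of_le_of_le'
    ((continuous_coe_real_ereal.tendsto P).comp hlim') tendsto_const_nhds ?_ ?_
  · filter_upwards [eventually_ge_atTop 1] with M hM using hlower M hM
  · filter_upwards [eventually_ge_atTop 1] with M hM
    refine EReal.le_of_forall_lt_iff_le.1 fun z hz => ?_
    have hz' : P < z := EReal.coe_lt_coe_iff.1 hz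
    obtain ⟨S, hS⟩ := exists_G_le.{v} ha hsmooth β h hsup hM (sub_pos.2 hz')
    exact (iInf_le _ S).trans (EReal.coe_le_coe_iff.2 (by linarith))

end
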